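/- Let $\kappa$ be an algebraically closed field of characteristic $0$. Let $W_1, W_2, X$ be connected fs (fine and saturated) log schemes whose underlying schemes are of finite length over $\operatorname{Spec}\kappa$ (i.e. finite over $\operatorname{Spec}\kappa$), so that each has exactly one point, and let $f_i : W_i \to X$ ($i=1,2$) be morphisms of log schemes over $\operatorname{Spec}\kappa$. Write $Q_1, Q_2, P$ for the stalks of the ghost sheaves $\mathcal M/\mathcal O^\times$ of $W_1, W_2, X$ at their (geometric) points, $\theta_i=\bar f_i^\flat : P \to Q_i$ for the homomorphisms induced by $f_i$, and $$\theta := (\theta_1^{\mathrm{gp}}, -\theta_2^{\mathrm{gp}}) : P^{\mathrm{gp}} \to Q_1^{\mathrm{gp}} \oplus Q_2^{\mathrm{gp}}.$$ For a commutative monoid $N$ put $N^* := \operatorname{Hom}(N,\mathbb Z)$, and let $\theta^t : Q_1^* \oplus Q_2^* \to P^*$, $(a,b)\mapsto a\circ\theta_1 - b\circ\theta_2$, be the transpose of $\theta$. Then: (1) If the fibre product $W_1 \times_X^{\mathrm{fs}} W_2$ in the category of fs log schemes is non-empty, then it has exactly $|\operatorname{coker}(\theta)_{\mathrm{tors}}|$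 connected components. (2) The torsion groups $\operatorname{coker}(\theta)_{\mathrm{tors}}$ and $\operatorname{coker}(\theta^t)_{\mathrm{tors}}$ are finite, and $|\operatorname{coker}(\theta)_{\mathrm{tors}}| = |\operatorname{coker}(\theta^t)_{\mathrm{tors}}|$. -/

import Mathlib

open CategoryTheory AlgebraicGeometry

universe u

namespace LogGeometry

open Limits Opposite

/-! ### Log schemes (for the étale topology) -/

/-- The presheaf `U ↦ (𝒪(U), ·)` of multiplicative monoids on the small étale site of `S`. -/
noncomputable def structureMonoid (S : Scheme.{u}) : S.Etaleᵒᵖ ⥤ CommMonCat.{u} :=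
  (Scheme.Etale.forget S ⋙ Over.forget S).op ⋙ Scheme.Γ ⋙ forget₂ CommRingCat CommMonCat

/-- Pull-back of functions `(𝒪(T), ·) ⟶ (𝒪(S), ·)` along a morphism of schemes `S ⟶ T`. -/
noncomputable def pullSections {S T : Scheme.{u}} (f : S ⟶ T) :
    (forget₂ CommRingCat CommMonCat).obj (Scheme.Γ.obj (op T)) ⟶
      (forget₂ CommRingCat CommMonCat).obj (Scheme.Γ.obj (op S)) :=
  (forget₂ CommRingCat CommMonCat).map (Scheme.Γ.map f.op)

theorem pullSections_comp {S T V : Scheme.{u}} (f : S ⟶ T) (g : T ⟶ V) :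
    pullSections (f ≫ g) = pullSections g ≫ pullSections f := by
  simp only [pullSections, op_comp, Functor.map_comp]

/-- A log scheme: a scheme with a sheaf of commutative monoids `M` on its small étale site and a
homomorphism `α : M ⟶ 𝒪` of sheaves of multiplicative monoids which restricts to an isomorphism
`α⁻¹(𝒪ˣ) ≅ 𝒪ˣ`. -/
structure LogScheme where
  /-- the underlying scheme -/
  toScheme : Scheme.{u}
  /-- the sheaf of monoids -/
  M : toScheme.Etaleᵒᵖ ⥤ CommMonCat.{u}
  isSheaf : Presheaf.IsSheaf toScheme.smallEtaleTopology M
  /-- the structure map -/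
  α : M ⟶ structureMonoid toScheme
  existsUnique_of_isUnit (U : toScheme.Etale)
    (s : (structureMonoid toScheme).obj (op U)) (hs : IsUnit s) :
    ∃! m : M.obj (op U), (α.app (op U)).hom m = s

namespace LogScheme

/-- A morphism `X ⟶ Y` of log schemes: a morphism `f` of the underlying schemes together with a
homomorphism `f⁻¹ M_Y ⟶ M_X` (equivalently `M_Y ⟶ f_* M_X`) compatible with `𝒪_Y ⟶ f_* 𝒪_X`.
The sheaf homomorphism is given by its components `M_Y(V) ⟶ M_X(U)` for all `U` étale over `X`, `V`
étale over `Y` and all morphisms `u : U ⟶ V` over `f`, natural in `U` and `V`. (By naturality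
these components are determined by those with `U` the base change of `V`.) -/
structure Hom (X Y : LogScheme.{u}) where
  /-- the underlying morphism of schemes -/
  base : X.toScheme ⟶ Y.toScheme
  /-- the components of the homomorphism of sheaves of monoids -/
  app {U : X.toScheme.Etale} {V : Y.toScheme.Etale} (u : U.left ⟶ V.left)
    (h : u ≫ V.hom = U.hom ≫ base) : Y.M.obj (op V) ⟶ X.M.obj (op U)
  naturality {U U' : X.toScheme.Etale} {V V' : Y.toScheme.Etale} (a : U' ⟶ U) (b : V ⟶ V')
    (u : U.left ⟶ V.left) (h : u ≫ V.hom = U.hom ≫ base) (u' : U'.left ⟶ V'.left)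
    (h' : u' ≫ V'.hom = U'.hom ≫ base) (hu : a.left ≫ u ≫ b.left = u') :
    Y.M.map b.op ≫ app u h ≫ X.M.map a.op = app u' h'
  comm {U : X.toScheme.Etale} {V : Y.toScheme.Etale} (u : U.left ⟶ V.left)
    (h : u ≫ V.hom = U.hom ≫ base) :
    app u h ≫ X.α.app (op U) =
      Y.α.app (op V) ≫ pullSections u

theorem Hom.ext' {X Y : LogScheme.{u}} {f g : Hom X Y} (hb : f.base = g.base)
    (ha : ∀ (U : X.toScheme.Etale) (V : Y.toScheme.Etale) (u : U.left ⟶ V.left)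
      (h : u ≫ V.hom = U.hom ≫ f.base) (h' : u ≫ V.hom = U.hom ≫ g.base),
      f.app u h = g.app u h') : f = g := by
  obtain ⟨b, a, _, _⟩ := f
  obtain ⟨b', a', _, _⟩ := g
  obtain rfl : b = b' := hb
  obtain rfl : @a = @a' := by
    funext U V u h
    exact ha U V u h h
  rfl

/-- The identity morphism of a log scheme. -/
def Hom.id (X : LogScheme.{u}) : Hom X X where
  base := 𝟙 _
  app {U V} u h := X.M.map (Quiver.Hom.op (MorphismProperty.Over.homMk u (by simpa using h)))
  naturality {U U' V V'} a b u h u' h' hu := by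
    rw [← X.M.map_comp, ← X.M.map_comp]
    congr 1
    apply Quiver.Hom.unop_inj
    refine MorphismProperty.Over.Hom.ext ?_
    exact hu
  comm {U V} u h := X.α.naturality _

/-- The base change `f^* V` of an étale `Y`-scheme `V` along `f : X ⟶ Y`. -/
noncomputable def basechange {X Y : Scheme.{u}} (f : X ⟶ Y) (V : Y.Etale) : X.Etale :=
  Scheme.Etale.mk (pullback.snd V.hom f)

/-- The projection `f^* V ⟶ V`. -/
noncomputable def basechangeFst {X Y : Scheme.{u}} (f : X ⟶ Y) (V : Y.Etale) :
    (basechange f V).left ⟶ V.left :=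
  pullback.fst V.hom f

theorem basechangeFst_comp {X Y : Scheme.{u}} (f : X ⟶ Y) (V : Y.Etale) :
    basechangeFst f V ≫ V.hom = (basechange f V).hom ≫ f :=
  pullback.condition

/-- The morphism `T ⟶ f^* V` given by a morphism `T ⟶ V` over `f`. -/
noncomputable def basechangeLift {X Y : Scheme.{u}} (f : X ⟶ Y) (V : Y.Etale) {T : Scheme.{u}}
    (u : T ⟶ V.left) (t : T ⟶ X) (h : u ≫ V.hom = t ≫ f) : T ⟶ (basechange f V).left :=
  pullback.lift u t h

theorem basechangeLift_fst {X Y : Scheme.{u}} (f : X ⟶ Y) (V : Y.Etale) {T : Scheme.{u}}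
    (u : T ⟶ V.left) (t : T ⟶ X) (h : u ≫ V.hom = t ≫ f) :
    basechangeLift f V u t h ≫ basechangeFst f V = u :=
  pullback.lift_fst _ _ _

theorem basechangeLift_hom {X Y : Scheme.{u}} (f : X ⟶ Y) (V : Y.Etale) {T : Scheme.{u}}
    (u : T ⟶ V.left) (t : T ⟶ X) (h : u ≫ V.hom = t ≫ f) :
    basechangeLift f V u t h ≫ (basechange f V).hom = t :=
  pullback.lift_snd _ _ _

/-- The composite `M_Z(W) ⟶ M_Y(V) ⟶ M_X(U)` does not depend on the factorisation `U ⟶ V ⟶ W`. -/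
theorem Hom.app_comp_app {X Y Z : LogScheme.{u}} (f : Hom X Y) (g : Hom Y Z)
    {U : X.toScheme.Etale} {V : Y.toScheme.Etale} {W : Z.toScheme.Etale}
    (u : U.left ⟶ V.left) (hu : u ≫ V.hom = U.hom ≫ f.base)
    (v : V.left ⟶ W.left) (hv : v ≫ W.hom = V.hom ≫ g.base)
    (w : U.left ⟶ W.left) (hw : w ≫ W.hom = (U.hom ≫ f.base) ≫ g.base) (huv : u ≫ v = w) :
    g.app (basechangeFst g.base W) (basechangeFst_comp g.base W) ≫
      f.app (basechangeLift g.base W w (U.hom ≫ f.base) hw) (basechangeLift_hom _ _ _ _ _) =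
      g.app v hv ≫ f.app u hu := by
  subst huv
  let b : V ⟶ basechange g.base W := MorphismProperty.Over.homMk
    (basechangeLift g.base W v V.hom hv) (basechangeLift_hom _ _ _ _ _)
  have hb : b.left ≫ basechangeFst g.base W = v := basechangeLift_fst _ _ _ _ _
  have h1 := g.naturality b (𝟙 W) (basechangeFst g.base W) (basechangeFst_comp g.base W) v hv
    ((congrArg (b.left ≫ ·) (Category.comp_id _)).trans hb)
  have h2 := f.naturality (𝟙 U) b u hu
    (basechangeLift g.base W (u ≫ v) (U.hom ≫ f.base) hw) (basechangeLift_hom _ _ _ _ _) (by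
    refine (Category.id_comp _).trans ?_
    apply pullback.hom_ext
    · exact (Category.assoc _ _ _).trans ((congrArg (u ≫ ·) hb).trans
        (basechangeLift_fst _ _ _ _ _).symm)
    · exact (Category.assoc _ _ _).trans
        ((congrArg (u ≫ ·) (basechangeLift_hom _ _ _ _ _)).trans
          (hu.trans (basechangeLift_hom _ _ _ _ _).symm)))
  rw [← h2, ← h1]
  simp

theorem Hom.comp_naturality {X Y Z : LogScheme.{u}} (f : Hom X Y) (g : Hom Y Z)
    {U U' : X.toScheme.Etale} {W W' : Z.toScheme.Etale} (a : U' ⟶ U) (b : W ⟶ W')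
    (u : U.left ⟶ W.left) (h : u ≫ W.hom = (U.hom ≫ f.base) ≫ g.base) (u' : U'.left ⟶ W'.left)
    (h' : u' ≫ W'.hom = (U'.hom ≫ f.base) ≫ g.base) (hu : a.left ≫ u ≫ b.left = u') :
    Z.M.map b.op ≫ (g.app (basechangeFst g.base W) (basechangeFst_comp g.base W) ≫
      f.app (basechangeLift g.base W u (U.hom ≫ f.base) h) (basechangeLift_hom _ _ _ _ _)) ≫
        X.M.map a.op =
    g.app (basechangeFst g.base W') (basechangeFst_comp g.base W') ≫
      f.app (basechangeLift g.base W' u' (U'.hom ≫ f.base) h') (basechangeLift_hom _ _ _ _ _) := by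
  have hb : (basechangeFst g.base W ≫ b.left) ≫ W'.hom = (basechange g.base W).hom ≫ g.base :=
    (Category.assoc _ _ _).trans ((congrArg (basechangeFst g.base W ≫ ·)
      (MorphismProperty.Over.w b)).trans (basechangeFst_comp g.base W))
  have ha : (a.left ≫ basechangeLift g.base W u (U.hom ≫ f.base) h) ≫ (basechange g.base W).hom =
      U'.hom ≫ f.base :=
    (Category.assoc _ _ _).trans ((congrArg (a.left ≫ ·) (basechangeLift_hom _ _ _ _ _)).trans
      ((Category.assoc _ _ _).symm.trans (congrArg (· ≫ f.base) (MorphismProperty.Over.w a))))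
  have e1 := g.naturality (𝟙 _) b (basechangeFst g.base W) (basechangeFst_comp g.base W)
    (basechangeFst g.base W ≫ b.left) hb (Category.id_comp _)
  have e2 := f.naturality a (𝟙 _) (basechangeLift g.base W u (U.hom ≫ f.base) h)
    (basechangeLift_hom _ _ _ _ _) _ ha (congrArg (a.left ≫ ·) (Category.comp_id _))
  have e3 := Hom.app_comp_app f g _ ha _ hb u' h' (by
    refine Eq.trans ?_ hu
    exact (Category.assoc _ _ _).trans (congrArg (a.left ≫ ·) ((Category.assoc _ _ _).symm.trans
      (congrArg (· ≫ b.left) (basechangeLift_fst _ _ _ _ _)))))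
  refine Eq.trans ?_ e3.symm
  have hid : Y.M.map (𝟙 (basechange g.base W)).op = 𝟙 _ := Y.M.map_id _
  rw [hid, Category.comp_id] at e1
  rw [hid, Category.id_comp] at e2
  rw [← e1, ← e2]
  simp only [Category.assoc]

/-- Composition of morphisms of log schemes. -/
noncomputable def Hom.comp {X Y Z : LogScheme.{u}} (f : Hom X Y) (g : Hom Y Z) : Hom X Z where
  base := f.base ≫ g.base
  app {U W} u h :=
    g.app (basechangeFst g.base W) (basechangeFst_comp g.base W) ≫
      f.app (basechangeLift g.base W u (U.hom ≫ f.base) (h.trans (Category.assoc _ _ _).symm))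
        (basechangeLift_hom _ _ _ _ _)
  naturality {U U' W W'} a b u h u' h' hu := Hom.comp_naturality f g a b u _ u' _ hu
  comm {U W} u h := by
    refine (Category.assoc _ _ _).trans ((congrArg (_ ≫ ·) (f.comm _ _)).trans ?_)
    refine (Category.assoc _ _ _).symm.trans ((congrArg (· ≫ _) (g.comm _ _)).trans ?_)
    refine (Category.assoc _ _ _).trans (congrArg (Z.α.app (op W) ≫ ·) ?_)
    exact (pullSections_comp _ _).symm.trans
      (congrArg pullSections (basechangeLift_fst g.base W u _ _))

noncomputable instance : Category LogScheme.{u} where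
  Hom := Hom
  id := Hom.id
  comp := Hom.comp
  id_comp {X Y} f := by
    refine Hom.ext' (Category.id_comp _) fun U V u h h' => ?_
    refine (Hom.app_comp_app (Hom.id X) f (U := U) (V := U) (𝟙 _) rfl u h' u _
      (Category.id_comp _)).trans ?_
    exact (congrArg (_ ≫ ·) (X.M.map_id _)).trans (Category.comp_id _)
  comp_id {X Y} f := by
    refine Hom.ext' (Category.comp_id _) fun U V u h h' => ?_
    refine (Hom.app_comp_app f (Hom.id Y) (U := U) (V := V) u h' (𝟙 _) rfl u _
      (Category.comp_id _)).trans ?_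
    exact (congrArg (· ≫ _) (Y.M.map_id _)).trans (Category.id_comp _)
  assoc {X Y Z T} f g k := by
    refine Hom.ext' (Category.assoc _ _ _) fun U W u h h' => ?_
    have h1 : u ≫ W.hom = (U.hom ≫ f.base) ≫ g.base ≫ k.base :=
      h'.trans (Category.assoc _ _ _).symm
    have e := Hom.app_comp_app f g (U := U) (V := basechange (g.base ≫ k.base) W)
      (W := basechange k.base W)
      (basechangeLift (g.base ≫ k.base) W u (U.hom ≫ f.base) h1) (basechangeLift_hom _ _ _ _ _)
      (basechangeLift k.base W (basechangeFst _ W) ((basechange (g.base ≫ k.base) W).hom ≫ g.base)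
        ((basechangeFst_comp _ _).trans (Category.assoc _ _ _).symm)) (basechangeLift_hom _ _ _ _ _)
      (basechangeLift k.base W u ((U.hom ≫ f.base) ≫ g.base)
        (h1.trans (Category.assoc _ _ _).symm)) (basechangeLift_hom _ _ _ _ _) (by
        apply pullback.hom_ext
        · exact (Category.assoc _ _ _).trans ((congrArg (_ ≫ ·) (basechangeLift_fst _ _ _ _ _)).trans
            ((basechangeLift_fst _ _ _ _ _).trans (basechangeLift_fst _ _ _ _ _).symm))
        · exact (Category.assoc _ _ _).trans ((congrArg (_ ≫ ·) (basechangeLift_hom _ _ _ _ _)).trans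
            ((Category.assoc _ _ _).symm.trans ((congrArg (· ≫ g.base)
              (basechangeLift_hom _ _ _ _ _)).trans (basechangeLift_hom _ _ _ _ _).symm))))
    have e' := congrArg (k.app (basechangeFst k.base W) (basechangeFst_comp k.base W) ≫ ·) e
    refine Eq.trans ?_ (e'.trans (Category.assoc _ _ _).symm)
    refine congrArg (k.app (basechangeFst k.base W) (basechangeFst_comp k.base W) ≫ ·) ?_
    rfl

end LogScheme

/-! ### Fine and saturated log schemes -/

/-- A commutative monoid is fine and saturated (fs) if it is finitely generated, integral
(the map to its group completion is injective), and every `x` in the group completion with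
`x ^ n` in the monoid for some `n > 0` lies in the monoid. -/
structure IsFsMonoid (P : Type*) [CommMonoid P] : Prop where
  fg : Monoid.FG P
  integral : Function.Injective (Algebra.GrothendieckGroup.of : P →* Algebra.GrothendieckGroup P)
  saturated : ∀ (x : Algebra.GrothendieckGroup P) (n : ℕ), 0 < n →
    x ^ n ∈ MonoidHom.mrange (Algebra.GrothendieckGroup.of : P →* Algebra.GrothendieckGroup P) →
    x ∈ MonoidHom.mrange (Algebra.GrothendieckGroup.of : P →* Algebra.GrothendieckGroup P)

namespace LogScheme

/-- A homomorphism `β : P →* M(U)` is a chart if the log structure `Pᵃ` associated to the pre-log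
structure `α ∘ β : P → 𝒪_U` is mapped isomorphically to `M|_U`. Here `Pᵃ` is the sheaf associated
to the presheaf of pushouts of `P ← (αβ)⁻¹(𝒪(V)ˣ) → 𝒪(V)ˣ`; as `M(V)ˣ ≅ 𝒪(V)ˣ` via `α`, this
pushout is the quotient of `P × M(V)ˣ` by the relation `(p, ε) ∼ (q, δ)` iff there are `a b : P`,
with `β a`, `β b` invertible on `V`, such that `p a = q b` and `β(b) ε = β(a) δ`, with the map
`(p, ε) ↦ β(p) ε` to `M(V)`. The map of associated sheaves is an isomorphism iff the map of
presheaves is locally surjective and locally injective, which are the two fields. -/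
structure IsChart (X : LogScheme.{u}) {U : X.toScheme.Etale} {P : Type u} [CommMonoid P]
    (β : P →* X.M.obj (op U)) : Prop where
  surj (V : X.toScheme.Etale) (g : V ⟶ U) (m : X.M.obj (op V)) :
    ∃ S ∈ X.toScheme.smallEtaleTopology V, ∀ (W : X.toScheme.Etale) (h : W ⟶ V), S h →
      ∃ (p : P) (ε : (X.M.obj (op W))ˣ), X.M.map h.op m = X.M.map (h ≫ g).op (β p) * ε
  inj (V : X.toScheme.Etale) (g : V ⟶ U) (p q : P) (ε δ : (X.M.obj (op V))ˣ)
    (heq : X.M.map g.op (β p) * ε = X.M.map g.op (β q) * δ) :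
    ∃ S ∈ X.toScheme.smallEtaleTopology V, ∀ (W : X.toScheme.Etale) (h : W ⟶ V), S h →
      ∃ a b : P, IsUnit (X.M.map (h ≫ g).op (β a)) ∧ IsUnit (X.M.map (h ≫ g).op (β b)) ∧
        p * a = q * b ∧
        X.M.map (h ≫ g).op (β b) * X.M.map h.op ε = X.M.map (h ≫ g).op (β a) * X.M.map h.op δ

/-- A log scheme is fine and saturated if étale locally it has charts by fs monoids. -/
def isFs : ObjectProperty LogScheme.{u} := fun X =>
  ∀ x : X.toScheme, ∃ (U : X.toScheme.Etale) (y : U.left), U.hom y = x ∧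
    ∃ (P : Type u) (_ : CommMonoid P) (β : P →* X.M.obj (op U)), IsFsMonoid P ∧ X.IsChart β

end LogScheme

/-- The category of fs log schemes, a full subcategory of that of log schemes. -/
abbrev FsLogScheme := LogScheme.isFs.{u}.FullSubcategory

/-! ### Stalks and ghost monoids -/

section Stalk

variable {Ω : Type u} [Field Ω] [IsSepClosed Ω]

instance {C : Type*} [Category C] [LocallySmall.{u} C] {J : GrothendieckTopology C}
    (Φ : GrothendieckTopology.Point.{u} J) :
    HasColimitsOfShape Φ.fiber.Elementsᵒᵖ CommMonCat.{u} := by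
  have : HasColimitsOfShape (FinallySmall.FilteredFinalModel.{u} Φ.fiber.Elementsᵒᵖ)
      CommMonCat.{u} := ⟨fun F => ⟨_, CommMonCat.FilteredColimits.colimitCoconeIsColimit.{u, u} F⟩⟩
  exact Functor.Final.hasColimitsOfShape_of_final
    (FinallySmall.fromFilteredFinalModel.{u} Φ.fiber.Elementsᵒᵖ)

/-- The stalk `M_{X, x}` of `M` at a geometric point `x`: the filtered colimit of `M(U)` over all
étale neighbourhoods of `x`, i.e. all `U` étale over `X` with a lift of `x` to `U`. -/
noncomputable def LogScheme.stalk (X : LogScheme.{u}) (x : Spec (.of Ω) ⟶ X.toScheme) :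
    CommMonCat.{u} :=
  colimit ((CategoryOfElements.π (Scheme.pointSmallEtale x).fiber).op ⋙ X.M)

/-- The germ in `M_{X, x}` of a section over an étale neighbourhood. -/
noncomputable def LogScheme.germ (X : LogScheme.{u}) (x : Spec (.of Ω) ⟶ X.toScheme)
    (U : X.toScheme.Etale) (y : Spec (.of Ω) ⟶ U.left) (h : y ≫ U.hom = x) :
    X.M.obj (op U) ⟶ X.stalk x :=
  colimit.ι ((CategoryOfElements.π (Scheme.pointSmallEtale x).fiber).op ⋙ X.M)
    (op ⟨U, Over.homMk y h⟩)

theorem LogScheme.germ_w (X : LogScheme.{u}) (x : Spec (.of Ω) ⟶ X.toScheme)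
    {U V : X.toScheme.Etale} (c : V ⟶ U) (y : Spec (.of Ω) ⟶ U.left) (h : y ≫ U.hom = x)
    (z : Spec (.of Ω) ⟶ V.left) (h' : z ≫ V.hom = x) (hz : z ≫ c.left = y) :
    X.M.map c.op ≫ X.germ x V z h' = X.germ x U y h := by
  subst hz
  exact colimit.w ((CategoryOfElements.π (Scheme.pointSmallEtale x).fiber).op ⋙ X.M)
    (CategoryOfElements.homMk ⟨V, Over.homMk z h'⟩ ⟨U, Over.homMk (z ≫ c.left) h⟩ c
      (by apply Over.OverMorphism.ext; rfl)).op

theorem LogScheme.stalkMap_aux {X Y : LogScheme.{u}} (f : X ⟶ Y)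
    (x : Spec (.of Ω) ⟶ X.toScheme) {V V' : Y.toScheme.Etale} (b : V' ⟶ V)
    (v : Spec (.of Ω) ⟶ V.left) (hv : v ≫ V.hom = x ≫ f.base)
    (v' : Spec (.of Ω) ⟶ V'.left) (hv' : v' ≫ V'.hom = x ≫ f.base) (hb : v' ≫ b.left = v) :
    Y.M.map b.op ≫ f.app (LogScheme.basechangeFst f.base V') (LogScheme.basechangeFst_comp _ V') ≫
        X.germ x (LogScheme.basechange f.base V') (LogScheme.basechangeLift f.base V' v' x hv')
          (LogScheme.basechangeLift_hom _ _ _ _ _) =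
      f.app (LogScheme.basechangeFst f.base V) (LogScheme.basechangeFst_comp _ V) ≫
        X.germ x (LogScheme.basechange f.base V) (LogScheme.basechangeLift f.base V v x hv)
          (LogScheme.basechangeLift_hom _ _ _ _ _) := by
  have hc : (LogScheme.basechangeFst f.base V' ≫ b.left) ≫ V.hom =
      (LogScheme.basechange f.base V').hom ≫ f.base :=
    (Category.assoc _ _ _).trans ((congrArg (LogScheme.basechangeFst f.base V' ≫ ·)
      (MorphismProperty.Over.w b)).trans (LogScheme.basechangeFst_comp f.base V'))
  let c : LogScheme.basechange f.base V' ⟶ LogScheme.basechange f.base V :=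
    MorphismProperty.Over.homMk (LogScheme.basechangeLift f.base V
      (LogScheme.basechangeFst f.base V' ≫ b.left) _ hc) (LogScheme.basechangeLift_hom _ _ _ _ _)
  have e1 := f.naturality c (𝟙 V) (LogScheme.basechangeFst f.base V)
    (LogScheme.basechangeFst_comp _ V) _ hc ((congrArg (c.left ≫ ·) (Category.comp_id _)).trans
      (LogScheme.basechangeLift_fst _ _ _ _ _))
  have e2 := f.naturality (𝟙 _) b (LogScheme.basechangeFst f.base V')
    (LogScheme.basechangeFst_comp _ V') _ hc (Category.id_comp _)
  have e3 := X.germ_w x c (LogScheme.basechangeLift f.base V v x hv)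
    (LogScheme.basechangeLift_hom _ _ _ _ _) (LogScheme.basechangeLift f.base V' v' x hv')
    (LogScheme.basechangeLift_hom _ _ _ _ _) (by
      apply pullback.hom_ext
      · refine (Category.assoc _ _ _).trans ((congrArg (_ ≫ ·)
          (LogScheme.basechangeLift_fst _ _ _ _ _)).trans ?_)
        refine (Category.assoc _ _ _).symm.trans ((congrArg (· ≫ b.left)
          (LogScheme.basechangeLift_fst _ _ _ _ _)).trans ?_)
        exact hb.trans (LogScheme.basechangeLift_fst _ _ _ _ _).symm
      · exact (Category.assoc _ _ _).trans ((congrArg (_ ≫ ·)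
          (LogScheme.basechangeLift_hom _ _ _ _ _)).trans
          ((LogScheme.basechangeLift_hom _ _ _ _ _).trans
            (LogScheme.basechangeLift_hom _ _ _ _ _).symm)))
  have i1 : X.M.map (𝟙 (LogScheme.basechange f.base V')).op = 𝟙 _ := X.M.map_id _
  have i2 : Y.M.map (𝟙 V).op = 𝟙 _ := Y.M.map_id _
  rw [i1, Category.comp_id] at e2
  rw [i2, Category.id_comp] at e1
  rw [← e3, ← Category.assoc, e2, ← e1, Category.assoc]

/-- The homomorphism `M_{Y, f(x)} ⟶ M_{X, x}` of stalks induced by a morphism of log schemes. -/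
noncomputable def LogScheme.stalkMap {X Y : LogScheme.{u}} (f : X ⟶ Y)
    (x : Spec (.of Ω) ⟶ X.toScheme) (y : Spec (.of Ω) ⟶ Y.toScheme) (h : x ≫ f.base = y) :
    Y.stalk y ⟶ X.stalk x :=
  colimit.desc ((CategoryOfElements.π (Scheme.pointSmallEtale y).fiber).op ⋙ Y.M)
    { pt := X.stalk x
      ι :=
        { app j := f.app (LogScheme.basechangeFst f.base j.unop.1)
              (LogScheme.basechangeFst_comp f.base j.unop.1) ≫
            X.germ x (LogScheme.basechange f.base j.unop.1)
              (LogScheme.basechangeLift f.base j.unop.1 j.unop.2.left x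
                ((Over.w j.unop.2).trans h.symm)) (LogScheme.basechangeLift_hom _ _ _ _ _)
          naturality _ _ φ :=
            (LogScheme.stalkMap_aux f x φ.unop.1 _ _ _ _
              (congrArg CommaMorphism.left φ.unop.2)).trans (Category.comp_id _).symm } }

/-- The homomorphism `M / Mˣ → N / Nˣ` induced by `M → N`. -/
noncomputable def associatesMap {M N : Type*} [CommMonoid M] [CommMonoid N] (f : M →* N) :
    Associates M →* Associates N where
  toFun := Quotient.map f fun _ _ h => h.map f
  map_one' := congrArg Associates.mk (map_one f)
  map_mul' := by
    rintro ⟨a⟩ ⟨b⟩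
    exact congrArg Associates.mk (map_mul f a b)

/-- The stalk `M_{X, x} / 𝒪_{X, x}ˣ = M_{X, x} / M_{X, x}ˣ` of the ghost sheaf at a geometric
point `x`, written additively. -/
abbrev LogScheme.ghost (X : LogScheme.{u}) (x : Spec (.of Ω) ⟶ X.toScheme) : Type u :=
  Additive (Associates (X.stalk x))

/-- The homomorphism of stalks of ghost sheaves induced by a morphism of log schemes. -/
noncomputable def LogScheme.ghostMap {X Y : LogScheme.{u}} (f : X ⟶ Y)
    (x : Spec (.of Ω) ⟶ X.toScheme) (y : Spec (.of Ω) ⟶ Y.toScheme) (h : x ≫ f.base = y) :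
    Y.ghost y →+ X.ghost x :=
  (associatesMap (LogScheme.stalkMap f x y h).hom).toAdditive

end Stalk

/-! ### The map `θ` and its transpose -/

section Theta

open Algebra

variable {P Q Q₁ Q₂ : Type*} [AddCommMonoid P] [AddCommMonoid Q] [AddCommMonoid Q₁]
  [AddCommMonoid Q₂]

/-- The homomorphism `P^gp → Q^gp` induced by `P → Q`. -/
noncomputable def gpMap (f : P →+ Q) : GrothendieckAddGroup P →+ GrothendieckAddGroup Q :=
  GrothendieckAddGroup.lift (GrothendieckAddGroup.of.comp f)

theorem lift_of {A : Type*} [AddCommGroup A] (g : P →+ A) (z : P) :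
    GrothendieckAddGroup.lift g (GrothendieckAddGroup.of z) = g z :=
  DFunLike.congr_fun (GrothendieckAddGroup.lift.symm_apply_apply g) z

theorem gpMap_of (f : P →+ Q) (z : P) :
    gpMap f (GrothendieckAddGroup.of z) = GrothendieckAddGroup.of (f z) :=
  lift_of _ z

/-- `θ = (θ₁^gp, -θ₂^gp) : P^gp → Q₁^gp ⊕ Q₂^gp`. -/
noncomputable def theta (θ₁ : P →+ Q₁) (θ₂ : P →+ Q₂) :
    GrothendieckAddGroup P →+ GrothendieckAddGroup Q₁ × GrothendieckAddGroup Q₂ :=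
  (gpMap θ₁).prod (-gpMap θ₂)

/-- The dual `Q^* → P^*` of `P → Q`, where `P^* = Hom(P, ℤ)`. -/
def dualMap (f : P →+ Q) : (Q →+ ℤ) →+ (P →+ ℤ) :=
  f.compHom'

/-- The transpose `θᵗ : Q₁^* ⊕ Q₂^* → P^*` of `θ`, where `P^* = Hom(P, ℤ) = Hom(P^gp, ℤ)`. -/
def thetaTranspose (θ₁ : P →+ Q₁) (θ₂ : P →+ Q₂) : (Q₁ →+ ℤ) × (Q₂ →+ ℤ) →+ (P →+ ℤ) :=
  (dualMap θ₁).coprod (-dualMap θ₂)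

/-- Under `P^* = Hom(P^gp, ℤ)`, the map `thetaTranspose` is precomposition with `theta`. -/
theorem lift_thetaTranspose (θ₁ : P →+ Q₁) (θ₂ : P →+ Q₂) (a : (Q₁ →+ ℤ) × (Q₂ →+ ℤ)) :
    GrothendieckAddGroup.lift (thetaTranspose θ₁ θ₂ a) =
      ((GrothendieckAddGroup.lift a.1).coprod (GrothendieckAddGroup.lift a.2)).comp
        (theta θ₁ θ₂) := by
  apply GrothendieckAddGroup.lift.symm.injective
  rw [Equiv.symm_apply_apply]
  ext p
  change a.1 (θ₁ p) + -(a.2 (θ₂ p)) =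
    GrothendieckAddGroup.lift a.1 (gpMap θ₁ (GrothendieckAddGroup.of p)) +
      GrothendieckAddGroup.lift a.2 (-(gpMap θ₂ (GrothendieckAddGroup.of p)))
  rw [map_neg, gpMap_of, gpMap_of, lift_of, lift_of]

/-- The torsion subgroup `coker(f)_tors` of the cokernel of a homomorphism of abelian groups. -/
abbrev cokerTors {A B : Type*} [AddCommGroup A] [AddCommGroup B] (f : A →+ B) : Type _ :=
  AddCommGroup.torsion (B ⧸ f.range)

end Theta

end LogGeometry

open LogGeometry

namespace LogGeometry

set_option linter.unusedSectionVars false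

open Limits Opposite

/-! ### Finitely generated commutative monoids and abelian groups -/

section Algebra

open Algebra

/-! The fibre product `Z` is probed by hollow log schemes `hollow NatSq (Spec A)`, whose stalks are
ℕ² × 𝒪ˣ. Write M(W) for the global sections of the log structure. A datum over a κ-algebra A
consists of homomorphisms aᵢ : M(Wᵢ) → ℕ² and cᵢ : M(Wᵢ) → Aˣ, agreeing on M(X), with aᵢ local and
cᵢ equal to evaluation on units. Each datum defines a morphism to `Z` (`exists_realizes`), and over
a field every morphism arises in this way (`exists_datum_of_hom`). Every point of `Z` is the image
of such a morphism over an algebraically closed field K (`exists_hollow_point`), because a sharp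
finitely generated integral monoid has a local homomorphism to ℕ (`exists_local_hom_nat`) and Kˣ is
divisible.

The cᵢ amount to one homomorphism on M(W₁)^gp ⊕ M(W₂)^gp. Those of two data differ by a character of
the quotient by the units and the relations coming from X, and this quotient is coker θ
(`nonempty_cokerEquiv`). Relative to a fixed datum over κ, every point of `Z` thus acquires a
character of T = coker(θ)_tors; its values are roots of unity, so they lie in κˣ.

The character is locally constant: since the stalks of `Z` are saturated, a torsion class becomes a
unit there, so its value is given étale locally by a function, with only finitely many possible
values (`exists_isOpen_chi`). Every character of T occurs: it extends to coker θ by divisibility of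
κˣ and twists the fixed datum (`exists_hasChar_of_hom`). Points with the same character lie in one
component: the remaining difference is a character of the free group coker(θ)/T, which is deformed
to the trivial one over an integral domain (`IsPt.connectedComponent_eq`). The homomorphisms aᵢ do
not influence the point (`IsPt.eq_of_pc_eq`); comparing two choices is what requires ℕ² instead of
ℕ.

Hence the components of `Z` correspond to Hom(T, κˣ), which has |T| elements in characteristic 0
(`card_hom_units`).

For the transpose, a torsion class of its cokernel is a functional h with n•h = g ∘ f. The character
exp(2πi g/n) of coker(f)_tors determines the class, which gives one inequality
(`card_cokerTors_compHom_le`). Biduality of free groups gives the other. -/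

theorem exists_hom_eq_one_of_not_torsion {G : Type u} [AddCommGroup G] (k : G)
    (hk : ∀ m : ℕ, 0 < m → m • k ≠ 0) : ∃ ψ : G →+ ℚ, ψ k = 1 := by
  -- The inclusion ℤ → ℚ extends along the injection n ↦ n•k, because ℚ is divisible.
  obtain ⟨ψ, hψ⟩ := (Module.Baer.of_divisible ℚ).extension_property_addMonoidHom
    (zmultiplesHom G k) (by
      rw [injective_iff_map_eq_zero]
      intro n hn
      by_contra hne
      refine hk n.natAbs (Int.natAbs_pos.2 hne) ?_
      rw [zmultiplesHom_apply] at hn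
      rcases Int.natAbs_eq n with h | h
      · rw [h] at hn; simpa using hn
      · rw [h] at hn; simpa using hn)
    (Int.castAddHom ℚ)
  refine ⟨ψ, ?_⟩
  have := DFunLike.congr_fun hψ 1
  simpa using this

/-- A theorem of the alternative for finite families in an abelian group. -/
theorem exists_pos_hom_or_neg_mem_closure (n : ℕ) : ∀ {G : Type u} [AddCommGroup G] (l : List G),
    l.length = n → (∃ φ : G →+ ℚ, ∀ g ∈ l, 0 < φ g) ∨
      ∃ g ∈ l, -g ∈ AddSubmonoid.closure {x | x ∈ l} := by
  induction n with
  | zero =>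
    intro G _ l hl
    obtain rfl := List.length_eq_zero_iff.1 hl
    exact Or.inl ⟨0, by simp⟩
  | succ n ih =>
    rintro G _ (_ | ⟨k, s⟩) hl
    · simp at hl
    have hs : s.length = n := by simpa using hl
    have hsub : AddSubmonoid.closure {x | x ∈ s} ≤ AddSubmonoid.closure {x | x ∈ k :: s} :=
      AddSubmonoid.closure_mono fun x hx => List.mem_cons_of_mem _ hx
    have hkmem : k ∈ AddSubmonoid.closure {x | x ∈ k :: s} :=
      AddSubmonoid.subset_closure (by simp)
    by_cases htor : ∃ m : ℕ, 0 < m ∧ m • k = 0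
    · obtain ⟨m, hm, h0⟩ := htor
      refine Or.inr ⟨k, by simp, ?_⟩
      have : -k = (m - 1) • k := by
        obtain ⟨m, rfl⟩ : ∃ m', m = m' + 1 := ⟨m - 1, by omega⟩
        rw [succ_nsmul] at h0
        rw [Nat.add_sub_cancel]
        exact (eq_neg_of_add_eq_zero_left h0).symm
      rw [this]
      exact nsmul_mem hkmem _
    push Not at htor
    obtain ⟨ψ, hψ⟩ := exists_hom_eq_one_of_not_torsion k htor
    -- The induction hypothesis is applied in G/⟨k⟩. A functional positive there on the tail,
    -- multiplied by a large N and corrected by `ψ`, is positive on the tail and on k.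
    let π := QuotientAddGroup.mk' (AddSubgroup.zmultiples k)
    rcases ih (s.map π) (by simpa using hs) with ⟨φ, hφ⟩ | ⟨g', hg', hneg⟩
    · left
      obtain ⟨N, hN, hNs⟩ : ∃ N : ℕ, 0 < N ∧ ∀ g ∈ s, 0 < N * φ (π g) + ψ g := by
        clear hl hs hsub hkmem ih
        have hpos : ∀ g ∈ s, 0 < φ (π g) := fun g hg => hφ _ (List.mem_map_of_mem hg)
        clear hφ
        induction s with
        | nil => exact ⟨1, one_pos, by simp⟩
        | cons a t iht =>
          obtain ⟨N, hN, h⟩ := iht fun g hg => hpos g (List.mem_cons_of_mem _ hg)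
          have ha := hpos a (by simp)
          obtain ⟨M, hM⟩ := exists_nat_gt (-ψ a / φ (π a))
          rw [div_lt_iff₀ ha] at hM
          refine ⟨N + M, by omega, fun g hg => ?_⟩
          push_cast
          rcases List.mem_cons.1 hg with rfl | hg'
          · have : 0 < (N : ℚ) * φ (π g) := by positivity
            linarith
          · have h1 := h g hg'
            have : 0 ≤ (M : ℚ) * φ (π g) :=
              mul_nonneg (Nat.cast_nonneg _) (hpos g hg).le
            linarith
      refine ⟨N • (φ.comp π) + ψ, fun g hg => ?_⟩
      rcases List.mem_cons.1 hg with rfl | hg'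
      · have : π g = 0 := (QuotientAddGroup.eq_zero_iff g).2 (AddSubgroup.mem_zmultiples g)
        simp [this, hψ]
      · simpa using hNs g hg'
    · obtain ⟨g, hg, rfl⟩ := List.mem_map.1 hg'
      have : -π g ∈ (AddSubmonoid.closure {x | x ∈ s}).map π := by
        rw [AddMonoidHom.map_mclosure]
        convert hneg using 2
        ext y
        simp
      obtain ⟨x, hx, hxg⟩ := this
      have hmem : x + g ∈ AddSubgroup.zmultiples k := by
        rw [← QuotientAddGroup.eq_zero_iff]
        change π (x + g) = 0
        rw [map_add, hxg, neg_add_cancel]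
      obtain ⟨c, hc⟩ := AddSubgroup.mem_zmultiples_iff.1 hmem
      -- In the relation x + g = c•k the sign of c decides. If c ≤ 0, then -g = x + |c|•k lies in
      -- the closure. If c > 0, any functional positive on the tail is positive on k as well, so the
      -- induction hypothesis in G itself suffices.
      rcases le_or_gt c 0 with hc0 | hc0
      · right
        refine ⟨g, List.mem_cons_of_mem _ hg, ?_⟩
        have : -g = x + c.natAbs • k := by
          have h2 : (c.natAbs : ℤ) = -c := by omega
          rw [← natCast_zsmul, h2, neg_zsmul, hc]
          abel
        rw [this]
        exact add_mem (hsub hx) (nsmul_mem hkmem _)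
      · rcases ih s hs with ⟨φ, hφ⟩ | ⟨g'', hg'', h''⟩
        · left
          refine ⟨φ, fun g' hg' => ?_⟩
          rcases List.mem_cons.1 hg' with rfl | hg''
          · have hxn : 0 ≤ φ x := by
              refine AddSubmonoid.closure_induction (motive := fun x _ => 0 ≤ φ x)
                (fun y hy => (hφ y hy).le) (by simp) (fun a b _ _ ha hb => ?_) hx
              rw [map_add]; exact add_nonneg ha hb
            have h3 := congrArg φ hc
            rw [map_zsmul, map_add, zsmul_eq_mul] at h3
            have h4 := hφ g hg
            have h5 : (0 : ℚ) < c * φ g' := by rw [h3]; linarith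
            exact (pos_iff_pos_of_mul_pos h5).1 (by exact_mod_cast hc0)
          · exact hφ g' hg''
        · exact Or.inr ⟨g'', List.mem_cons_of_mem _ hg'', hsub h''⟩

/-- A finitely generated sharp integral monoid has a local homomorphism to `ℕ`. -/
theorem exists_local_hom_nat {Q : Type u} [AddCommMonoid Q] (hfg : AddMonoid.FG Q)
    (hint : Function.Injective (GrothendieckAddGroup.of : Q →+ GrothendieckAddGroup Q))
    (hsharp : ∀ x y : Q, x + y = 0 → x = 0) : ∃ f : Q →+ ℕ, ∀ q, f q = 0 → q = 0 := by
  classical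
  obtain ⟨S, hS⟩ := hfg.fg_top
  let l : List Q := (S.filter (· ≠ 0)).toList
  let o : Q →+ GrothendieckAddGroup Q := GrothendieckAddGroup.of
  have hl : ∀ q, q ∈ l ↔ q ∈ S ∧ q ≠ 0 := by simp [l]
  rcases exists_pos_hom_or_neg_mem_closure _ (l.map o) rfl with ⟨φ, hφ⟩ | ⟨g', hg', hneg⟩
  -- The product of the denominators of the values on the generators makes the functional integral
  -- on them, hence natural-valued on all of Q.
  · obtain ⟨D, hD, hDS⟩ : ∃ D : ℕ, 0 < D ∧ ∀ q ∈ S, ∃ n : ℕ, (D : ℚ) * φ (o q) = n := by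
      refine ⟨∏ q ∈ S, (φ (o q)).den, Finset.prod_pos fun q _ => (φ (o q)).den_pos,
        fun q hq => ?_⟩
      have hnonneg : 0 ≤ φ (o q) := by
        by_cases h0 : q = 0
        · simp [h0]
        · exact (hφ _ (List.mem_map_of_mem ((hl q).2 ⟨hq, h0⟩))).le
      refine ⟨(∏ q' ∈ S.erase q, (φ (o q')).den) * (φ (o q)).num.toNat, ?_⟩
      rw [← Finset.mul_prod_erase S _ hq]
      push_cast
      have h1 : ((φ (o q)).num.toNat : ℚ) = (φ (o q)).num := by
        exact_mod_cast Int.toNat_of_nonneg (Rat.num_nonneg.2 hnonneg)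
      rw [h1, mul_comm ((φ (o q)).den : ℚ), mul_assoc, Rat.den_mul_eq_num]
    have hall : ∀ q : Q, ∃ n : ℕ, (D : ℚ) * φ (o q) = n := by
      intro q
      have hq : q ∈ AddSubmonoid.closure (S : Set Q) := by rw [hS]; trivial
      refine AddSubmonoid.closure_induction (motive := fun q _ => ∃ n : ℕ, (D : ℚ) * φ (o q) = n)
        (fun y hy => hDS y hy) ⟨0, by simp⟩ ?_ hq
      rintro a b _ _ ⟨n, hn⟩ ⟨m, hm⟩
      exact ⟨n + m, by rw [map_add, map_add, mul_add, hn, hm]; push_cast; ring⟩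
    choose f hf using hall
    let F : Q →+ ℕ :=
      { toFun := f
        map_zero' := by
          have := hf 0
          simp only [map_zero, mul_zero] at this
          exact_mod_cast this.symm
        map_add' := fun a b => by
          have h1 := hf (a + b)
          rw [map_add, map_add, mul_add, hf a, hf b] at h1
          exact_mod_cast h1.symm }
    refine ⟨F, fun q => ?_⟩
    have hq : q ∈ AddSubmonoid.closure (S : Set Q) := by rw [hS]; trivial
    refine AddSubmonoid.closure_induction (motive := fun q _ => F q = 0 → q = 0) ?_ ?_ ?_ hq
    · intro y hy h0
      by_contra hne
      have h1 := hφ _ (List.mem_map_of_mem ((hl y).2 ⟨hy, hne⟩))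
      have h2 := hf y
      change f y = 0 at h0
      rw [h0, Nat.cast_zero] at h2
      have : (0 : ℚ) < D * φ (o y) := by positivity
      exact this.ne' h2
    · simp
    · intro a b _ _ ha hb h0
      rw [map_add] at h0
      rw [ha (by omega), hb (by omega), add_zero]
  -- A nonzero generator whose negative is represented by an element of Q would be invertible in Q,
  -- against sharpness.
  · exfalso
    obtain ⟨g, hg, rfl⟩ := List.mem_map.1 hg'
    have hrange : AddSubmonoid.closure {x | x ∈ l.map o} ≤ AddMonoidHom.mrange o := by
      rw [AddSubmonoid.closure_le]
      intro x hx
      obtain ⟨y, _, rfl⟩ := List.mem_map.1 hx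
      exact ⟨y, rfl⟩
    obtain ⟨y, hy⟩ := hrange hneg
    have : g + y = 0 := by
      apply hint
      change o (g + y) = o 0
      rw [map_add, hy, add_neg_cancel, map_zero]
    exact ((hl g).1 hg).2 (hsharp _ _ this)

/-- The unit group of an algebraically closed field is divisible. -/
noncomputable instance {K : Type*} [Field K] [IsAlgClosed K] : DivisibleBy (Additive Kˣ) ℕ :=
  divisibleByOfSMulRightSurj _ _ fun {n} hn x => by
    obtain ⟨z, hz⟩ := IsAlgClosed.exists_pow_nat_eq ((Additive.toMul x : Kˣ) : K)
      (Nat.pos_of_ne_zero hn)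
    have hz0 : z ≠ 0 := by
      rintro rfl
      rw [zero_pow hn] at hz
      exact (Additive.toMul x).ne_zero hz.symm
    refine ⟨Additive.ofMul (Units.mk0 z hz0), ?_⟩
    apply Additive.toMul.injective
    ext
    simpa using hz

noncomputable instance {K : Type*} [Field K] [IsAlgClosed K] : DivisibleBy (Additive Kˣ) ℤ :=
  AddGroup.divisibleByIntOfDivisibleByNat _

/-- Homomorphisms to the unit group of an algebraically closed field extend. -/
theorem exists_extension_units {K : Type*} [Field K] [IsAlgClosed K] {M N : Type*}
    [AddCommGroup M] [AddCommGroup N] (f : M →+ N) (hf : Function.Injective f)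
    (g : M →+ Additive Kˣ) : ∃ h : N →+ Additive Kˣ, h.comp f = g :=
  (Module.Baer.of_divisible (Additive Kˣ)).extension_property_addMonoidHom f hf g

/-- An algebraically closed field of characteristic 0 contains all roots of unity of order the
exponent of G, so G has as many characters as elements. This is where the characteristic enters the
count. -/
theorem card_hom_units {K : Type*} [Field K] [IsAlgClosed K] [CharZero K] (G : Type*)
    [AddCommGroup G] [Finite G] : Nat.card (G →+ Additive Kˣ) = Nat.card G := by
  have : NeZero (Monoid.exponent (Multiplicative G) : K) :=
    ⟨Nat.cast_ne_zero.2 Monoid.exponent_ne_zero_of_finite⟩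
  rw [Nat.card_congr AddMonoidHom.toMultiplicativeLeft,
    CommGroup.card_monoidHom_of_hasEnoughRootsOfUnity]
  rfl

end Algebra

/-! ### Torsion in the cokernel of a homomorphism and of its transpose -/

section Algebra

open Algebra

/-- The quotient by a saturated subgroup of a finitely generated abelian group is free. -/
theorem projective_quotient_of_saturated {B : Type*} [AddCommGroup B] [Module.Finite ℤ B]
    (L : Submodule ℤ B) (hL : ∀ (n : ℕ) (b : B), 0 < n → n • b ∈ L → b ∈ L) :
    Module.Projective ℤ (B ⧸ L) := by
  have : Module.IsTorsionFree ℤ (B ⧸ L) := by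
    rw [Module.isTorsionFree_int_iff_isAddTorsionFree]
    refine ⟨fun n hn x y hxy => ?_⟩
    obtain ⟨x, rfl⟩ := L.mkQ_surjective x
    obtain ⟨y, rfl⟩ := L.mkQ_surjective y
    change n • L.mkQ x = n • L.mkQ y at hxy
    rw [← map_nsmul, ← map_nsmul] at hxy
    have h1 := (Submodule.Quotient.eq L).1 hxy
    rw [← nsmul_sub] at h1
    exact (Submodule.Quotient.eq L).2 (hL n _ (Nat.pos_of_ne_zero hn) h1)
  have : Module.Free ℤ (B ⧸ L) := Module.free_of_finite_type_torsion_free'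
  infer_instance

/-- The projection B → B/L splits since B/L is projective; subtracting from b the lift of its class
gives the retraction. -/
theorem exists_retraction_of_saturated {B : Type*} [AddCommGroup B] [Module.Finite ℤ B]
    (L : Submodule ℤ B) (hL : ∀ (n : ℕ) (b : B), 0 < n → n • b ∈ L → b ∈ L) :
    ∃ r : B →ₗ[ℤ] L, ∀ x : L, r x = x := by
  have := projective_quotient_of_saturated L hL
  obtain ⟨s, hs⟩ := Module.projective_lifting_property L.mkQ LinearMap.id L.mkQ_surjective
  have hmem : ∀ b, (LinearMap.id - s.comp L.mkQ : B →ₗ[ℤ] B) b ∈ L := fun b => by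
    rw [← Submodule.Quotient.mk_eq_zero, ← Submodule.mkQ_apply]
    have := DFunLike.congr_fun hs (L.mkQ b)
    simp only [LinearMap.comp_apply, LinearMap.id_apply] at this
    simp only [LinearMap.sub_apply, LinearMap.id_apply, map_sub, LinearMap.comp_apply, this,
      sub_self]
  refine ⟨(LinearMap.id - s.comp L.mkQ).codRestrict L hmem, fun x => ?_⟩
  ext
  have : L.mkQ (x : B) = 0 := by simp
  simp [this]

/-- The character `q ↦ exp (2πi q)` of `ℚ`. -/
noncomputable def ratExp : ℚ →+ Additive ℂˣ where
  toFun q := Additive.ofMul (Units.mk0 (Complex.exp (2 * Real.pi * Complex.I * q))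
    (Complex.exp_ne_zero _))
  map_zero' := by
    apply Additive.toMul.injective
    ext
    simp
  map_add' a b := by
    apply Additive.toMul.injective
    ext
    simp [mul_add, Complex.exp_add]

theorem ratExp_eq_zero_iff (q : ℚ) : ratExp q = 0 ↔ ∃ n : ℤ, q = n := by
  have : ratExp q = 0 ↔ Complex.exp (2 * Real.pi * Complex.I * q) = 1 := by
    rw [← Additive.toMul.injective.eq_iff, Units.ext_iff]
    simp [ratExp]
  rw [this, Complex.exp_eq_one_iff]
  refine exists_congr fun n => ?_
  have h : (2 * Real.pi * Complex.I : ℂ) ≠ 0 := Complex.two_pi_I_ne_zero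
  rw [mul_comm (n : ℂ), mul_right_inj' h]
  norm_cast

theorem finite_cokerTors {A B : Type*} [AddCommGroup A] [AddCommGroup B] [Module.Finite ℤ B]
    (f : A →+ B) : Finite (cokerTors f) := by
  have h1 : Module.Finite ℤ (B ⧸ f.range) :=
    Module.Finite.of_surjective (QuotientAddGroup.mk' f.range).toIntLinearMap
      (QuotientAddGroup.mk'_surjective _)
  have h2 : Module.Finite ℤ (AddSubgroup.toIntSubmodule (AddCommGroup.torsion (B ⧸ f.range))) :=
    inferInstance
  have h3 : AddGroup.FG (cokerTors f) := by
    have : Module.Finite ℤ (cokerTors f) := h2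
    exact Module.Finite.iff_addGroup_fg.1 this
  refine AddCommGroup.finite_of_fg_isAddTorsion _ ?_
  intro x
  obtain ⟨n, hn, h⟩ := isOfFinAddOrder_iff_nsmul_eq_zero.1 x.2
  exact isOfFinAddOrder_iff_nsmul_eq_zero.2 ⟨n, hn, Subtype.ext h⟩

theorem mk_mem_torsion_iff {A B : Type*} [AddCommGroup A] [AddCommGroup B] (f : A →+ B) (b : B) :
    (QuotientAddGroup.mk b : B ⧸ f.range) ∈ AddCommGroup.torsion (B ⧸ f.range) ↔
      ∃ n : ℕ, 0 < n ∧ n • b ∈ f.range := by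
  refine isOfFinAddOrder_iff_nsmul_eq_zero.trans ?_
  refine exists_congr fun n => and_congr_right fun _ => ?_
  rw [← QuotientAddGroup.eq_zero_iff]
  rfl

/-- The transpose has at most as much torsion in its cokernel. -/
theorem card_cokerTors_compHom_le {A B : Type*} [AddCommGroup A] [AddCommGroup B]
    [Module.Finite ℤ B] (f : A →+ B) :
    Finite (cokerTors (f.compHom' : (B →+ ℤ) →+ (A →+ ℤ))) ∧
      Nat.card (cokerTors (f.compHom' : (B →+ ℤ) →+ (A →+ ℤ))) ≤ Nat.card (cokerTors f) := by
  have hfin := finite_cokerTors f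
  -- If n•h = g ∘ f, then G = g/n is a rational-valued extension of h along f.
  have key : ∀ y : cokerTors (f.compHom' : (B →+ ℤ) →+ (A →+ ℤ)), ∃ (h : A →+ ℤ) (G : B →+ ℚ),
      QuotientAddGroup.mk h = y.1 ∧ ∀ a, G (f a) = h a := by
    rintro ⟨y, hy⟩
    obtain ⟨h, rfl⟩ := QuotientAddGroup.mk_surjective y
    obtain ⟨n, hn, g, hg⟩ := (mk_mem_torsion_iff _ h).1 hy
    refine ⟨h, (AddMonoidHom.mulLeft (n : ℚ)⁻¹).comp ((Int.castAddHom ℚ).comp g), rfl, fun a => ?_⟩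
    have h1 : g (f a) = n • h a := DFunLike.congr_fun hg a
    have hn' : (n : ℚ) ≠ 0 := by positivity
    simp [h1, hn']
  choose h G hh hG using key
  -- exp(2πi G) is trivial on the image of f, where G takes the integral values of h, so it induces
  -- a character of the cokernel, here restricted to torsion.
  let E : cokerTors (f.compHom' : (B →+ ℤ) →+ (A →+ ℤ)) → (cokerTors f →+ Additive ℂˣ) := fun y =>
    (QuotientAddGroup.lift f.range (ratExp.comp (G y)) (by
      rintro _ ⟨a, rfl⟩
      exact (ratExp_eq_zero_iff _).2 ⟨h y a, hG y a⟩)).comp (AddSubgroup.subtype _)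
  have hE : Function.Injective E := by
    intro y y' hyy
    -- L is the saturation of the image of f. Equality of the two characters says that the
    -- difference of the G's is integral on L; composing with a retraction onto L gives an integral
    -- functional on B whose pullback along f is the difference of the h's.
    let L : Submodule ℤ B :=
      AddSubgroup.toIntSubmodule ((AddCommGroup.torsion (B ⧸ f.range)).comap
        (QuotientAddGroup.mk' f.range))
    have hL : ∀ b, b ∈ L ↔ ∃ n : ℕ, 0 < n ∧ n • b ∈ f.range := fun b => mk_mem_torsion_iff f b
    obtain ⟨r, hr⟩ := exists_retraction_of_saturated L (by
      intro n b hn hb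
      obtain ⟨m, hm, hb⟩ := (hL _).1 hb
      exact (hL b).2 ⟨m * n, by positivity, by rwa [mul_smul]⟩)
    have hint : ∀ b : L, ∃ n : ℤ, (G y - G y') b = n := fun b => by
      rw [← ratExp_eq_zero_iff, AddMonoidHom.sub_apply, map_sub, sub_eq_zero]
      exact DFunLike.congr_fun hyy ⟨QuotientAddGroup.mk b.1, b.2⟩
    choose l hl using hint
    let l' : L →+ ℤ :=
      { toFun := l
        map_zero' := by
          have := hl 0
          rw [ZeroMemClass.coe_zero, map_zero] at this
          exact_mod_cast this.symm
        map_add' := fun a b => by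
          have := hl (a + b)
          rw [Submodule.coe_add, map_add, hl, hl] at this
          exact_mod_cast this.symm }
    apply Subtype.ext
    rw [← hh y, ← hh y', QuotientAddGroup.eq_iff_sub_mem]
    refine ⟨l'.comp r.toAddMonoidHom, ?_⟩
    ext a
    have hfa : f a ∈ L := (hL _).2 ⟨1, one_pos, by simp⟩
    have h1 : r (f a) = ⟨f a, hfa⟩ := hr ⟨f a, hfa⟩
    have h2 := hl ⟨f a, hfa⟩
    simp only [AddMonoidHom.sub_apply, hG] at h2
    have h3 : h y a - h y' a = l ⟨f a, hfa⟩ := by exact_mod_cast h2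
    change l (r (f a)) = h y a - h y' a
    rw [h1, h3]
  have hcard := card_hom_units (K := ℂ) (cokerTors f)
  have : Finite (cokerTors f →+ Additive ℂˣ) := Nat.finite_of_card_ne_zero (by
    rw [hcard]; exact Nat.card_pos.ne')
  exact ⟨Finite.of_injective E hE, hcard ▸ Nat.card_le_card_of_injective E hE⟩

theorem card_cokerTors_congr {A B A' B' : Type*} [AddCommGroup A] [AddCommGroup B]
    [AddCommGroup A'] [AddCommGroup B'] (f : A →+ B) (f' : A' →+ B') (eA : A ≃+ A') (eB : B ≃+ B')
    (h : ∀ a, eB (f a) = f' (eA a)) : Nonempty (cokerTors f ≃ cokerTors f') := by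
  have hr : f.range.map eB.toAddMonoidHom = f'.range := by
    ext y
    constructor
    · rintro ⟨_, ⟨a, rfl⟩, rfl⟩
      exact ⟨eA a, (h a).symm⟩
    · rintro ⟨a, rfl⟩
      exact ⟨f (eA.symm a), ⟨_, rfl⟩, (h _).trans (by simp)⟩
  let e : B ⧸ f.range ≃+ B' ⧸ f'.range := QuotientAddGroup.congr _ _ eB hr
  refine ⟨e.toEquiv.subtypeEquiv fun x => ?_⟩
  exact (Function.Injective.isOfFinAddOrder_iff (f := e.toAddMonoidHom) e.injective).symm

theorem bijective_eval (C : Type*) [AddCommGroup C] [Module.Finite ℤ C] [Module.Free ℤ C] :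
    Function.Bijective (AddMonoidHom.eval : C →+ (C →+ ℤ) →+ ℤ) := by
  have h := (Module.evalEquiv ℤ C).bijective
  refine ⟨fun a b hab => h.1 ?_, fun g => ?_⟩
  · ext φ
    exact DFunLike.congr_fun hab φ.toAddMonoidHom
  · obtain ⟨c, hc⟩ := h.2 ((g.comp (addMonoidHomLequivInt (A := C) (B := ℤ) ℤ).symm.toLinearMap.toAddMonoidHom).toIntLinearMap)
    refine ⟨c, ?_⟩
    ext φ
    exact DFunLike.congr_fun hc φ.toIntLinearMap

/-- The inequality is applied to f and to its transpose: by biduality the double transpose is f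
again. -/
theorem card_cokerTors_compHom {A B : Type*} [AddCommGroup A] [AddCommGroup B]
    [Module.Finite ℤ A] [Module.Free ℤ A] [Module.Finite ℤ B] [Module.Free ℤ B] (f : A →+ B) :
    Nat.card (cokerTors (f.compHom' : (B →+ ℤ) →+ (A →+ ℤ))) = Nat.card (cokerTors f) := by
  refine le_antisymm (card_cokerTors_compHom_le f).2 ?_
  have : Module.Finite ℤ (A →+ ℤ) :=
    Module.Finite.equiv (addMonoidHomLequivInt (A := A) (B := ℤ) ℤ).symm
  obtain ⟨e⟩ := card_cokerTors_congr f
    ((f.compHom' : (B →+ ℤ) →+ (A →+ ℤ)).compHom' : ((A →+ ℤ) →+ ℤ) →+ ((B →+ ℤ) →+ ℤ))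
    (AddEquiv.ofBijective _ (bijective_eval A)) (AddEquiv.ofBijective _ (bijective_eval B))
    (fun a => rfl)
  rw [Nat.card_congr e]
  exact (card_cokerTors_compHom_le _).2

/-- `Hom(Q, ℤ) = Hom(Q^gp, ℤ)`. -/
noncomputable def liftAddEquiv (Q : Type*) [AddCommMonoid Q] :
    (Q →+ ℤ) ≃+ (GrothendieckAddGroup Q →+ ℤ) :=
  { GrothendieckAddGroup.lift with
    map_add' := fun a b => by
      apply GrothendieckAddGroup.lift.symm.injective
      change GrothendieckAddGroup.lift.symm (GrothendieckAddGroup.lift (a + b)) = _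
      rw [Equiv.symm_apply_apply]
      ext q
      change a q + b q = GrothendieckAddGroup.lift a (GrothendieckAddGroup.of q) +
        GrothendieckAddGroup.lift b (GrothendieckAddGroup.of q)
      rw [lift_of, lift_of] }

/-- Under Hom(Q, ℤ) = Hom(Q^gp, ℤ) the map θᵗ becomes precomposition with θ, a homomorphism of
finitely generated free groups. -/
theorem card_cokerTors_thetaTranspose {P Q₁ Q₂ : Type*} [AddCommMonoid P] [AddCommMonoid Q₁]
    [AddCommMonoid Q₂] [Module.Finite ℤ (GrothendieckAddGroup P)]
    [Module.Finite ℤ (GrothendieckAddGroup Q₁)] [Module.Finite ℤ (GrothendieckAddGroup Q₂)]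
    [Module.Free ℤ (GrothendieckAddGroup P)] [Module.Free ℤ (GrothendieckAddGroup Q₁)]
    [Module.Free ℤ (GrothendieckAddGroup Q₂)] (θ₁ : P →+ Q₁) (θ₂ : P →+ Q₂) :
    Finite (cokerTors (theta θ₁ θ₂)) ∧ Finite (cokerTors (thetaTranspose θ₁ θ₂)) ∧
      Nat.card (cokerTors (theta θ₁ θ₂)) = Nat.card (cokerTors (thetaTranspose θ₁ θ₂)) := by
  obtain ⟨e⟩ := card_cokerTors_congr (thetaTranspose θ₁ θ₂)
    ((theta θ₁ θ₂).compHom' : (GrothendieckAddGroup Q₁ × GrothendieckAddGroup Q₂ →+ ℤ) →+ _)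
    (((liftAddEquiv Q₁).prodCongr (liftAddEquiv Q₂)).trans
      { toFun := fun p => p.1.coprod p.2
        invFun := fun g => (g.comp (AddMonoidHom.inl _ _), g.comp (AddMonoidHom.inr _ _))
        left_inv := fun p => by simp
        right_inv := fun g => by ext <;> simp
        map_add' := fun p q => by ext <;> simp [add_add_add_comm] })
    (liftAddEquiv P) (fun a => lift_thetaTranspose θ₁ θ₂ a)
  have := (card_cokerTors_compHom_le (theta θ₁ θ₂)).1
  exact ⟨finite_cokerTors _, Finite.of_equiv _ e.symm,
    (card_cokerTors_compHom _).symm.trans (Nat.card_congr e.symm)⟩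

/-! ### A ring joining two points -/

/-- A connected affine scheme over `K` with two `K`-points such that every element of `Kˣ` is the
ratio of the values of a unit at these points. -/
theorem exists_path_ring (K : Type u) [Field K] : ∃ (A : Type u) (_ : CommRing A) (_ : IsDomain A)
    (j : K →+* A) (e₀ e₁ : A →+* K), e₀.comp j = RingHom.id K ∧ e₁.comp j = RingHom.id K ∧
      ∀ c : Kˣ, ∃ u : Aˣ, Units.map e₀.toMonoidHom u = 1 ∧ Units.map e₁.toMonoidHom u = c := by
  open Polynomial in
  -- The ring is K[X] localised at the polynomials vanishing neither at 0 nor at 1, so that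
  -- evaluation at both points survives and many more elements become units.
  let S : Submonoid K[X] :=
    { carrier := {f | f.eval 0 ≠ 0 ∧ f.eval 1 ≠ 0}
      one_mem' := by simp
      mul_mem' := fun {a b} ha hb => by
        simp only [Set.mem_ofPred_eq, eval_mul] at *
        exact ⟨mul_ne_zero ha.1 hb.1, mul_ne_zero ha.2 hb.2⟩ }
  have hS : S ≤ nonZeroDivisors K[X] := fun f hf => mem_nonZeroDivisors_of_ne_zero (by
    rintro rfl
    exact hf.1 (by simp))
  let e₀ : Localization S →+* K := IsLocalization.lift (M := S) (g := evalRingHom 0)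
    fun y => (y.2.1).isUnit
  let e₁ : Localization S →+* K := IsLocalization.lift (M := S) (g := evalRingHom 1)
    fun y => (y.2.2).isUnit
  have h₀ : ∀ f : K[X], e₀ (algebraMap _ _ f) = f.eval 0 := fun f => IsLocalization.lift_eq _ f
  have h₁ : ∀ f : K[X], e₁ (algebraMap _ _ f) = f.eval 1 := fun f => IsLocalization.lift_eq _ f
  refine ⟨Localization S, inferInstance, IsLocalization.isDomain_localization hS,
    (algebraMap K[X] (Localization S)).comp C, e₀, e₁, ?_, ?_, fun c => ?_⟩
  · ext x; simp [h₀]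
  · ext x; simp [h₁]
  -- Linear interpolation between the value 1 at 0 and the value c at 1.
  · let f : K[X] := 1 + C (c.1 - 1) * X
    have hf : f ∈ S := by constructor <;> simp [f]
    refine ⟨(IsLocalization.map_units (Localization S) ⟨f, hf⟩).unit, ?_, ?_⟩
    · ext
      change e₀ (algebraMap _ _ f) = 1
      rw [h₀]; simp [f]
    · ext
      change e₁ (algebraMap _ _ f) = c
      rw [h₁]; simp [f]

/-- A homomorphism to `Kˣ` which is trivial on a saturated subgroup is joined to the trivial
homomorphism. -/
theorem exists_path_hom {K A : Type*} [CommRing K] [CommRing A] (e₀ e₁ : A →+* K)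
    (h : ∀ c : Kˣ, ∃ u : Aˣ, Units.map e₀.toMonoidHom u = 1 ∧ Units.map e₁.toMonoidHom u = c)
    {E : Type*} [AddCommGroup E] [Module.Finite ℤ E] (L : Submodule ℤ E)
    (hL : ∀ (n : ℕ) (b : E), 0 < n → n • b ∈ L → b ∈ L) (ψ : E →+ Additive Kˣ)
    (hψ : ∀ x ∈ L, ψ x = 0) : ∃ Ψ : E →+ Additive Aˣ, (∀ x ∈ L, Ψ x = 0) ∧
      (∀ x, (Units.map e₀.toMonoidHom).toAdditive (Ψ x) = 0) ∧
      ∀ x, (Units.map e₁.toMonoidHom).toAdditive (Ψ x) = ψ x := by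
  have := projective_quotient_of_saturated L hL
  -- `e₁` maps the units with value 1 under `e₀` onto Kˣ. Since E/L is projective, the character it
  -- inherits from ψ lifts to these units.
  let N := (Units.map e₀.toMonoidHom).toAdditive.ker
  obtain ⟨s, hs⟩ := Module.projective_lifting_property
    (((Units.map e₁.toMonoidHom).toAdditive.comp N.subtype).toIntLinearMap)
    (L.liftQ ψ.toIntLinearMap fun x hx => hψ x hx) (fun c => by
      obtain ⟨u, hu₀, hu₁⟩ := h (Additive.toMul c)
      exact ⟨⟨Additive.ofMul u, hu₀⟩, hu₁⟩)
  refine ⟨N.subtype.comp (s.toAddMonoidHom.comp L.mkQ.toAddMonoidHom), fun x hx => ?_, fun x => ?_,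
    fun x => ?_⟩
  · have : L.mkQ x = 0 := by simpa using hx
    simp [this]
  · exact (s (L.mkQ x)).2
  · exact DFunLike.congr_fun hs (L.mkQ x)

/-! ### The monoid `ℕ²` -/

/-- The monoid `ℕ²`, written multiplicatively. -/
abbrev NatSq : Type u := Multiplicative (ULift.{u} (ℕ × ℕ))

theorem exists_mul_of_eq_of {M : Type*} [CommMonoid M] (x : GrothendieckGroup M) :
    ∃ a b : M, x * GrothendieckGroup.of b = GrothendieckGroup.of a := by
  obtain ⟨⟨a, b⟩, h⟩ := (Localization.monoidOf (⊤ : Submonoid M)).surj x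
  exact ⟨a, b, h⟩

theorem exists_add_of_eq_of {M : Type*} [AddCommMonoid M] (x : GrothendieckAddGroup M) :
    ∃ a b : M, x + GrothendieckAddGroup.of b = GrothendieckAddGroup.of a := by
  obtain ⟨⟨a, b⟩, h⟩ := (AddLocalization.addMonoidOf (⊤ : AddSubmonoid M)).surj x
  exact ⟨a, b, h⟩

theorem natSq_isFsMonoid : IsFsMonoid NatSq.{u} where
  fg := by
    have h1 : AddMonoid.FG (ULift.{u} (ℕ × ℕ)) := by
      have : AddMonoid.FG (ℕ × ℕ) := inferInstance
      exact AddMonoid.fg_of_surjective (AddEquiv.ulift.symm : ℕ × ℕ ≃+ ULift.{u} (ℕ × ℕ)).toAddMonoidHom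
        (AddEquiv.ulift.symm).surjective
    exact AddMonoid.fg_iff_mul_fg.1 h1
  integral := GrothendieckGroup.of_injective
  saturated := by
    rintro x n hn ⟨c, hc⟩
    obtain ⟨a, b, h⟩ := exists_mul_of_eq_of x
    have h1 : c * b ^ n = a ^ n := by
      apply GrothendieckGroup.of_injective
      rw [map_mul, map_pow, map_pow, hc, ← mul_pow, h]
    have h2 := congrArg (fun z : NatSq => (Multiplicative.toAdd z).down) h1
    have h3 : (Multiplicative.toAdd c).down + n • (Multiplicative.toAdd b).down =
        n • (Multiplicative.toAdd a).down := h2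
    have hle : (Multiplicative.toAdd b).down ≤ (Multiplicative.toAdd a).down := by
      constructor
      · have := congrArg Prod.fst h3
        simp only [Prod.fst_add, Prod.smul_fst, smul_eq_mul] at this
        exact Nat.le_of_mul_le_mul_left (by omega) hn
      · have := congrArg Prod.snd h3
        simp only [Prod.snd_add, Prod.smul_snd, smul_eq_mul] at this
        exact Nat.le_of_mul_le_mul_left (by omega) hn
    obtain ⟨d, hd⟩ := exists_add_of_le hle
    refine ⟨Multiplicative.ofAdd ⟨d⟩, ?_⟩
    have h4 : Multiplicative.ofAdd ⟨d⟩ * b = a := by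
      apply Multiplicative.toAdd.injective
      apply ULift.ext
      exact (add_comm _ _).trans hd.symm
    rw [← h4, map_mul] at h
    exact (mul_right_cancel h).symm

end Algebra

/-! ### One-point schemes over an algebraically closed field -/

section Point

variable {κ : Type u} [Field κ] [IsAlgClosed κ] {W : Scheme.{u}} [ConnectedSpace W]

/-- A scheme finite over a point is discrete, and connectedness then leaves a single point. -/
theorem subsingleton_of_isFinite (s : W ⟶ Spec (.of κ)) [IsFinite s] : Subsingleton W := by
  have h1 : _root_.IsDiscrete (Set.univ : Set (Spec (.of κ))) :=
    (Set.subsingleton_of_subsingleton).isDiscrete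
  have h2 : _root_.IsDiscrete (Set.univ : Set W) := s.isDiscrete_preimage h1
  have : DiscreteTopology W := isDiscrete_univ_iff.1 h2
  exact PreconnectedSpace.trivial_of_discrete

theorem isAffine_of_isFinite (s : W ⟶ Spec (.of κ)) [IsFinite s] : IsAffine W :=
  isAffine_of_isAffineHom s

theorem isClosed_singleton_of_isFinite (s : W ⟶ Spec (.of κ)) [IsFinite s] (w : W) :
    IsClosed {w} := by
  have := subsingleton_of_isFinite s
  rw [Set.eq_univ_of_forall (s := {w}) fun y => Subsingleton.elim y w]
  exact isClosed_univ

/-- The `κ`-point of a one-point scheme finite over `κ`. -/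
noncomputable def kpt (s : W ⟶ Spec (.of κ)) [IsFinite s] : Spec (.of κ) ⟶ W :=
  pointOfClosedPoint s (Classical.arbitrary W) (isClosed_singleton_of_isFinite s _)

@[simp]
theorem kpt_comp (s : W ⟶ Spec (.of κ)) [IsFinite s] : kpt s ≫ s = 𝟙 _ :=
  pointOfClosedPoint_comp _ _ _

/-- Evaluation of functions at the `κ`-point. -/
noncomputable def kval (s : W ⟶ Spec (.of κ)) [IsFinite s] : Γ(W, ⊤) →+* κ :=
  ((Scheme.ΓSpecIso (.of κ)).hom.hom).comp (kpt s).appTop.hom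

theorem isNilpotent_of_kval_eq_zero (s : W ⟶ Spec (.of κ)) [IsFinite s] (x : Γ(W, ⊤))
    (hx : kval s x = 0) : IsNilpotent x := by
  have := subsingleton_of_isFinite s
  have := isAffine_of_isFinite s
  have hsub : Subsingleton (PrimeSpectrum Γ(W, ⊤)) :=
    (W.isoSpec.hom.homeomorph.symm.injective).subsingleton
  rw [nilpotent_iff_mem_prime]
  intro J hJ
  have h1 : (⟨J, hJ⟩ : PrimeSpectrum Γ(W, ⊤)) = ⟨RingHom.ker (kval s), RingHom.ker_isPrime _⟩ :=
    Subsingleton.elim _ _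
  have h2 : J = RingHom.ker (kval s) := congrArg PrimeSpectrum.asIdeal h1
  rw [h2]
  exact hx

theorem isUnit_iff_kval_ne_zero (s : W ⟶ Spec (.of κ)) [IsFinite s] (x : Γ(W, ⊤)) :
    IsUnit x ↔ kval s x ≠ 0 := by
  refine ⟨fun h => (h.map (kval s)).ne_zero, fun h => ?_⟩
  have := subsingleton_of_isFinite s
  have := isAffine_of_isFinite s
  have hsub : Subsingleton (PrimeSpectrum Γ(W, ⊤)) :=
    (W.isoSpec.hom.homeomorph.symm.injective).subsingleton
  by_contra hx
  obtain ⟨M, hM, hxM⟩ := exists_max_ideal_of_mem_nonunits hx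
  have h1 : (⟨M, hM.isPrime⟩ : PrimeSpectrum Γ(W, ⊤)) =
      ⟨RingHom.ker (kval s), RingHom.ker_isPrime _⟩ := Subsingleton.elim _ _
  have h2 : M = RingHom.ker (kval s) := congrArg PrimeSpectrum.asIdeal h1
  rw [h2] at hxM
  exact h hxM

/-- The inclusion of constants. -/
noncomputable def kconst {S : Scheme.{u}} (t : S ⟶ Spec (.of κ)) : κ →+* Γ(S, ⊤) :=
  t.appTop.hom.comp ((Scheme.ΓSpecIso (.of κ)).inv.hom)

theorem kval_kconst (s : W ⟶ Spec (.of κ)) [IsFinite s] (c : κ) : kval s (kconst s c) = c := by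
  have h : (Scheme.ΓSpecIso (.of κ)).inv ≫ s.appTop ≫ (kpt s).appTop ≫
      (Scheme.ΓSpecIso (.of κ)).hom = 𝟙 _ := by
    rw [← Scheme.Hom.comp_appTop_assoc, kpt_comp]
    simp
  exact congr($(h).hom c)

theorem kconst_comp {S T : Scheme.{u}} (t : T ⟶ Spec (.of κ)) (b : S ⟶ T) (c : κ) :
    b.appTop.hom (kconst t c) = kconst (b ≫ t) c := by
  simp only [kconst, Scheme.Hom.comp_appTop]
  rfl

/-- A morphism from a reduced scheme takes a function to the constant given by its value. -/
theorem appTop_eq_kconst_kval (s : W ⟶ Spec (.of κ)) [IsFinite s] {S : Scheme.{u}} (b : S ⟶ W)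
    [_root_.IsReduced Γ(S, ⊤)] (x : Γ(W, ⊤)) : b.appTop.hom x = kconst (b ≫ s) (kval s x) := by
  rw [← kconst_comp, ← sub_eq_zero, ← map_sub]
  refine IsNilpotent.eq_zero (IsNilpotent.map (isNilpotent_of_kval_eq_zero s _ ?_) b.appTop.hom)
  rw [map_sub, kval_kconst, sub_self]

theorem kpt_appTop (s : W ⟶ Spec (.of κ)) [IsFinite s] {S : Scheme.{u}}
    (t : S ⟶ Spec (.of κ)) (x : Γ(W, ⊤)) : (t ≫ kpt s).appTop.hom x = kconst t (kval s x) := by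
  have h : (t ≫ kpt s).appTop = (kpt s).appTop ≫ (Scheme.ΓSpecIso (.of κ)).hom ≫
      (Scheme.ΓSpecIso (.of κ)).inv ≫ t.appTop := by
    rw [Scheme.Hom.comp_appTop, Iso.hom_inv_id_assoc]
  exact congr($(h).hom x)

/-- A reduced `κ`-scheme has a unique `κ`-morphism to a one-point scheme finite over `κ`. -/
theorem eq_comp_kpt (s : W ⟶ Spec (.of κ)) [IsFinite s] {S : Scheme.{u}} (b : S ⟶ W)
    [_root_.IsReduced Γ(S, ⊤)] : b = (b ≫ s) ≫ kpt s := by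
  have := isAffine_of_isFinite s
  refine ext_of_isAffine ?_
  ext x
  rw [appTop_eq_kconst_kval s, kpt_appTop]

/-- The κ-point of W lifts through v because κ is separably closed. The ring of functions of W is a
nilpotent thickening of κ, so formal smoothness extends the lift from the closed point to all of W.
-/
theorem exists_section (s : W ⟶ Spec (.of κ)) [IsFinite s] {V : Scheme.{u}} (f : V ⟶ W) [Etale f]
    (v : V) : ∃ σ : W ⟶ V, σ ≫ f = 𝟙 _ ∧ ∀ w, σ w = v := by
  have := subsingleton_of_isFinite s
  have := isAffine_of_isFinite s
  have hN : IsNoetherianRing Γ(W, ⊤) := by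
    have : IsLocallyNoetherian W := LocallyOfFiniteType.isLocallyNoetherian s
    exact IsLocallyNoetherian.component_noetherian ⟨⊤, isAffineOpen_top W⟩
  obtain ⟨l, hl, hlv⟩ := Scheme.exists_fac_of_etale_of_isSepClosed f (kpt s) v
    (Subsingleton.elim _ _)
  obtain ⟨U, hU, hvU, -⟩ := exists_isAffineOpen_mem_and_subset (x := v) (U := ⊤) trivial
  have hT := isAffineOpen_top W
  have hiso : IsIso hT.fromSpec := by
    have : Surjective hT.fromSpec := ⟨by
      rw [← Set.range_eq_univ, hT.range_fromSpec]; rfl⟩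
    exact Flat.isIso_of_surjective_of_mono hT.fromSpec
  have hrange : Set.range l ⊆ Set.range hU.fromSpec := by
    rintro _ ⟨p, rfl⟩
    rw [hU.range_fromSpec, Subsingleton.elim p default, hlv]
    exact hvU
  let t := IsOpenImmersion.lift hU.fromSpec l hrange
  have ht : t ≫ hU.fromSpec = l := IsOpenImmersion.lift_fac _ _ _
  let φ : Γ(W, ⊤) ⟶ Γ(V, U) := f.appLE ⊤ U le_top
  have hφ : φ.hom.Etale := f.etale_appLE hT hU le_top
  let g : Γ(V, U) ⟶ .of κ := Spec.preimage t
  let ρ : Γ(W, ⊤) ⟶ .of κ := φ ≫ g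
  have hρ : Spec.map ρ ≫ hT.fromSpec = kpt s := by
    rw [Spec.map_comp, Category.assoc, IsAffineOpen.SpecMap_appLE_fromSpec f hT hU le_top, ← hl, ← ht]
    simp [g]
  have hρs : Function.Surjective ρ.hom := by
    intro c
    have h1 : (hT.fromSpec ≫ s) = Spec.map (Spec.preimage (hT.fromSpec ≫ s)) := by simp
    have h2 : Spec.preimage (hT.fromSpec ≫ s) ≫ ρ = 𝟙 _ := by
      apply Spec.map_injective
      rw [Spec.map_comp, ← h1, ← Category.assoc, hρ, kpt_comp, Spec.map_id]
    exact ⟨(Spec.preimage (hT.fromSpec ≫ s)).hom c, congr($(h2).hom c)⟩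
  -- The ring has only one prime ideal, so the kernel lies in the nilradical, which is nilpotent by
  -- noetherianity.
  have hker : IsNilpotent (RingHom.ker ρ.hom) := by
    have h1 : RingHom.ker ρ.hom ≤ nilradical _ := by
      intro x hx
      have hsub : Subsingleton (PrimeSpectrum Γ(W, ⊤)) :=
        (W.isoSpec.hom.homeomorph.symm.injective).subsingleton
      rw [mem_nilradical, nilpotent_iff_mem_prime]
      intro J hJ
      have h1 : (⟨J, hJ⟩ : PrimeSpectrum Γ(W, ⊤)) = ⟨RingHom.ker ρ.hom, RingHom.ker_isPrime _⟩ :=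
        Subsingleton.elim _ _
      have h2 : J = RingHom.ker ρ.hom := congrArg PrimeSpectrum.asIdeal h1
      rw [h2]
      exact hx
    obtain ⟨n, hn⟩ := IsNoetherianRing.isNilpotent_nilradical Γ(W, ⊤)
    exact ⟨n, le_bot_iff.1 ((Ideal.pow_right_mono h1 n).trans hn.le)⟩
  obtain ⟨τ, hτ, hτg⟩ : ∃ τ : Γ(V, U) ⟶ Γ(W, ⊤), φ ≫ τ = 𝟙 _ ∧ τ ≫ ρ = g := by
    algebraize [φ.hom, ρ.hom]
    have : Algebra.FormallySmooth Γ(W, ⊤) Γ(V, U) := inferInstance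
    let g' : Γ(V, U) →ₐ[Γ(W, ⊤)] κ := { g.hom with commutes' := fun r => rfl }
    let ρ' : Γ(W, ⊤) →ₐ[Γ(W, ⊤)] κ := { ρ.hom with commutes' := fun r => rfl }
    let τ' := Algebra.FormallySmooth.liftOfSurjective g' ρ' hρs hker
    refine ⟨CommRingCat.ofHom τ'.toRingHom, ?_, ?_⟩
    · ext x
      exact τ'.commutes x
    · ext x
      exact Algebra.FormallySmooth.liftOfSurjective_apply g' ρ' hρs hker x
  let σ : W ⟶ V := inv hT.fromSpec ≫ Spec.map τ ≫ hU.fromSpec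
  have hσ : σ ≫ f = 𝟙 _ := by
    simp only [σ, Category.assoc]
    rw [← IsAffineOpen.SpecMap_appLE_fromSpec f hT hU le_top, ← Spec.map_comp_assoc, hτ]
    simp
  refine ⟨σ, hσ, fun w => ?_⟩
  have h1 : kpt s ≫ σ = l := by
    simp only [σ]
    rw [← hρ, Category.assoc, IsIso.hom_inv_id_assoc, ← Spec.map_comp_assoc, hτg, ← ht]
    simp [g]
  rw [Subsingleton.elim w (kpt s default), ← Scheme.Hom.comp_apply, h1, hlv]

/-- The section of an étale morphism to a one-point scheme through a given point. -/
noncomputable def secAt (s : W ⟶ Spec (.of κ)) [IsFinite s] {V : Scheme.{u}} (f : V ⟶ W) [Etale f]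
    (v : V) : W ⟶ V :=
  (exists_section s f v).choose

@[simp]
theorem secAt_comp (s : W ⟶ Spec (.of κ)) [IsFinite s] {V : Scheme.{u}} (f : V ⟶ W) [Etale f]
    (v : V) : secAt s f v ≫ f = 𝟙 _ :=
  (exists_section s f v).choose_spec.1

@[simp]
theorem secAt_apply (s : W ⟶ Spec (.of κ)) [IsFinite s] {V : Scheme.{u}} (f : V ⟶ W) [Etale f]
    (v : V) (w : W) : secAt s f v w = v :=
  (exists_section s f v).choose_spec.2 w

instance (s : W ⟶ Spec (.of κ)) [IsFinite s] {V : Scheme.{u}} (f : V ⟶ W) [Etale f]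
    (v : V) : IsOpenImmersion (secAt s f v) := by
  have : Etale (secAt s f v ≫ f) := by rw [secAt_comp]; infer_instance
  have : Etale (secAt s f v) := Etale.of_comp _ f
  have : Mono (secAt s f v) := by
    have : Mono (secAt s f v ≫ f) := by rw [secAt_comp]; infer_instance
    exact mono_of_mono _ f
  exact IsOpenImmersion.of_flat_of_mono _

theorem range_secAt (s : W ⟶ Spec (.of κ)) [IsFinite s] {V : Scheme.{u}} (f : V ⟶ W) [Etale f]
    (v : V) : Set.range (secAt s f v) = {v} := by
  ext y
  constructor
  · rintro ⟨w, rfl⟩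
    simp
  · rintro rfl
    exact ⟨Classical.arbitrary W, by simp⟩

theorem discreteTopology_of_etale (s : W ⟶ Spec (.of κ)) [IsFinite s] {V : Scheme.{u}} (f : V ⟶ W)
    [Etale f] : DiscreteTopology V := by
  rw [discreteTopology_iff_isOpen_singleton]
  intro v
  rw [← range_secAt s f v]
  exact (secAt s f v).isOpenEmbedding.isOpen_range

/-- A morphism which is constant as a map factors through the section. -/
theorem eq_comp_secAt (s : W ⟶ Spec (.of κ)) [IsFinite s] {V : Scheme.{u}} (f : V ⟶ W) [Etale f]
    (v : V) {T : Scheme.{u}} (b : T ⟶ V) (hb : ∀ x, b x = v) : b = (b ≫ f) ≫ secAt s f v := by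
  have hr : Set.range b ⊆ Set.range (secAt s f v) := by
    rw [range_secAt]
    rintro _ ⟨x, rfl⟩
    exact hb x
  have h1 := IsOpenImmersion.lift_fac (secAt s f v) b hr
  have h2 : b ≫ f = IsOpenImmersion.lift (secAt s f v) b hr := by
    conv_lhs => rw [← h1]
    rw [Category.assoc, secAt_comp, Category.comp_id]
  rw [h2, h1]

end Point

/-! ### Sheaves on the small étale site -/

section Sheaf

variable (S : Scheme.{u})

/-- This allows sheaves on the big étale site to be restricted to sheaves on the small one. -/
theorem isContinuous_forget :
    (Scheme.Etale.forget S ⋙ Over.forget S).IsContinuous S.smallEtaleTopology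
      Scheme.etaleTopology := by
  have : (Scheme.Etale.forget S).IsContinuous S.smallEtaleTopology
      (Scheme.etaleTopology.over S) := by
    have : RepresentablyFlat (Scheme.Etale.forget S) := flat_of_preservesFiniteLimits _
    rw [Functor.isContinuous_iff_coverPreserving]
    have hm : MorphismProperty.IsMultiplicative (@Etale : MorphismProperty Scheme.{u}) :=
      inferInstance
    have hs : MorphismProperty.IsStableUnderBaseChange (@Etale : MorphismProperty Scheme.{u}) :=
      inferInstance
    have := hm.toIsStableUnderComposition
    have := hs.respectsIso
    have : (Scheme.Etale.forget S).LocallyCoverDense (Scheme.etaleTopology.over S) :=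
      Scheme.locallyCoverDense_of_le S le_rfl
    exact Functor.coverPreserving_restrictedTopology
      (Scheme.Etale.forget S) (Scheme.etaleTopology.over S)
  exact Functor.isContinuous_comp _ _ _ (Scheme.etaleTopology.over S) _

theorem etaleTopology_le_fpqcTopology : Scheme.etaleTopology.{u} ≤ Scheme.fpqcTopology.{u} :=
  Scheme.etaleTopology_le_proetaleTopology.trans Scheme.proetaleTopology_le_fpqcTopology

theorem isSheaf_continuousMap (T : Type u) [TopologicalSpace T] :
    Presieve.IsSheaf S.smallEtaleTopology
      ((Scheme.Etale.forget S ⋙ Over.forget S).op ⋙ continuousMapPresheaf T) := by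
  rw [← isSheaf_iff_isSheaf_of_type]
  have := isContinuous_forget S
  exact (Scheme.Etale.forget S ⋙ Over.forget S).op_comp_isSheaf S.smallEtaleTopology
    Scheme.etaleTopology ⟨_, Presheaf.IsSheaf.of_le etaleTopology_le_fpqcTopology
      (isSheaf_fpqcTopology_continuousMapPresheaf T)⟩

/-- Global functions are represented by the affine line, and the étale topology is subcanonical. -/
theorem isSheaf_functions :
    Presieve.IsSheaf S.smallEtaleTopology
      ((Scheme.Etale.forget S ⋙ Over.forget S).op ⋙ (Scheme.Γ ⋙ forget CommRingCat)) := by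
  rw [← isSheaf_iff_isSheaf_of_type]
  have := isContinuous_forget S
  have : Scheme.etaleTopology.{u}.Subcanonical := .of_le etaleTopology_le_fpqcTopology
  refine (Scheme.Etale.forget S ⋙ Over.forget S).op_comp_isSheaf S.smallEtaleTopology
    Scheme.etaleTopology ⟨Scheme.Γ ⋙ forget CommRingCat, ?_⟩
  rw [isSheaf_iff_isSheaf_of_type]
  let e : Functor.RepresentableBy (Scheme.Γ.{u} ⋙ forget CommRingCat) _ :=
    { homEquiv := fun {X} =>
        (AffineSpace.toSpecMvPolyIntEquiv (X := X) PUnit.{u + 1}).trans (Equiv.funUnique _ _)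
      homEquiv_comp := fun f g => AffineSpace.toSpecMvPolyIntEquiv_comp _ f g _ }
  have := Functor.RepresentableBy.isRepresentable e
  exact GrothendieckTopology.Subcanonical.isSheaf_of_isRepresentable (Scheme.Γ.{u} ⋙ forget CommRingCat)

/-- Homomorphisms from a test monoid E are glued element by element; multiplicativity of the glued
map follows from separatedness. -/
theorem isSheaf_of_forget {C : Type*} [Category C] (J : GrothendieckTopology C)
    (M : Cᵒᵖ ⥤ CommMonCat.{u}) (h : Presieve.IsSheaf J (M ⋙ forget CommMonCat)) :
    Presheaf.IsSheaf J M := by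
  intro E X R hR x hx
  have hsep := (h R hR).isSeparatedFor
  let y : E → Presieve.FamilyOfElements (M ⋙ forget CommMonCat) R.arrows :=
    fun e _ f hf => (x f hf).hom e
  have hy : ∀ e, (y e).Compatible := fun e Y₁ Y₂ Z g₁ g₂ f₁ f₂ h₁ h₂ w =>
    congr($(hx g₁ g₂ h₁ h₂ w).hom e)
  choose t ht using fun e => (h R hR (y e) (hy e)).exists
  let T : E →* M.obj (op X) :=
    { toFun := t
      map_one' := hsep (y 1) _ _ (ht 1) fun Y f hf =>
        ((M.map f.op).hom.map_one).trans ((x f hf).hom.map_one).symm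
      map_mul' := fun a b => hsep (y (a * b)) _ _ (ht _) fun Y f hf => by
        refine ((M.map f.op).hom.map_mul _ _).trans (Eq.trans ?_ ((x f hf).hom.map_mul a b).symm)
        exact congrArg₂ (· * ·) (ht a f hf) (ht b f hf) }
  refine ⟨CommMonCat.ofHom T, fun Y f hf => ?_, fun T' hT' => ?_⟩
  · refine CommMonCat.hom_ext (MonoidHom.ext fun e => ?_)
    exact ht e f hf
  · refine CommMonCat.hom_ext (MonoidHom.ext fun e => ?_)
    exact hsep (y e) _ _ (fun Y f hf => congr($(hT' f hf).hom e)) (ht e)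

end Sheaf

/-! ### Gluing locally constant functions -/

section Glue

variable {U : Scheme.{u}}

/-- The germ at a point of a global function. -/
noncomputable abbrev gm (y : U) : Γ(U, ⊤) →+* U.presheaf.stalk y :=
  (U.presheaf.germ ⊤ y trivial).hom

theorem gm_ext {a b : Γ(U, ⊤)} (h : ∀ y, gm y a = gm y b) : a = b :=
  TopCat.Presheaf.section_ext U.sheaf ⊤ a b fun y _ => h y

/-- The fibres of F form a cover by disjoint open sets; on the fibre over b the section b is taken.
-/
theorem exists_glue (F : LocallyConstant U Γ(U, ⊤)) : ∃ x : Γ(U, ⊤), ∀ y, gm y x = gm y (F y) := by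
  let O : Γ(U, ⊤) → U.Opens := fun b => ⟨F ⁻¹' {b}, F.isLocallyConstant _⟩
  obtain ⟨x, hx, -⟩ := TopCat.Sheaf.existsUnique_gluing' U.sheaf O ⊤ (fun b => homOfLE le_top)
    (fun y _ => TopologicalSpace.Opens.mem_iSup.2 ⟨F y, rfl⟩)
    (fun b => U.presheaf.map (homOfLE le_top).op b) (by
      intro b b'
      refine TopCat.Presheaf.section_ext U.sheaf _ _ _ fun y hy => ?_
      have h1 : F y = b := hy.1
      have h2 : F y = b' := hy.2
      obtain rfl : b = b' := h1.symm.trans h2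
      erw [TopCat.Presheaf.germ_res_apply, TopCat.Presheaf.germ_res_apply])
  refine ⟨x, fun y => ?_⟩
  have h1 := congrArg (U.presheaf.germ (O (F y)) y rfl).hom (hx (F y))
  erw [TopCat.Presheaf.germ_res_apply, TopCat.Presheaf.germ_res_apply] at h1
  exact h1

/-- The function on `U` given by a locally constant function with values in functions. -/
noncomputable def glue : LocallyConstant U Γ(U, ⊤) →+* Γ(U, ⊤) where
  toFun F := (exists_glue F).choose
  map_one' := gm_ext fun y => by rw [(exists_glue _).choose_spec]; rfl
  map_zero' := gm_ext fun y => by rw [(exists_glue _).choose_spec]; rfl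
  map_mul' a b := gm_ext fun y => by
    rw [(exists_glue _).choose_spec, map_mul, (exists_glue _).choose_spec,
      (exists_glue _).choose_spec, ← map_mul]; rfl
  map_add' a b := gm_ext fun y => by
    rw [(exists_glue _).choose_spec, map_add, (exists_glue _).choose_spec,
      (exists_glue _).choose_spec, ← map_add]; rfl

theorem gm_glue (F : LocallyConstant U Γ(U, ⊤)) (y : U) : gm y (glue F) = gm y (F y) :=
  (exists_glue F).choose_spec y

/-- Germs of pulled back functions. -/
theorem gm_appTop {V : Scheme.{u}} (f : U ⟶ V) (y : U) (x : Γ(V, ⊤)) :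
    gm y (f.appTop.hom x) = (f.stalkMap y).hom (gm (f y) x) := by
  have := Scheme.Hom.germ_stalkMap f ⊤ y trivial
  exact congr($(this).hom x).symm

theorem isUnit_iff_gm {a : Γ(U, ⊤)} : IsUnit a ↔ ∀ y, IsUnit (gm y a) := by
  refine ⟨fun h y => h.map _, fun h => ?_⟩
  exact U.toRingedSpace.isUnit_of_isUnit_germ ⊤ a fun y _ => h y

end Glue

/-! ### Hollow log schemes -/

/-! ### Covers on the small étale site by open subschemes -/

section Site

variable {S : Scheme.{u}}

theorem mem_smallEtaleTopology_of_forall {V : S.Etale} (R : Sieve V)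
    (h : ∀ x : V.left, ∃ (Y : S.Etale) (f : Y ⟶ V) (y : Y.left), R f ∧ f.left y = x) :
    R ∈ S.smallEtaleTopology V := by
  choose Y f y hR hy using h
  refine GrothendieckTopology.superset_covering _ ?_
    (Scheme.ofArrows_mem_smallEtaleTopology_iff f |>.2 ?_)
  · rw [Sieve.ofArrows, Sieve.generate_le_iff]
    rintro _ _ ⟨i⟩
    exact hR i
  · exact Set.eq_univ_of_forall fun x => Set.mem_iUnion.2 ⟨x, y x, hy x⟩

/-- An open subscheme of an étale scheme. -/
noncomputable def etaleOpen (V : S.Etale) (O : V.left.Opens) : S.Etale :=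
  Scheme.Etale.mk (O.ι ≫ V.hom)

/-- The inclusion of an open subscheme of an étale scheme. -/
noncomputable def etaleOpenHom (V : S.Etale) (O : V.left.Opens) : etaleOpen V O ⟶ V :=
  MorphismProperty.Over.homMk O.ι rfl

end Site

section Hollow

variable (R : Type u) [CommMonoid R] [Subsingleton Rˣ]

theorem eq_one_of_isUnit {R : Type u} [CommMonoid R] [Subsingleton Rˣ] {r : R} (h : IsUnit r) :
    r = 1 := by
  obtain ⟨v, rfl⟩ := h
  rw [Subsingleton.elim v 1, Units.val_one]

open Classical in
/-- The homomorphism which takes `1` to `1` and everything else to `0`. -/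
noncomputable def indHom (B : Type*) [CommRing B] : R →* B where
  toFun r := if r = 1 then 1 else 0
  map_one' := if_pos rfl
  map_mul' a b := by
    -- Multiplicativity rests on R being sharp: a product equals 1 only if both factors do.
    by_cases h : a * b = 1
    · have ha := eq_one_of_isUnit (IsUnit.of_mul_eq_one b h)
      subst ha
      rw [one_mul] at h
      simp [h]
    · have h' : ¬(a = 1 ∧ b = 1) := fun ⟨h1, h2⟩ => h (by rw [h1, h2, one_mul])
      rw [if_neg h]
      by_cases ha : a = 1
      · rw [if_neg fun hb => h' ⟨ha, hb⟩, mul_zero]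
      · rw [if_neg ha, zero_mul]

theorem map_indHom {B C : Type*} [CommRing B] [CommRing C] (f : B →+* C) (r : R) :
    f (indHom R B r) = indHom R C r := by
  by_cases h : r = 1 <;> simp [indHom, h]

theorem isUnit_indHom_iff (B : Type*) [CommRing B] [Nontrivial B] (r : R) :
    IsUnit (indHom R B r) ↔ r = 1 := by
  by_cases h : r = 1 <;> simp [indHom, h]

/-- The function which is `1` where a locally constant function is `1`, and `0` elsewhere. -/
noncomputable def indFun (U : Scheme.{u}) : LocallyConstant U R →* Γ(U, ⊤) :=
  glue.toMonoidHom.comp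
    { toFun := fun F => F.map (indHom R Γ(U, ⊤))
      map_one' := by ext; simp
      map_mul' := fun a b => by ext; simp }

theorem gm_indFun {U : Scheme.{u}} (F : LocallyConstant U R) (y : U) :
    gm y (indFun R U F) = indHom R _ (F y) := by
  refine (gm_glue _ y).trans ?_
  exact map_indHom R (gm y) (F y)

theorem appTop_indFun {U V : Scheme.{u}} (f : U ⟶ V) (F : LocallyConstant V R) :
    f.appTop.hom (indFun R V F) = indFun R U (F.comap f.base.hom) := by
  refine gm_ext fun y => ?_
  rw [gm_appTop, gm_indFun, gm_indFun, map_indHom]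
  rfl

theorem isUnit_indFun_iff {U : Scheme.{u}} (F : LocallyConstant U R) :
    IsUnit (indFun R U F) ↔ F = 1 := by
  rw [isUnit_iff_gm]
  simp only [gm_indFun, isUnit_indHom_iff]
  exact ⟨fun h => LocallyConstant.ext h, fun h y => by rw [h]; rfl⟩

/-- Sections of the hollow log structure with stalks `R × 𝒪ˣ`. -/
abbrev HollowSections (U : Scheme.{u}) : Type u := LocallyConstant U R × (Γ(U, ⊤))ˣ

/-- The restriction maps of the hollow log structure. -/
noncomputable def hollowRes {U V : Scheme.{u}} (f : U ⟶ V) :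
    HollowSections R V →* HollowSections R U :=
  MonoidHom.prodMap (LocallyConstant.comapMonoidHom f.base.hom) (Units.map f.appTop.hom.toMonoidHom)

theorem hollowRes_id (U : Scheme.{u}) : hollowRes R (𝟙 U) = MonoidHom.id _ := by
  ext ⟨F, c⟩ : 1
  refine Prod.ext (LocallyConstant.ext fun _ => rfl) (Units.ext ?_)
  change (Scheme.Hom.appTop (𝟙 U)).hom c = c
  simp

theorem hollowRes_comp {U V W : Scheme.{u}} (f : U ⟶ V) (g : V ⟶ W) :
    hollowRes R (f ≫ g) = (hollowRes R f).comp (hollowRes R g) := by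
  ext ⟨F, c⟩ : 1
  refine Prod.ext (LocallyConstant.ext fun _ => rfl) (Units.ext ?_)
  exact congr($(Scheme.Hom.comp_appTop f g).hom c)

/-- The function of a section of the hollow log structure. -/
noncomputable def hollowFun (U : Scheme.{u}) : HollowSections R U →* Γ(U, ⊤) :=
  ((indFun R U).comp (MonoidHom.fst _ _)) * ((Units.coeHom _).comp (MonoidHom.snd _ _))

theorem hollowFun_apply (U : Scheme.{u}) (m : HollowSections R U) :
    hollowFun R U m = indFun R U m.1 * m.2 := rfl

theorem appTop_hollowFun {U V : Scheme.{u}} (f : U ⟶ V) (m : HollowSections R V) :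
    f.appTop.hom (hollowFun R V m) = hollowFun R U (hollowRes R f m) := by
  rw [hollowFun_apply, hollowFun_apply, map_mul, appTop_indFun]
  rfl

theorem eq_of_hollowFun_eq {U : Scheme.{u}} (m : HollowSections R U) (c : (Γ(U, ⊤))ˣ)
    (h : hollowFun R U m = c) : m = (1, c) := by
  rw [hollowFun_apply] at h
  have h1 : m.1 = 1 := by
    rw [← isUnit_indFun_iff R]
    exact isUnit_of_mul_isUnit_left (h ▸ c.isUnit)
  rw [h1, map_one, one_mul] at h
  exact Prod.ext h1 (Units.ext h)

theorem hollowFun_one_mk {U : Scheme.{u}} (c : (Γ(U, ⊤))ˣ) : hollowFun R U (1, c) = c := by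
  rw [hollowFun_apply, map_one, one_mul]

/-- Constant sections. -/
noncomputable def hollowConst (U : Scheme.{u}) : R →* HollowSections R U where
  toFun r := (LocallyConstant.const _ r, 1)
  map_one' := rfl
  map_mul' _ _ := Prod.ext rfl (one_mul _).symm

theorem hollowRes_const {U V : Scheme.{u}} (f : U ⟶ V) (r : R) :
    hollowRes R f (hollowConst R V r) = hollowConst R U r :=
  Prod.ext rfl (map_one (Units.map f.appTop.hom.toMonoidHom))

theorem fst_eq_one_of_isUnit {U : Scheme.{u}} {m : HollowSections R U} (h : IsUnit m) :
    m.1 = 1 := by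
  ext y
  exact eq_one_of_isUnit ((h.map (MonoidHom.fst _ _)).map
    ((Pi.evalMonoidHom (fun _ => R) y).comp LocallyConstant.coeFnMonoidHom))

theorem eq_hollowConst_mul {U : Scheme.{u}} (m : HollowSections R U) (r : R)
    (h : ∀ y, m.1 y = r) : ∃ ε : (HollowSections R U)ˣ, m = hollowConst R U r * ε := by
  refine ⟨⟨(1, m.2), (1, m.2⁻¹), by simp, by simp⟩, ?_⟩
  refine Prod.ext (LocallyConstant.ext fun y => ?_) (one_mul _).symm
  rw [h]
  exact (mul_one r).symm

theorem hollowConst_cancel {U : Scheme.{u}} (p q : R) (ε δ : (HollowSections R U)ˣ)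
    (h : hollowConst R U p * ε = hollowConst R U q * δ) : (U → p = q) ∧ ε.val = δ.val := by
  have h3 := fst_eq_one_of_isUnit R ε.isUnit
  have h4 := fst_eq_one_of_isUnit R δ.isUnit
  refine ⟨fun v => ?_, Prod.ext (h3.trans h4.symm) ?_⟩
  · have h2 : p * ε.val.1 v = q * δ.val.1 v := congrArg (fun m : HollowSections R U => m.1 v) h
    rw [h3, h4] at h2
    simpa using h2
  · have h2 : 1 * ε.val.2 = 1 * δ.val.2 := congrArg (fun m : HollowSections R U => m.2) h
    rwa [one_mul, one_mul] at h2

variable (S : Scheme.{u})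

/-- The hollow log structure with stalks `R × 𝒪ˣ`. -/
noncomputable def hollowSheaf : S.Etaleᵒᵖ ⥤ CommMonCat.{u} where
  obj U := CommMonCat.of (HollowSections R U.unop.left)
  map f := CommMonCat.ofHom (hollowRes R f.unop.left)
  map_id U := by
    refine CommMonCat.hom_ext ?_
    exact hollowRes_id R _
  map_comp f g := by
    refine CommMonCat.hom_ext ?_
    exact hollowRes_comp R g.unop.left f.unop.left

/-- A section is a continuous map to the discrete space R together with a unit. The unit is glued as
a pair of mutually inverse functions, so the sheaf properties of continuous maps and of functions
suffice. -/
theorem isSheaf_hollowSheaf : Presheaf.IsSheaf S.smallEtaleTopology (hollowSheaf R S) := by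
  refine isSheaf_of_forget _ _ fun V T hT => ?_
  let _ : TopologicalSpace R := ⊥
  have : DiscreteTopology R := ⟨rfl⟩
  intro x hx
  let x1 : Presieve.FamilyOfElements
      ((Scheme.Etale.forget S ⋙ Over.forget S).op ⋙ continuousMapPresheaf R) T.arrows :=
    fun Y f hf => (x f hf).1.toContinuousMap
  have hx1 : x1.Compatible := fun Y₁ Y₂ Z g₁ g₂ f₁ f₂ h₁ h₂ w =>
    congrArg (fun m : HollowSections R Z.left => m.1.toContinuousMap) (hx g₁ g₂ h₁ h₂ w)
  let x2 : Presieve.FamilyOfElements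
      ((Scheme.Etale.forget S ⋙ Over.forget S).op ⋙ (Scheme.Γ ⋙ forget CommRingCat)) T.arrows :=
    fun Y f hf => (x f hf).2.val
  have hx2 : x2.Compatible := fun Y₁ Y₂ Z g₁ g₂ f₁ f₂ h₁ h₂ w =>
    congrArg (fun m : HollowSections R Z.left => m.2.val) (hx g₁ g₂ h₁ h₂ w)
  let x3 : Presieve.FamilyOfElements
      ((Scheme.Etale.forget S ⋙ Over.forget S).op ⋙ (Scheme.Γ ⋙ forget CommRingCat)) T.arrows :=
    fun Y f hf => (x f hf).2⁻¹.val
  have hx3 : x3.Compatible := fun Y₁ Y₂ Z g₁ g₂ f₁ f₂ h₁ h₂ w =>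
    congrArg (fun m : HollowSections R Z.left => m.2⁻¹.val) (hx g₁ g₂ h₁ h₂ w)
  obtain ⟨F, hF, hF'⟩ := isSheaf_continuousMap S R T hT x1 hx1
  obtain ⟨c, hc, hc'⟩ := isSheaf_functions S T hT x2 hx2
  obtain ⟨d, hd, hd'⟩ := isSheaf_functions S T hT x3 hx3
  have hs := (isSheaf_functions S T hT).isSeparatedFor
  change C(V.left, R) at F
  change Γ(V.left, ⊤) at c d
  have hcd : c * d = 1 := by
    refine hs (fun Y f hf => (1 : Γ(Y.left, ⊤))) _ _ (fun Y f hf => ?_) (fun Y f hf => ?_)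
    · exact (map_mul f.left.appTop.hom c d).trans
        ((congrArg₂ (fun a b : Γ(Y.left, ⊤) => a * b) (hc f hf) (hd f hf)).trans
          (Units.mul_inv (x f hf).2))
    · exact map_one f.left.appTop.hom
  let C : (Γ(V.left, ⊤))ˣ := ⟨c, d, hcd, (mul_comm d c).trans hcd⟩
  let F' : LocallyConstant V.left R :=
    ⟨F, (IsLocallyConstant.iff_continuous _).2 F.continuous⟩
  refine ⟨((F', C) : HollowSections R V.left), fun Y f hf => ?_, fun m hm => ?_⟩
  · refine Prod.ext (LocallyConstant.ext fun y => ?_) (Units.ext (hc f hf))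
    exact DFunLike.congr_fun (F := C(Y.left, R)) (hF f hf) y
  · have h1 : (m : HollowSections R V.left).1.toContinuousMap = F :=
      hF' _ fun Y f hf => congrArg (fun n : HollowSections R Y.left => n.1.toContinuousMap) (hm f hf)
    have h2 : (m : HollowSections R V.left).2.val = c :=
      hc' _ fun Y f hf => congrArg (fun n : HollowSections R Y.left => n.2.val) (hm f hf)
    refine Prod.ext (LocallyConstant.ext fun y => ?_) (Units.ext h2)
    exact DFunLike.congr_fun (F := C(V.left, R)) h1 y

/-- The hollow log scheme over `S` with stalks `R × 𝒪ˣ`. -/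
noncomputable def hollow : LogScheme.{u} where
  toScheme := S
  M := hollowSheaf R S
  isSheaf := isSheaf_hollowSheaf R S
  α :=
    { app U := CommMonCat.ofHom (hollowFun R U.unop.left)
      naturality U V f := by
        refine CommMonCat.hom_ext (MonoidHom.ext fun m => ?_)
        exact (appTop_hollowFun R f.unop.left m).symm }
  existsUnique_of_isUnit U s hs := by
    obtain ⟨c, rfl⟩ : ∃ c : (Γ(U.left, ⊤))ˣ, c.val = s := hs
    exact ⟨((1, c) : HollowSections R U.left), hollowFun_one_mk R c,
      fun m hm => eq_of_hollowFun_eq R m c hm⟩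

variable {R} in
-- The constant sections form a global chart: on an open set where the R-component is constant, a
-- section is a constant section times a unit.
theorem isFs_hollow (hR : IsFsMonoid R) : LogScheme.isFs (hollow R S) := by
  intro x
  let U : S.Etale := Scheme.Etale.mk (𝟙 S)
  refine ⟨U, x, rfl, R, inferInstance, hollowConst R U.left, hR, ?_, ?_⟩
  · intro V g m
    let F : LocallyConstant V.left R := (m : HollowSections R V.left).1
    let T : Sieve V :=
      { arrows := fun Y h => ∃ r : R, ∀ y : Y.left, F (h.left y) = r
        downward_closed := by
          rintro Y Z h ⟨r, hr⟩ k
          exact ⟨r, fun z => hr (k.left z)⟩ }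
    refine ⟨T, mem_smallEtaleTopology_of_forall T fun v => ?_, fun W h hW => ?_⟩
    · let O : V.left.Opens := ⟨F ⁻¹' {F v}, F.isLocallyConstant _⟩
      exact ⟨etaleOpen V O, etaleOpenHom V O, ⟨v, rfl⟩, ⟨F v, fun y => y.2⟩, rfl⟩
    · obtain ⟨r, hr⟩ := hW
      obtain ⟨ε, hε⟩ := eq_hollowConst_mul R (hollowRes R h.left m) r hr
      exact ⟨r, ε, hε.trans (congrArg (· * ε.val) (hollowRes_const R (h ≫ g).left r).symm)⟩
  · intro V g p q ε δ heq
    obtain ⟨h1, h2⟩ := hollowConst_cancel R (U := V.left) p q ε δ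
      ((congrArg (· * ε.val) (hollowRes_const R g.left p).symm).trans
        (heq.trans (congrArg (· * δ.val) (hollowRes_const R g.left q))))
    -- If V is non-empty, then p = q and this sieve is everything. If V is empty, p and q may
    -- differ, and the resulting empty sieve still covers V.
    let T : Sieve V :=
      { arrows := fun Y h => p = q
        downward_closed := fun h _ => h }
    refine ⟨T, mem_smallEtaleTopology_of_forall T fun v => ⟨V, 𝟙 V, v, h1 v, rfl⟩, fun W h hW => ?_⟩
    obtain rfl : p = q := hW
    have h3 : IsUnit (hollowRes R (h ≫ g).left (hollowConst R U.left 1)) := by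
      rw [map_one, map_one]
      exact isUnit_one
    exact ⟨1, 1, h3, h3, rfl, congrArg (fun m => hollowRes R (h ≫ g).left (hollowConst R U.left 1) *
      hollowRes R h.left m) h2⟩

end Hollow

/-! ### Stalks of log schemes -/

section Stalks

variable {Ω : Type u} [Field Ω] [IsSepClosed Ω] (X : LogScheme.{u})

/-- Restriction of sections of the log structure. -/
noncomputable abbrev resM {X : LogScheme.{u}} {U V : X.toScheme.Etale} (c : V ⟶ U) :
    X.M.obj (op U) →* X.M.obj (op V) :=
  (X.M.map c.op).hom

/-- The function of a section of the log structure. -/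
noncomputable def funM (X : LogScheme.{u}) (U : X.toScheme.Etale) :
    X.M.obj (op U) →* Γ(U.left, ⊤) :=
  (X.α.app (op U)).hom

theorem funM_resM {U V : X.toScheme.Etale} (c : V ⟶ U) (m : X.M.obj (op U)) :
    funM X V (resM c m) = c.left.appTop.hom (funM X U m) :=
  congr($(X.α.naturality c.op).hom m)

theorem resM_resM {U V W : X.toScheme.Etale} (c : V ⟶ U) (d : W ⟶ V) (m : X.M.obj (op U)) :
    resM d (resM c m) = resM (d ≫ c) m :=
  congr($((X.M.map_comp c.op d.op).symm).hom m)

theorem resM_id {U : X.toScheme.Etale} (m : X.M.obj (op U)) : resM (𝟙 U) m = m :=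
  congr($(X.M.map_id (op U)).hom m)

theorem exists_funM_eq {U : X.toScheme.Etale} (c : (Γ(U.left, ⊤))ˣ) :
    ∃ m : (X.M.obj (op U))ˣ, funM X U m = c := by
  obtain ⟨m, hm, -⟩ := X.existsUnique_of_isUnit U c.val c.isUnit
  obtain ⟨n, hn, -⟩ := X.existsUnique_of_isUnit U c⁻¹.val c⁻¹.isUnit
  obtain ⟨e, he, he'⟩ := X.existsUnique_of_isUnit U (1 : Γ(U.left, ⊤)) isUnit_one
  change funM X U m = c at hm
  change funM X U n = c⁻¹.val at hn
  have h1 : m * n = e := he' _ (by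
    change funM X U (m * n) = 1
    rw [map_mul, hm, hn, Units.mul_inv])
  have h2 : 1 = e := he' _ (by
    change funM X U 1 = 1
    rw [map_one])
  have h3 : m * n = 1 := h1.trans h2.symm
  exact ⟨⟨m, n, h3, (mul_comm n m).trans h3⟩, hm⟩

theorem isUnit_iff_funM {U : X.toScheme.Etale} (m : X.M.obj (op U)) :
    IsUnit m ↔ IsUnit (funM X U m) := by
  refine ⟨fun h => h.map _, fun ⟨c, hc⟩ => ?_⟩
  obtain ⟨n, hn⟩ := exists_funM_eq X c
  have : m = n := (X.existsUnique_of_isUnit U c.val c.isUnit).unique hc.symm hn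
  rw [this]
  exact n.isUnit

/-- The index category of a stalk has a filtered final model, so stalks of monoids may be computed
on underlying sets. -/
theorem preservesColimitsOfShape_elements {C : Type*} [Category C] [LocallySmall.{u} C]
    {J : GrothendieckTopology C} (Φ : GrothendieckTopology.Point.{u} J) :
    PreservesColimitsOfShape Φ.fiber.Elementsᵒᵖ (forget CommMonCat.{u}) :=
  Functor.Final.preservesColimitsOfShape_of_final (FinallySmall.fromFilteredFinalModel.{u} _) _

variable (x : Spec (.of Ω) ⟶ X.toScheme)

theorem exists_germ (n : X.stalk x) : ∃ (U : X.toScheme.Etale) (y : Spec (.of Ω) ⟶ U.left)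
    (h : y ≫ U.hom = x) (m : X.M.obj (op U)), (X.germ x U y h).hom m = n := by
  have := preservesColimitsOfShape_elements (Scheme.pointSmallEtale x)
  obtain ⟨⟨U, y⟩, m, hm⟩ := Types.jointly_surjective_of_isColimit
    (isColimitOfPreserves (forget CommMonCat)
      (colimit.isColimit ((CategoryOfElements.π (Scheme.pointSmallEtale x).fiber).op ⋙ X.M))) n
  exact ⟨U, y.left, Over.w y, m, hm⟩

theorem germ_resM {U V : X.toScheme.Etale} (c : V ⟶ U) (y : Spec (.of Ω) ⟶ U.left)
    (h : y ≫ U.hom = x) (z : Spec (.of Ω) ⟶ V.left) (h' : z ≫ V.hom = x) (hz : z ≫ c.left = y)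
    (m : X.M.obj (op U)) : (X.germ x V z h').hom (resM c m) = (X.germ x U y h).hom m :=
  congr($(X.germ_w x c y h z h' hz).hom m)

theorem exists_of_germ_eq (U : X.toScheme.Etale) (y : Spec (.of Ω) ⟶ U.left)
    (h : y ≫ U.hom = x) (m m' : X.M.obj (op U))
    (hm : (X.germ x U y h).hom m = (X.germ x U y h).hom m') :
    ∃ (V : X.toScheme.Etale) (c : V ⟶ U) (z : Spec (.of Ω) ⟶ V.left) (_ : z ≫ V.hom = x),
      z ≫ c.left = y ∧ resM c m = resM c m' := by
  have := preservesColimitsOfShape_elements (Scheme.pointSmallEtale x)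
  obtain ⟨⟨V, z⟩, ⟨c, hz⟩, h'⟩ :=
    ((colimit.isColimit ((CategoryOfElements.π (Scheme.pointSmallEtale x).fiber).op ⋙ X.M)).eq_iff'
      (i := op ⟨U, Over.homMk y h⟩) m m').1 hm
  exact ⟨V, c, z.left, Over.w z, congrArg CommaMorphism.left hz, h'⟩

theorem exists_of_mem_topology {U : X.toScheme.Etale} (T : Sieve U)
    (hT : T ∈ X.toScheme.smallEtaleTopology U) (y : Spec (.of Ω) ⟶ U.left) (h : y ≫ U.hom = x) :
    ∃ (V : X.toScheme.Etale) (c : V ⟶ U) (z : Spec (.of Ω) ⟶ V.left) (_ : z ≫ V.hom = x),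
      z ≫ c.left = y ∧ T c := by
  obtain ⟨V, c, hc, z, hz⟩ := (Scheme.pointSmallEtale x).jointly_surjective T hT (Over.homMk y h)
  exact ⟨V, c, z.left, Over.w z, congrArg CommaMorphism.left hz, hc⟩

variable {X x} in
/-- A homomorphism from a stalk, given by a compatible family. -/
noncomputable def stalkLift {N : Type u} [CommMonoid N]
    (φ : ∀ (U : X.toScheme.Etale) (y : Spec (.of Ω) ⟶ U.left) (_ : y ≫ U.hom = x),
      X.M.obj (op U) →* N)
    (hφ : ∀ {U V : X.toScheme.Etale} (c : V ⟶ U) (y : Spec (.of Ω) ⟶ U.left)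
      (h : y ≫ U.hom = x) (z : Spec (.of Ω) ⟶ V.left) (h' : z ≫ V.hom = x) (_ : z ≫ c.left = y)
      (m : X.M.obj (op U)), φ V z h' (resM c m) = φ U y h m) : X.stalk x →* N :=
  (colimit.desc ((CategoryOfElements.π (Scheme.pointSmallEtale x).fiber).op ⋙ X.M)
    { pt := CommMonCat.of N
      ι :=
        { app j := CommMonCat.ofHom (φ j.unop.1 j.unop.2.left (Over.w j.unop.2))
          naturality i j f := by
            refine CommMonCat.hom_ext (MonoidHom.ext fun m => ?_)
            exact hφ f.unop.1 i.unop.2.left (Over.w i.unop.2) j.unop.2.left (Over.w j.unop.2)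
              (congrArg CommaMorphism.left f.unop.2) m } }).hom

variable {X x} in
theorem stalkLift_germ {N : Type u} [CommMonoid N]
    (φ : ∀ (U : X.toScheme.Etale) (y : Spec (.of Ω) ⟶ U.left) (_ : y ≫ U.hom = x),
      X.M.obj (op U) →* N)
    (hφ : ∀ {U V : X.toScheme.Etale} (c : V ⟶ U) (y : Spec (.of Ω) ⟶ U.left)
      (h : y ≫ U.hom = x) (z : Spec (.of Ω) ⟶ V.left) (h' : z ≫ V.hom = x) (_ : z ≫ c.left = y)
      (m : X.M.obj (op U)), φ V z h' (resM c m) = φ U y h m)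
    (U : X.toScheme.Etale) (y : Spec (.of Ω) ⟶ U.left) (h : y ≫ U.hom = x) (m : X.M.obj (op U)) :
    stalkLift φ hφ ((X.germ x U y h).hom m) = φ U y h m := by
  have := colimit.ι_desc (F := (CategoryOfElements.π (Scheme.pointSmallEtale x).fiber).op ⋙ X.M)
    { pt := CommMonCat.of N
      ι :=
        { app j := CommMonCat.ofHom (φ j.unop.1 j.unop.2.left (Over.w j.unop.2))
          naturality i j f := by
            refine CommMonCat.hom_ext (MonoidHom.ext fun m => ?_)
            exact hφ f.unop.1 i.unop.2.left (Over.w i.unop.2) j.unop.2.left (Over.w j.unop.2)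
              (congrArg CommaMorphism.left f.unop.2) m } } (op ⟨U, Over.homMk y h⟩)
  exact congr($(this).hom m)

theorem evStalk_aux {U V : X.toScheme.Etale} (c : V ⟶ U) (y : Spec (.of Ω) ⟶ U.left)
    (_ : y ≫ U.hom = x) (z : Spec (.of Ω) ⟶ V.left) (_ : z ≫ V.hom = x) (hz : z ≫ c.left = y)
    (m : X.M.obj (op U)) : ((z.appTop.hom : Γ(V.left, ⊤) →* Γ(Spec (.of Ω), ⊤)).comp (funM X V))
        (resM c m) = ((y.appTop.hom : Γ(U.left, ⊤) →* Γ(Spec (.of Ω), ⊤)).comp (funM X U)) m := by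
  subst hz
  exact (congrArg z.appTop.hom (funM_resM X c m)).trans
    congr($((Scheme.Hom.comp_appTop z c.left).symm).hom _)

/-- Evaluation of sections at a geometric point. -/
noncomputable def evStalk : X.stalk x →* Γ(Spec (.of Ω), ⊤) :=
  stalkLift (fun U y _ => (y.appTop.hom : Γ(U.left, ⊤) →* Γ(Spec (.of Ω), ⊤)).comp (funM X U))
    (evStalk_aux X x)

theorem evStalk_germ (U : X.toScheme.Etale) (y : Spec (.of Ω) ⟶ U.left) (h : y ≫ U.hom = x)
    (m : X.M.obj (op U)) : evStalk X x ((X.germ x U y h).hom m) = y.appTop.hom (funM X U m) :=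
  stalkLift_germ _ (evStalk_aux X x) U y h m

theorem isUnit_appTop_iff {T U : Scheme.{u}} (f : T ⟶ U) (a : Γ(U, ⊤)) :
    IsUnit (f.appTop.hom a) ↔ ∀ t, f t ∈ U.basicOpen a := by
  rw [isUnit_iff_gm]
  refine forall_congr' fun t => ?_
  rw [Scheme.mem_basicOpen_top, gm_appTop]
  exact isUnit_map_iff (f.stalkMap t).hom _

theorem exists_lift_opens {T U : Scheme.{u}} (y : T ⟶ U) (O : U.Opens) (h : ∀ t, y t ∈ O) :
    ∃ z : T ⟶ O, z ≫ O.ι = y :=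
  ⟨IsOpenImmersion.lift O.ι y (by
    rintro _ ⟨t, rfl⟩
    rw [Scheme.Opens.range_ι]
    exact h t), IsOpenImmersion.lift_fac _ _ _⟩

theorem isUnit_resM_etaleOpenHom (U : X.toScheme.Etale) (m : X.M.obj (op U)) :
    IsUnit (resM (etaleOpenHom U (U.left.basicOpen (funM X U m))) m) := by
  rw [isUnit_iff_funM, funM_resM]
  exact (isUnit_appTop_iff (U.left.basicOpen (funM X U m)).ι (funM X U m)).2 fun t => t.2

theorem exists_isUnit_of_isUnit (U : X.toScheme.Etale) (y : Spec (.of Ω) ⟶ U.left)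
    (h : y ≫ U.hom = x) (m : X.M.obj (op U)) (hm : IsUnit (y.appTop.hom (funM X U m))) :
    ∃ (V : X.toScheme.Etale) (c : V ⟶ U) (z : Spec (.of Ω) ⟶ V.left) (_ : z ≫ V.hom = x),
      z ≫ c.left = y ∧ IsUnit (resM c m) := by
  rw [isUnit_appTop_iff] at hm
  obtain ⟨z, hz⟩ := exists_lift_opens y _ hm
  refine ⟨etaleOpen U _, etaleOpenHom U _, z, ?_, hz, isUnit_resM_etaleOpenHom X U m⟩
  exact (Category.assoc _ _ _).symm.trans ((congrArg (· ≫ U.hom) hz).trans h)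

/-- If the value at the geometric point is invertible, the function of a representing section is
invertible on a smaller neighbourhood, and a section of M with invertible function is invertible. -/
theorem isUnit_stalk_iff (n : X.stalk x) : IsUnit n ↔ IsUnit (evStalk X x n) := by
  refine ⟨fun h => h.map _, fun h => ?_⟩
  obtain ⟨U, y, hy, m, rfl⟩ := exists_germ X x n
  rw [evStalk_germ] at h
  obtain ⟨V, c, z, hz, hzc, hu⟩ := exists_isUnit_of_isUnit X x U y hy m h
  rw [← germ_resM X x c y hy z hz hzc]
  exact hu.map _

/-- `stalkMap` is defined through base-changed neighbourhoods; naturality extends the formula to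
every compatible pair of neighbourhoods. -/
theorem stalkMap_germ {Y : LogScheme.{u}} (f : X ⟶ Y) (y : Spec (.of Ω) ⟶ Y.toScheme)
    (h : x ≫ f.base = y) {U : X.toScheme.Etale} {V : Y.toScheme.Etale} (v : U.left ⟶ V.left)
    (hv : v ≫ V.hom = U.hom ≫ f.base) (p : Spec (.of Ω) ⟶ U.left) (hp : p ≫ U.hom = x)
    (q : Spec (.of Ω) ⟶ V.left) (hq : q ≫ V.hom = y) (hpq : p ≫ v = q) (m : Y.M.obj (op V)) :
    (LogScheme.stalkMap f x y h).hom ((Y.germ y V q hq).hom m) =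
      (X.germ x U p hp).hom ((f.app v hv).hom m) := by
  subst h hp
  have h1 := colimit.ι_desc
    (F := (CategoryOfElements.π (Scheme.pointSmallEtale ((p ≫ U.hom) ≫ f.base)).fiber).op ⋙ Y.M)
    { pt := X.stalk (p ≫ U.hom)
      ι :=
        { app j := f.app (LogScheme.basechangeFst f.base j.unop.1)
              (LogScheme.basechangeFst_comp f.base j.unop.1) ≫
            X.germ (p ≫ U.hom) (LogScheme.basechange f.base j.unop.1)
              (LogScheme.basechangeLift f.base j.unop.1 j.unop.2.left (p ≫ U.hom)
                ((Over.w j.unop.2))) (LogScheme.basechangeLift_hom _ _ _ _ _)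
          naturality _ _ φ :=
            (LogScheme.stalkMap_aux f (p ≫ U.hom) φ.unop.1 _ _ _ _
              (congrArg CommaMorphism.left φ.unop.2)).trans (Category.comp_id _).symm } }
    (op ⟨V, Over.homMk q hq⟩)
  have h2 := congr($(h1).hom m)
  refine h2.trans ?_
  let c : U ⟶ LogScheme.basechange f.base V := MorphismProperty.Over.homMk
    (LogScheme.basechangeLift f.base V v U.hom hv) (LogScheme.basechangeLift_hom _ _ _ _ _)
  have hc : c.left ≫ LogScheme.basechangeFst f.base V = v := LogScheme.basechangeLift_fst _ _ _ _ _
  have h3 := f.naturality c (𝟙 V) (LogScheme.basechangeFst f.base V)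
    (LogScheme.basechangeFst_comp _ V) v hv ((congrArg (c.left ≫ ·) (Category.comp_id _)).trans hc)
  have i2 : Y.M.map (𝟙 V).op = 𝟙 _ := Y.M.map_id _
  rw [i2, Category.id_comp] at h3
  rw [← h3]
  refine (germ_resM X (p ≫ U.hom) c _ _ p rfl ?_ _).symm
  apply pullback.hom_ext
  · refine (Category.assoc _ _ _).trans ((congrArg (p ≫ ·) hc).trans (hpq.trans ?_))
    exact (LogScheme.basechangeLift_fst _ _ _ _ _).symm
  · refine (Category.assoc _ _ _).trans ((congrArg (p ≫ ·)
      (LogScheme.basechangeLift_hom _ _ _ _ _)).trans ?_)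
    exact (LogScheme.basechangeLift_hom _ _ _ _ _).symm

end Stalks

/-! ### Stalks of fs log schemes -/

section FsStalk

/-- The properties of the stalks of an fs log structure. -/
structure IsFsStalk (M : Type*) [CommMonoid M] : Prop where
  cancel : ∀ a b c : M, a * c = b * c → a = b
  exists_mul : ∀ (n : ℕ) (a b c : M), 0 < n → a ^ n = b ^ n * c → ∃ d, a = b * d
  fg : AddMonoid.FG (Additive (Associates M))

open Algebra

theorem IsFsMonoid.cancel {P : Type*} [CommMonoid P] (hP : IsFsMonoid P) (a b c : P)
    (h : a * c = b * c) : a = b := by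
  apply hP.integral
  have h1 := congrArg (GrothendieckGroup.of : P →* _) h
  rw [map_mul, map_mul] at h1
  exact mul_right_cancel h1

/-- This is saturation applied to a/b, phrased as divisibility inside the monoid so that it passes
from a chart to the stalk. -/
theorem IsFsMonoid.exists_mul {P : Type*} [CommMonoid P] (hP : IsFsMonoid P) (n : ℕ) (a b c : P)
    (hn : 0 < n) (h : a ^ n = b ^ n * c) : ∃ d, a = b * d := by
  obtain ⟨d, hd⟩ := hP.saturated (GrothendieckGroup.of a / GrothendieckGroup.of b) n hn
    ⟨c, by rw [div_pow, ← map_pow, ← map_pow, h, map_mul, mul_div_cancel_left]⟩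
  refine ⟨d, hP.integral ?_⟩
  rw [map_mul, hd, mul_div_cancel]

/-- A monoid with a homomorphism from an fs monoid satisfying the conditions on charts. -/
theorem isFsStalk_of_chart {M P : Type*} [CommMonoid M] [CommMonoid P] (hP : IsFsMonoid P)
    (β : P →* M) (hs : ∀ m, ∃ (p : P) (ε : Mˣ), m = β p * ε)
    (hi : ∀ (p q : P) (ε δ : Mˣ), β p * ε = β q * δ → ∃ a b : P, IsUnit (β a) ∧ IsUnit (β b) ∧
      p * a = q * b ∧ β b * ε = β a * δ) : IsFsStalk M where
  cancel m m' l h := by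
    obtain ⟨p, ε, rfl⟩ := hs m
    obtain ⟨q, δ, rfl⟩ := hs m'
    obtain ⟨r, η, rfl⟩ := hs l
    obtain ⟨a, b, ha, hb, hab, hε⟩ := hi (p * r) (q * r) ε δ (by
      have h1 : (β p * β r * ε) * η = (β q * β r * δ) * η := by
        calc _ = β p * ε * (β r * η) := by ac_rfl
          _ = β q * δ * (β r * η) := h
          _ = _ := by ac_rfl
      rw [map_mul, map_mul]
      exact η.isUnit.mul_left_injective h1)
    have hab' : p * a = q * b := hP.cancel _ _ r (by
      calc _ = p * r * a := by ac_rfl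
        _ = q * r * b := hab
        _ = _ := by ac_rfl)
    refine (ha.mul hb).mul_left_injective ?_
    calc β p * ε * (β a * β b) = β (p * a) * (β b * ε) := by rw [map_mul]; ac_rfl
      _ = β (q * b) * (β a * δ) := by rw [hab', hε]
      _ = β q * δ * (β a * β b) := by
        rw [map_mul, mul_mul_mul_comm, mul_comm (β b), mul_mul_mul_comm]
  exists_mul n m m' l hn h := by
    obtain ⟨p, ε, rfl⟩ := hs m
    obtain ⟨q, δ, rfl⟩ := hs m'
    obtain ⟨r, η, rfl⟩ := hs l
    obtain ⟨a, b, ⟨a', ha⟩, hb, hab, -⟩ := hi (p ^ n) (q ^ n * r) (ε ^ n) (δ ^ n * η) (by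
      rw [map_pow, map_mul, map_pow, Units.val_pow_eq_pow_val, Units.val_mul,
        Units.val_pow_eq_pow_val, ← mul_pow, h, mul_pow]
      ac_rfl)
    -- The relation pⁿa = qⁿrb is multiplied by aⁿ⁻¹, which makes the left side the n-th power of
    -- pa.
    obtain ⟨d, hd⟩ := hP.exists_mul n (p * a) q (r * b * a ^ (n - 1)) hn (by
      obtain ⟨k, rfl⟩ : ∃ k, n = k + 1 := ⟨n - 1, by omega⟩
      rw [mul_pow, pow_succ a, Nat.add_sub_cancel]
      calc _ = p ^ (k + 1) * a * a ^ k := by ac_rfl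
        _ = _ := by rw [hab]; ac_rfl)
    refine ⟨β d * (δ⁻¹ * ε * a'⁻¹ : Mˣ), ?_⟩
    refine a'.isUnit.mul_left_injective ?_
    simp only [Units.val_mul]
    calc β p * ε * a' = β (p * a) * ε := by rw [map_mul, ha]; ac_rfl
      _ = β q * β d * ε := by rw [hd, map_mul]
      _ = (β q * β d * ε) * (δ * ↑δ⁻¹) * (↑a'⁻¹ * a') := by simp
      _ = _ := by ac_rfl
  fg := by
    have : Monoid.FG P := hP.fg
    have h1 : Monoid.FG (Associates M) := Monoid.fg_of_surjective
      ((Associates.mkMonoidHom : M →* Associates M).comp β) fun m => by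
        obtain ⟨m, rfl⟩ := Associates.mk_surjective m
        obtain ⟨p, ε, rfl⟩ := hs m
        exact ⟨p, Associates.mk_eq_mk_iff_associated.2 ⟨ε, rfl⟩⟩
    exact Monoid.fg_iff_add_fg.1 h1

variable {M : Type*} [CommMonoid M] (hM : IsFsStalk M)
include hM

theorem IsFsStalk.associates_cancel (a b c : Associates M) (h : a * c = b * c) : a = b := by
  obtain ⟨a, rfl⟩ := Associates.mk_surjective a
  obtain ⟨b, rfl⟩ := Associates.mk_surjective b
  obtain ⟨c, rfl⟩ := Associates.mk_surjective c
  rw [Associates.mk_mul_mk, Associates.mk_mul_mk, Associates.mk_eq_mk_iff_associated] at h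
  obtain ⟨v, hv⟩ := h
  exact Associates.mk_eq_mk_iff_associated.2 ⟨v, hM.cancel _ _ c (by rw [← hv]; ac_rfl)⟩

theorem IsFsStalk.of_injective :
    Function.Injective (GrothendieckGroup.of : M →* GrothendieckGroup M) := by
  have : IsCancelMul M :=
    { mul_left_cancel := fun a b c h => hM.cancel b c a (by
        rw [mul_comm b, mul_comm c]; exact h)
      mul_right_cancel := fun a b c h => hM.cancel b c a h }
  exact GrothendieckGroup.of_injective

theorem IsFsStalk.ghost_of_injective :
    Function.Injective (GrothendieckAddGroup.of : Additive (Associates M) →+ _) := by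
  have : IsCancelAdd (Additive (Associates M)) :=
    { add_left_cancel := fun a b c h => hM.associates_cancel b c a
        ((mul_comm (G := Associates M) b a).trans (h.trans (mul_comm (G := Associates M) a c)))
      add_right_cancel := fun a b c h => hM.associates_cancel b c a h }
  exact GrothendieckAddGroup.of_injective

omit hM in
theorem ghost_sharp (a b : Additive (Associates M)) (h : a + b = 0) : a = 0 := by
  have h1 : Additive.toMul a * Additive.toMul b = 1 := h
  exact (Associates.isUnit_iff_eq_one _).1 (IsUnit.of_mul_eq_one _ h1)

theorem IsFsStalk.finite_gp :
    Module.Finite ℤ (GrothendieckAddGroup (Additive (Associates M))) := by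
  have := hM.fg
  have h1 : AddGroup.FG (GrothendieckAddGroup (Additive (Associates M))) :=
    AddGroup.fg_iff_addMonoid_fg.2 inferInstance
  exact Module.Finite.iff_addGroup_fg.2 h1

theorem IsFsStalk.ghost_nsmul_injective (n : ℕ) (hn : 0 < n) (a b : Associates M)
    (h : a ^ n = b ^ n) : a = b := by
  obtain ⟨a, rfl⟩ := Associates.mk_surjective a
  obtain ⟨b, rfl⟩ := Associates.mk_surjective b
  rw [← Associates.mk_pow, ← Associates.mk_pow, Associates.mk_eq_mk_iff_associated] at h
  obtain ⟨v, hv⟩ := h.symm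
  obtain ⟨d, rfl⟩ := hM.exists_mul n a b v hn hv.symm
  have h1 : d ^ n = v := hM.cancel _ _ (b ^ n) (by
    rw [mul_comm, ← mul_pow, ← hv, mul_comm])
  have h2 : IsUnit d := (isUnit_pow_iff hn.ne').1 (h1 ▸ v.isUnit)
  exact (Associates.mk_eq_mk_iff_associated.2 ⟨h2.unit, rfl⟩).symm

/-- If the difference of the classes of a and b is torsion, then n•a = n•b in the ghost monoid, and
saturation together with cancellation gives a = b. A finitely generated torsion-free group is free.
-/
theorem IsFsStalk.free_gp : Module.Free ℤ (GrothendieckAddGroup (Additive (Associates M))) := by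
  have := hM.finite_gp
  have : Module.IsTorsionFree ℤ (GrothendieckAddGroup (Additive (Associates M))) := by
    rw [Module.isTorsionFree_int_iff_isAddTorsionFree]
    refine ⟨fun n hn x y hxy => ?_⟩
    obtain ⟨a, b, hab⟩ := exists_add_of_eq_of (x - y)
    have h1 : n • (x - y) = 0 := by
      rw [nsmul_sub]
      exact sub_eq_zero.2 hxy
    have h2 : n • GrothendieckAddGroup.of b = n • GrothendieckAddGroup.of a := by
      rw [← hab, nsmul_add, h1, zero_add]
    rw [← map_nsmul, ← map_nsmul] at h2
    have h3 : b = a := hM.ghost_nsmul_injective n (Nat.pos_of_ne_zero hn) _ _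
      (hM.ghost_of_injective h2)
    rw [h3] at hab
    exact sub_eq_zero.1 (by simpa using hab)
  infer_instance

end FsStalk

section

variable {Ω : Type u} [Field Ω] [IsSepClosed Ω] {X : LogScheme.{u}}

theorem exists_germ_over (x : Spec (.of Ω) ⟶ X.toScheme) (U : X.toScheme.Etale)
    (y : Spec (.of Ω) ⟶ U.left) (hy : y ≫ U.hom = x) (n : X.stalk x) :
    ∃ (V : X.toScheme.Etale) (c : V ⟶ U) (z : Spec (.of Ω) ⟶ V.left) (h : z ≫ V.hom = x),
      z ≫ c.left = y ∧ ∃ m : X.M.obj (op V), (X.germ x V z h).hom m = n := by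
  obtain ⟨U', y', hy', m, rfl⟩ := exists_germ X x n
  have : Etale U.hom := U.prop
  have : Etale U'.hom := U'.prop
  let V : X.toScheme.Etale := Scheme.Etale.mk (pullback.fst U.hom U'.hom ≫ U.hom)
  let c : V ⟶ U := MorphismProperty.Over.homMk (pullback.fst U.hom U'.hom) rfl
  let c' : V ⟶ U' := MorphismProperty.Over.homMk (pullback.snd U.hom U'.hom)
    pullback.condition.symm
  let z : Spec (.of Ω) ⟶ V.left := pullback.lift y y' (hy.trans hy'.symm)
  have hc : z ≫ c.left = y := pullback.lift_fst _ _ _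
  have hc' : z ≫ c'.left = y' := pullback.lift_snd _ _ _
  have hz : z ≫ V.hom = x := by
    refine Eq.trans ?_ hy
    rw [← hc]
    exact (Category.assoc _ _ _).symm
  exact ⟨V, c, z, hz, hc, resM c' m, germ_resM X x c' y' hy' z hz hc' m⟩

theorem exists_unit_germ_over (x : Spec (.of Ω) ⟶ X.toScheme) (U : X.toScheme.Etale)
    (y : Spec (.of Ω) ⟶ U.left) (hy : y ≫ U.hom = x) (n : (X.stalk x)ˣ) :
    ∃ (V : X.toScheme.Etale) (c : V ⟶ U) (z : Spec (.of Ω) ⟶ V.left) (h : z ≫ V.hom = x),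
      z ≫ c.left = y ∧ ∃ m : (X.M.obj (op V))ˣ, Units.map (X.germ x V z h).hom m = n := by
  obtain ⟨V, c, z, hz, hc, m, hm⟩ := exists_germ_over x U y hy n
  obtain ⟨W, d, t, ht, hd, hu⟩ := exists_isUnit_of_isUnit X x V z hz m (by
    rw [← evStalk_germ X x V z hz, hm]
    exact n.isUnit.map _)
  refine ⟨W, d ≫ c, t, ht, ?_, hu.unit, Units.ext ?_⟩
  · rw [← hc, ← hd]
    exact (Category.assoc _ _ _).symm
  · exact (germ_resM X x d z hz t ht hd m).trans hm

/-- The chart conditions hold on covering sieves, and a geometric point lifts to a member of every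
covering sieve. They therefore hold in the stalk without further localisation, and
`isFsStalk_of_chart` applies. -/
theorem isFsStalk_stalk (hX : X.isFs) (x : Spec (.of Ω) ⟶ X.toScheme) : IsFsStalk (X.stalk x) := by
  obtain ⟨U, y₀, hy₀, P, _, β, hP, hβ⟩ := hX (x default)
  have : Etale U.hom := U.prop
  obtain ⟨y, hy, -⟩ := Scheme.exists_fac_of_etale_of_isSepClosed U.hom x y₀ hy₀
  let βs : P →* X.stalk x := ((X.germ x U y hy).hom).comp β
  have hβs : ∀ {V : X.toScheme.Etale} (c : V ⟶ U) (z : Spec (.of Ω) ⟶ V.left)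
      (h : z ≫ V.hom = x) (_ : z ≫ c.left = y) (p : P),
      βs p = (X.germ x V z h).hom (resM c (β p)) := fun c z h hz p =>
    (germ_resM X x c y hy z h hz (β p)).symm
  refine isFsStalk_of_chart hP βs (fun n => ?_) (fun p q ε δ h => ?_)
  · obtain ⟨V, c, z, hz, hc, m, rfl⟩ := exists_germ_over x U y hy n
    obtain ⟨T, hT, hT'⟩ := hβ.surj V c m
    obtain ⟨W, d, t, ht, hd, hTd⟩ := exists_of_mem_topology X x T hT z hz
    obtain ⟨p, ε, hpε⟩ := hT' W d hTd
    refine ⟨p, Units.map (X.germ x W t ht).hom ε, ?_⟩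
    rw [hβs (d ≫ c) t ht (by
      refine Eq.trans ?_ hc
      rw [← hd]
      exact (Category.assoc _ _ _).symm), ← germ_resM X x d z hz t ht hd]
    exact (congrArg (X.germ x W t ht).hom hpε).trans (map_mul _ _ _)
  · obtain ⟨V, c, z, hz, hc, ε, rfl⟩ := exists_unit_germ_over x U y hy ε
    obtain ⟨V', c', z', hz', hc', δ, rfl⟩ := exists_unit_germ_over x V z hz δ
    have hcc : z' ≫ (c' ≫ c).left = y := by
      refine Eq.trans ?_ hc
      rw [← hc']
      exact (Category.assoc _ _ _).symm
    have h1 : (X.germ x V' z' hz').hom (resM (c' ≫ c) (β p) * resM c' ε) =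
        (X.germ x V' z' hz').hom (resM (c' ≫ c) (β q) * δ) := by
      rw [map_mul, map_mul, ← hβs _ _ _ hcc, ← hβs _ _ _ hcc, germ_resM X x c' z hz z' hz' hc']
      exact h
    obtain ⟨W, d, t, ht, hd, h2⟩ := exists_of_germ_eq X x V' z' hz' _ _ h1
    have hdd : t ≫ (d ≫ c' ≫ c).left = y := by
      refine Eq.trans ?_ hcc
      rw [← hd]
      exact (Category.assoc _ _ _).symm
    obtain ⟨T, hT, hT'⟩ := hβ.inj W (d ≫ c' ≫ c) p q (Units.map (resM (d ≫ c')) ε)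
      (Units.map (resM d) δ) (by
        rw [map_mul, map_mul, resM_resM, resM_resM, resM_resM] at h2
        exact h2)
    obtain ⟨W', e, t', ht', he, hTe⟩ := exists_of_mem_topology X x T hT t ht
    obtain ⟨a, b, ha, hb, hab, h3⟩ := hT' W' e hTe
    have hee : t' ≫ (e ≫ d ≫ c' ≫ c).left = y := by
      refine Eq.trans ?_ hdd
      rw [← he]
      exact (Category.assoc _ _ _).symm
    refine ⟨a, b, ?_, ?_, hab, ?_⟩
    · rw [hβs _ t' ht' hee]
      exact ha.map _
    · rw [hβs _ t' ht' hee]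
      exact hb.map _
    · rw [hβs _ t' ht' hee, hβs _ t' ht' hee]
      have h4 := congrArg (X.germ x W' t' ht').hom h3
      have h5 : (X.germ x W' t' ht').hom (resM e (resM (d ≫ c') ε.val)) =
          (X.germ x V z hz).hom ε := by
        rw [resM_resM]
        refine germ_resM X x _ _ _ _ _ ?_ _
        rw [← hc', ← hd, ← he]
        simp only [Category.assoc]
        rfl
      have h6 : (X.germ x W' t' ht').hom (resM e (resM d δ.val)) =
          (X.germ x V' z' hz').hom δ := by
        rw [resM_resM]
        refine germ_resM X x _ _ _ _ _ ?_ _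
        rw [← hd, ← he]
        exact (Category.assoc _ _ _).symm
      refine (congrArg (_ * ·) h5.symm).trans (Eq.trans ?_ (congrArg (_ * ·) h6))
      exact (map_mul _ _ _).symm.trans (h4.trans (map_mul _ _ _))

end

/-! ### Morphisms from hollow log schemes -/

section HollowHom

/-- The terminal object of the small étale site. -/
noncomputable abbrev topEt (S : Scheme.{u}) : S.Etale := Scheme.Etale.mk (𝟙 S)

theorem comp_app {X Y Z : LogScheme.{u}} (f : X ⟶ Y) (g : Y ⟶ Z)
    {U : X.toScheme.Etale} {V : Y.toScheme.Etale} {W : Z.toScheme.Etale}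
    (u : U.left ⟶ V.left) (hu : u ≫ V.hom = U.hom ≫ f.base)
    (v : V.left ⟶ W.left) (hv : v ≫ W.hom = V.hom ≫ g.base)
    (w : U.left ⟶ W.left) (hw : w ≫ W.hom = U.hom ≫ (f ≫ g).base) (huv : u ≫ v = w) :
    (f ≫ g).app w hw = g.app v hv ≫ f.app u hu :=
  LogScheme.Hom.app_comp_app f g u hu v hv w (hw.trans (Category.assoc _ _ _).symm) huv

variable (R : Type u) [CommMonoid R] [Subsingleton Rˣ] {S : Scheme.{u}} {Y : LogScheme.{u}}

variable {R} in
/-- The pull-back of sections along a morphism from a hollow log scheme. -/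
noncomputable def homSec (φ : hollow R S ⟶ Y) {V : Y.toScheme.Etale} (y : S ⟶ V.left)
    (hy : y ≫ V.hom = φ.base) : Y.M.obj (op V) →* HollowSections R S :=
  (φ.app (U := topEt S) y (hy.trans (Category.id_comp _).symm)).hom

variable {R} in
theorem homSec_resM (φ : hollow R S ⟶ Y) {V V' : Y.toScheme.Etale} (c : V' ⟶ V) (y : S ⟶ V.left)
    (hy : y ≫ V.hom = φ.base) (z : S ⟶ V'.left) (hz : z ≫ V'.hom = φ.base) (h : z ≫ c.left = y)
    (m : Y.M.obj (op V)) : homSec φ z hz (resM c m) = homSec φ y hy m := by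
  have h1 := φ.naturality (U := topEt S) (𝟙 (topEt S)) c z (hz.trans (Category.id_comp _).symm) y
    (hy.trans (Category.id_comp _).symm) ((Category.id_comp _).trans h)
  have i1 : (hollow R S).M.map (𝟙 (topEt S)).op = 𝟙 _ := (hollow R S).M.map_id _
  exact congr($(i1.symm).hom (homSec φ z hz (resM c m))).trans congr($(h1).hom m)

variable {R} in
theorem hollowFun_homSec (φ : hollow R S ⟶ Y) {V : Y.toScheme.Etale} (y : S ⟶ V.left)
    (hy : y ≫ V.hom = φ.base) (m : Y.M.obj (op V)) :
    hollowFun R S (homSec φ y hy m) = y.appTop.hom (funM Y V m) :=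
  congr($(φ.comm (U := topEt S) y (hy.trans (Category.id_comp _).symm)).hom m)

variable {R} in
theorem homSec_comp {Z : LogScheme.{u}} (φ : hollow R S ⟶ Z) (p : Z ⟶ Y)
    {V : Z.toScheme.Etale} {W : Y.toScheme.Etale} (v : V.left ⟶ W.left)
    (hv : v ≫ W.hom = V.hom ≫ p.base) (y : S ⟶ V.left) (hy : y ≫ V.hom = φ.base)
    (w : S ⟶ W.left) (hw : w ≫ W.hom = (φ ≫ p).base) (h : y ≫ v = w) (m : Y.M.obj (op W)) :
    homSec (φ ≫ p) w hw m = homSec φ y hy ((p.app v hv).hom m) :=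
  congr($(comp_app φ p (U := topEt S) y (hy.trans (Category.id_comp _).symm) v hv w
    (hw.trans (Category.id_comp _).symm) h).hom m)

theorem gm_congr {U : Scheme.{u}} (O : U.Opens) (y : U) (hy : y ∈ O) {a b : Γ(U, ⊤)}
    (h : O.ι.appTop.hom a = O.ι.appTop.hom b) : gm y a = gm y b := by
  let z : O.toScheme := ⟨y, hy⟩
  have h1 := congrArg (gm z) h
  rw [gm_appTop, gm_appTop] at h1
  have : IsIso (O.ι.stalkMap z) := inferInstance
  exact (ConcreteCategory.bijective_of_isIso (O.ι.stalkMap z)).1 h1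

theorem gm_appTop_congr {U V : Scheme.{u}} (O : U.Opens) (y : U) (hy : y ∈ O) {f g : U ⟶ V}
    (h : O.ι ≫ f = O.ι ≫ g) (a : Γ(V, ⊤)) : gm y (f.appTop.hom a) = gm y (g.appTop.hom a) := by
  refine gm_congr O y hy ?_
  have h1 := congrArg Scheme.Hom.appTop h
  rw [Scheme.Hom.comp_appTop, Scheme.Hom.comp_appTop] at h1
  exact congr($(h1).hom a)

theorem hollow_ext {U : Scheme.{u}} {m n : HollowSections R U} (h1 : ∀ y, m.1 y = n.1 y)
    (h2 : ∀ y, gm y m.2.val = gm y n.2.val) : m = n :=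
  Prod.ext (LocallyConstant.ext h1) (Units.ext (gm_ext h2))

/-- Gluing locally constant families of sections. -/
noncomputable def hollowGlue (U : Scheme.{u}) :
    LocallyConstant U (HollowSections R U) →* HollowSections R U where
  toFun F :=
    (⟨fun y => (F y).1 y, by
      rw [IsLocallyConstant.iff_eventually_eq]
      intro y
      have h1 := (IsLocallyConstant.iff_eventually_eq _).1 F.isLocallyConstant y
      have h2 := (IsLocallyConstant.iff_eventually_eq _).1 (F y).1.isLocallyConstant y
      filter_upwards [h1, h2] with z hz hz'
      exact (congrArg (fun m : HollowSections R U => m.1 z) hz).trans hz'⟩,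
     ⟨glue (F.map fun m => m.2.val), glue (F.map fun m => m.2⁻¹.val),
      gm_ext fun y => by
        rw [map_mul, gm_glue, gm_glue, ← map_mul]
        exact congrArg _ (Units.mul_inv _),
      gm_ext fun y => by
        rw [map_mul, gm_glue, gm_glue, ← map_mul]
        exact congrArg _ (Units.inv_mul _)⟩)
  map_one' := hollow_ext R (fun y => rfl) fun y => gm_glue _ y
  map_mul' F G := hollow_ext R (fun y => rfl) fun y => by
    refine (gm_glue _ y).trans (Eq.trans ?_ (map_mul (gm y) _ _).symm)
    refine (map_mul (gm y) _ _).trans ?_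
    exact congrArg₂ (· * ·) (gm_glue (F.map fun m : HollowSections R U => m.2.val) y).symm
      (gm_glue (G.map fun m : HollowSections R U => m.2.val) y).symm

theorem hollowGlue_fst {U : Scheme.{u}} (F : LocallyConstant U (HollowSections R U)) (y : U) :
    (hollowGlue R U F).1 y = (F y).1 y := rfl

theorem gm_hollowGlue_snd {U : Scheme.{u}} (F : LocallyConstant U (HollowSections R U)) (y : U) :
    gm y (hollowGlue R U F).2.val = gm y (F y).2.val :=
  gm_glue _ y

theorem gm_hollowFun {U : Scheme.{u}} (m : HollowSections R U) (y : U) :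
    gm y (hollowFun R U m) = indHom R _ (m.1 y) * gm y m.2.val := by
  rw [hollowFun_apply, map_mul, gm_indFun]

theorem gm_hollowFun_hollowGlue {U : Scheme.{u}} (F : LocallyConstant U (HollowSections R U))
    (y : U) : gm y (hollowFun R U (hollowGlue R U F)) = gm y (hollowFun R U (F y)) := by
  rw [gm_hollowFun, gm_hollowFun, gm_hollowGlue_snd, hollowGlue_fst]

theorem hollowRes_hollowGlue {U U' : Scheme.{u}} (f : U' ⟶ U)
    (F : LocallyConstant U (HollowSections R U)) :
    hollowRes R f (hollowGlue R U F) =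
      hollowGlue R U' ((F.comap f.base.hom).map (hollowRes R f)) := by
  refine hollow_ext R (fun y => rfl) fun y => ?_
  refine Eq.trans ?_ (gm_hollowGlue_snd R _ y).symm
  refine (gm_appTop f y _).trans ?_
  exact (congrArg _ (gm_hollowGlue_snd R F (f y))).trans (gm_appTop f y _).symm

/-- A morphism from a hollow log scheme, given by a natural family of locally constant functions. -/
noncomputable def hollowHom (b : S ⟶ Y.toScheme) {N : Type u} [CommMonoid N]
    (g : ∀ {U : S.Etale} {V : Y.toScheme.Etale} (u : U.left ⟶ V.left)
      (_ : u ≫ V.hom = U.hom ≫ b), Y.M.obj (op V) →* LocallyConstant U.left N)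
    (hg : ∀ {U U' : S.Etale} {V V' : Y.toScheme.Etale} (a : U' ⟶ U) (c : V ⟶ V')
      (u : U.left ⟶ V.left) (h : u ≫ V.hom = U.hom ≫ b) (u' : U'.left ⟶ V'.left)
      (h' : u' ≫ V'.hom = U'.hom ≫ b) (_ : a.left ≫ u ≫ c.left = u') (m : Y.M.obj (op V'))
      (y : U'.left), g u h (resM c m) (a.left y) = g u' h' m y)
    (h : N →* HollowSections R S)
    (hh : ∀ {U : S.Etale} {V : Y.toScheme.Etale} (u : U.left ⟶ V.left)
      (hu : u ≫ V.hom = U.hom ≫ b) (m : Y.M.obj (op V)) (y : U.left),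
      gm y (U.hom.appTop.hom (hollowFun R S (h (g u hu m y)))) =
        gm y (u.appTop.hom (funM Y V m))) : hollow R S ⟶ Y :=
  show LogScheme.Hom (hollow R S) Y from
  { base := b
    app := fun {U V} u hu => CommMonCat.ofHom ((hollowGlue R U.left).comp
      ((LocallyConstant.mapMonoidHom ((hollowRes R (U.hom : U.left ⟶ S)).comp h)).comp (g u hu)))
    naturality := fun {U U' V V'} a c u hu u' hu' hac => by
      refine CommMonCat.hom_ext (MonoidHom.ext fun m => ?_)
      refine (hollowRes_hollowGlue R a.left _).trans ?_
      refine congrArg (hollowGlue R U'.left) (LocallyConstant.ext fun y => ?_)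
      change hollowRes R a.left (hollowRes R U.hom (h (g u hu (resM c m) (a.left y)))) =
        hollowRes R U'.hom (h (g u' hu' m y))
      rw [hg a c u hu u' hu' hac m y]
      have h1 : a.left ≫ U.hom = U'.hom := MorphismProperty.Over.w a
      have h2 := hollowRes_comp R a.left (U.hom : U.left ⟶ S)
      rw [h1] at h2
      exact congr($(h2.symm) _)
    comm := fun {U V} u hu => by
      refine CommMonCat.hom_ext (MonoidHom.ext fun m => ?_)
      refine gm_ext fun y => ?_
      refine (gm_hollowFun_hollowGlue R _ y).trans (Eq.trans ?_ (hh u hu m y))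
      exact congrArg (gm y) (appTop_hollowFun R (U.hom : U.left ⟶ S) _).symm }

end HollowHom

/-! ### Functoriality of hollow log schemes in the scheme and in the monoid -/

section HollowMap

variable {R R' : Type u} [CommMonoid R] [Subsingleton Rˣ] [CommMonoid R'] [Subsingleton R'ˣ]

/-- Pull-back of sections along a morphism of schemes and a homomorphism of monoids. -/
noncomputable def hollowPush {U V : Scheme.{u}} (f : U ⟶ V) (ρ : R →* R') :
    HollowSections R V →* HollowSections R' U :=
  MonoidHom.prodMap ((LocallyConstant.mapMonoidHom ρ).comp
    (LocallyConstant.comapMonoidHom f.base.hom)) (Units.map f.appTop.hom.toMonoidHom)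

theorem hollowFun_hollowPush {U V : Scheme.{u}} (f : U ⟶ V) (ρ : R →* R')
    (hρ : ∀ r, ρ r = 1 → r = 1) (m : HollowSections R V) :
    hollowFun R' U (hollowPush f ρ m) = f.appTop.hom (hollowFun R V m) := by
  refine gm_ext fun y => ?_
  rw [gm_hollowFun, appTop_hollowFun, gm_hollowFun]
  have h : ∀ (B : Type u) [CommRing B] (r : R), indHom R' B (ρ r) = indHom R B r := fun B _ r => by
    by_cases hr : r = 1
    · rw [hr, map_one, map_one, map_one]
    · have hr' : ρ r ≠ 1 := fun h => hr (hρ r h)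
      simp [indHom, hr, hr']
  exact congrArg (· * _) (h _ _)

theorem hollowPush_hollowRes {U U' V V' : Scheme.{u}} (ρ : R →* R') (a : U' ⟶ U) (u : U ⟶ V)
    (c : V ⟶ V') (u' : U' ⟶ V') (h : a ≫ u ≫ c = u') (m : HollowSections R V') :
    hollowRes R' a (hollowPush u ρ (hollowRes R c m)) = hollowPush u' ρ m := by
  subst h
  refine Prod.ext (LocallyConstant.ext fun _ => rfl) (Units.ext ?_)
  change a.appTop.hom (u.appTop.hom (c.appTop.hom m.2.val)) = (a ≫ u ≫ c).appTop.hom m.2.val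
  simp only [Scheme.Hom.comp_appTop]
  rfl

/-- The morphism of hollow log schemes given by a morphism of schemes and a local homomorphism. -/
noncomputable def hollowMap {S S' : Scheme.{u}} (f : S' ⟶ S) (ρ : R →* R')
    (hρ : ∀ r, ρ r = 1 → r = 1) : hollow R' S' ⟶ hollow R S :=
  show LogScheme.Hom (hollow R' S') (hollow R S) from
  { base := f
    app := fun u _ => CommMonCat.ofHom (hollowPush u ρ)
    naturality := fun a c u _ u' _ h => by
      refine CommMonCat.hom_ext (MonoidHom.ext fun m => ?_)
      exact hollowPush_hollowRes ρ a.left u c.left u' h m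
    comm := fun u _ => by
      refine CommMonCat.hom_ext (MonoidHom.ext fun m => ?_)
      exact hollowFun_hollowPush u ρ hρ m }

theorem homSec_hollowMap_comp {S S' : Scheme.{u}} {Y : LogScheme.{u}} (f : S' ⟶ S) (ρ : R →* R')
    (hρ : ∀ r, ρ r = 1 → r = 1) (φ : hollow R S ⟶ Y) {V : Y.toScheme.Etale} (y : S ⟶ V.left)
    (hy : y ≫ V.hom = φ.base) (w : S' ⟶ V.left) (hw : w ≫ V.hom = (hollowMap f ρ hρ ≫ φ).base)
    (h : f ≫ y = w) (m : Y.M.obj (op V)) :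
    homSec (hollowMap f ρ hρ ≫ φ) w hw m = hollowPush f ρ (homSec φ y hy m) :=
  homSec_comp (hollowMap f ρ hρ) φ (V := topEt S) y (hy.trans (Category.id_comp _).symm) f
    (Category.comp_id _) w hw h m

end HollowMap

/-! ### Geometric points with hollow log structures -/

section GeometricPoint

variable {R : Type u} [CommMonoid R] [Subsingleton Rˣ] {K : Type u} [Field K] [IsAlgClosed K]
  {Y : LogScheme.{u}}

theorem iota_eq_comp {U W : Scheme.{u}} {κ : Type u} [Field κ] [IsAlgClosed κ] [ConnectedSpace W]
    (s : W ⟶ Spec (.of κ)) [IsFinite s] (f : U ⟶ W) [Etale f] (y : U) (O : U.Opens)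
    (hO : ∀ z ∈ O, z = y) : O.ι ≫ 𝟙 U = O.ι ≫ f ≫ secAt s f y := by
  have := eq_comp_secAt s f y O.ι fun z => hO _ z.2
  rw [Category.comp_id, ← Category.assoc]
  exact this

/-- A homomorphism from the stalk at a geometric point gives a morphism from the hollow log
scheme. -/
theorem exists_hom_of_stalk (b : Spec (.of K) ⟶ Y.toScheme)
    (h : Y.stalk b →* HollowSections R (Spec (.of K)))
    (hh : ∀ n, hollowFun R _ (h n) = evStalk Y b n) :
    ∃ φ : hollow R (Spec (.of K)) ⟶ Y, φ.base = b := by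
  let t : Spec (.of K) ⟶ Spec (.of K) := 𝟙 _
  have het : ∀ U : (Spec (.of K)).Etale, Etale (U.hom : U.left ⟶ Spec (.of K)) := fun U => U.prop
  have hdisc : ∀ U : (Spec (.of K)).Etale, DiscreteTopology U.left := fun U =>
    discreteTopology_of_etale t U.hom
  have hpt : ∀ {U : (Spec (.of K)).Etale} {V : Y.toScheme.Etale} (u : U.left ⟶ V.left)
      (_ : u ≫ V.hom = U.hom ≫ b) (y : U.left), (secAt t U.hom y ≫ u) ≫ V.hom = b := by
    intro U V u hu y
    rw [Category.assoc, hu]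
    exact (Category.assoc _ _ _).symm.trans ((congrArg (· ≫ b) (secAt_comp t U.hom y)).trans
      (Category.id_comp b))
  -- A scheme étale over Spec K is discrete, and each of its points is a K-point; a section over V
  -- is sent to the family of its germs at the images of these points.
  let g : ∀ {U : (Spec (.of K)).Etale} {V : Y.toScheme.Etale} (u : U.left ⟶ V.left)
      (_ : u ≫ V.hom = U.hom ≫ b), Y.M.obj (op V) →* LocallyConstant U.left (Y.stalk b) :=
    fun {U V} u hu =>
    { toFun := fun m => ⟨fun y => (Y.germ b V (secAt t U.hom y ≫ u) (hpt u hu y)).hom m,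
        IsLocallyConstant.of_discrete _⟩
      map_one' := LocallyConstant.ext fun y =>
        map_one (Y.germ b V (secAt t U.hom y ≫ u) (hpt u hu y)).hom
      map_mul' := fun m n => LocallyConstant.ext fun y =>
        map_mul (Y.germ b V (secAt t U.hom y ≫ u) (hpt u hu y)).hom m n }
  refine ⟨hollowHom R b g ?_ h ?_, rfl⟩
  · intro U U' V V' a c u hu u' hu' hac m y
    refine germ_resM Y b c _ (hpt u' hu' y) _ (hpt u hu (a.left y)) ?_ m
    have h1 : secAt t U.hom (a.left y) = secAt t U'.hom y ≫ a.left := by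
      have h2 := eq_comp_secAt t U.hom (a.left y) (secAt t U'.hom y ≫ a.left) (fun x => by
        rw [Scheme.Hom.comp_apply, secAt_apply])
      have h3 : (secAt t U'.hom y ≫ a.left) ≫ U.hom = 𝟙 _ := by
        rw [Category.assoc]
        exact (congrArg (secAt t U'.hom y ≫ ·) (MorphismProperty.Over.w a)).trans (secAt_comp _ _ _)
      rw [h3, Category.id_comp] at h2
      exact h2.symm
    rw [h1, ← hac]
    simp only [Category.assoc]
  · intro U V u hu m y
    have h4 : hollowFun R _ (h ((Y.germ b V _ (hpt u hu y)).hom m)) =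
      (secAt t U.hom y ≫ u).appTop.hom (funM Y V m) := (hh _).trans (evStalk_germ Y b V _ _ m)
    refine (congrArg (fun f : Γ(Spec (.of K), ⊤) =>
      gm y ((U.hom : U.left ⟶ Spec (.of K)).appTop.hom f)) h4).trans ?_
    let O : U.left.Opens := ⟨{y}, @isOpen_discrete U.left _ (hdisc U) {y}⟩
    have h1 := iota_eq_comp t U.hom y O fun z hz => hz
    have h2 := gm_appTop_congr O y rfl h1 (u.appTop.hom (funM Y V m))
    have h3 : U.hom.appTop.hom ((secAt t U.hom y ≫ u).appTop.hom (funM Y V m)) =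
        (U.hom ≫ secAt t U.hom y).appTop.hom (u.appTop.hom (funM Y V m)) := by
      simp only [Scheme.Hom.comp_appTop]
      rfl
    refine (congrArg (gm y) h3).trans (h2.symm.trans ?_)
    simp

end GeometricPoint

/-! ### Morphisms to one-point log schemes -/

section ToPoint

variable {R : Type u} [CommMonoid R] [Subsingleton Rˣ] {κ : Type u} [Field κ] [IsAlgClosed κ]
  {W : LogScheme.{u}} [ConnectedSpace W.toScheme] (s : W.toScheme ⟶ Spec (.of κ)) [IsFinite s]
  {S : Scheme.{u}}

/-- The section of an étale object over a one-point scheme through a given point. -/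
noncomputable def secHom (V : W.toScheme.Etale) (v : V.left) : topEt W.toScheme ⟶ V :=
  have : Etale (V.hom : V.left ⟶ W.toScheme) := V.prop
  MorphismProperty.Over.homMk (secAt s V.hom v) (secAt_comp s V.hom v)

theorem secHom_comp {V V' : W.toScheme.Etale} (c : V ⟶ V') (v : V.left) :
    secHom s V v ≫ c = secHom s V' (c.left v) := by
  have : Etale (V.hom : V.left ⟶ W.toScheme) := V.prop
  have : Etale (V'.hom : V'.left ⟶ W.toScheme) := V'.prop
  refine MorphismProperty.Over.Hom.ext ?_
  change secAt s V.hom v ≫ c.left = secAt s V'.hom (c.left v)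
  have h2 := eq_comp_secAt s V'.hom (c.left v) (secAt s V.hom v ≫ c.left) (fun x => by
    rw [Scheme.Hom.comp_apply, secAt_apply])
  have h3 : (secAt s V.hom v ≫ c.left) ≫ V'.hom = 𝟙 _ := by
    rw [Category.assoc]
    exact (congrArg (secAt s V.hom v ≫ ·) (MorphismProperty.Over.w c)).trans (secAt_comp _ _ _)
  rw [h3, Category.id_comp] at h2
  exact h2

include s

/-- Each point of an étale W-scheme is open and carries a section from W. Restriction along these
sections turns any section over V into a locally constant family of global ones, so a homomorphism
on global sections compatible with functions suffices. -/
theorem exists_hom_to_point (b : S ⟶ W.toScheme)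
    (h : W.M.obj (op (topEt W.toScheme)) →* HollowSections R S)
    (hh : ∀ m, hollowFun R S (h m) = b.appTop.hom (funM W (topEt W.toScheme) m)) :
    ∃ (φ : hollow R S ⟶ W) (hb : φ.base = b), ∀ m,
      homSec φ (V := topEt W.toScheme) b ((Category.comp_id _).trans hb.symm) m = h m := by
  have het : ∀ V : W.toScheme.Etale, Etale (V.hom : V.left ⟶ W.toScheme) := fun V => V.prop
  have hdisc : ∀ V : W.toScheme.Etale, DiscreteTopology V.left := fun V =>
    discreteTopology_of_etale s (V.hom : V.left ⟶ W.toScheme)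
  let g : ∀ {U : S.Etale} {V : W.toScheme.Etale} (u : U.left ⟶ V.left)
      (_ : u ≫ V.hom = U.hom ≫ b), W.M.obj (op V) →* 
        LocallyConstant U.left (W.M.obj (op (topEt W.toScheme))) :=
    fun {U V} u hu =>
    { toFun := fun m => ⟨fun y => resM (secHom s V (u y)) m,
        (IsLocallyConstant.of_discrete fun v : V.left => resM (secHom s V v) m).comp_continuous
          u.continuous⟩
      map_one' := LocallyConstant.ext fun y => map_one (resM (secHom s V (u y)))
      map_mul' := fun m n => LocallyConstant.ext fun y => map_mul (resM (secHom s V (u y))) m n }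
  refine ⟨hollowHom R b g ?_ h ?_, rfl, fun m => ?_⟩
  · intro U U' V V' a c u hu u' hu' hac m y
    change resM (secHom s V (u (a.left y))) (resM c m) = resM (secHom s V' (u' y)) m
    rw [resM_resM, secHom_comp, ← hac]
    rfl
  · intro U V u hu m y
    have h4 : hollowFun R S (h (resM (secHom s V (u y)) m)) =
      b.appTop.hom ((secHom s V (u y)).left.appTop.hom (funM W V m)) :=
      (hh _).trans (congrArg _ (funM_resM W _ m))
    refine (congrArg (fun f : Γ(S, ⊤) => gm y ((U.hom : U.left ⟶ S).appTop.hom f)) h4).trans ?_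
    let O : U.left.Opens := ⟨u ⁻¹' {u y}, (isOpen_discrete {u y}).preimage u.continuous⟩
    have h1 : O.ι ≫ (U.hom ≫ b ≫ secAt s V.hom (u y)) = O.ι ≫ u := by
      have h5 := eq_comp_secAt s V.hom (u y) (O.ι ≫ u) fun z => z.2
      refine Eq.trans ?_ h5.symm
      have h6 : (O.ι ≫ u) ≫ V.hom = O.ι ≫ U.hom ≫ b :=
        (Category.assoc _ _ _).trans (congrArg (O.ι ≫ ·) hu)
      rw [h6]
      simp only [Category.assoc]
    refine Eq.trans ?_ (gm_appTop_congr O y rfl h1 (funM W V m))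
    simp only [Scheme.Hom.comp_appTop]
    rfl
  · have hid : ∀ v, resM (secHom s (topEt W.toScheme) v) m = m := fun v => by
      have h1 : secHom s (topEt W.toScheme) v = 𝟙 _ := by
        refine MorphismProperty.Over.Hom.ext ?_
        exact (Category.comp_id _).symm.trans (secAt_comp s (𝟙 W.toScheme) v)
      rw [h1, resM_id]
    refine hollow_ext R (fun y => ?_) fun y => ?_
    · exact congrArg (fun n => (h n).1 y) (hid (b y))
    · refine (gm_hollowGlue_snd R _ y).trans ?_
      refine (congrArg (fun n => gm y ((hollowRes R (𝟙 S) (h n)).2.val)) (hid (b y))).trans ?_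
      rw [hollowRes_id]
      rfl

theorem hollow_ext_local {U : Scheme.{u}} {m n : HollowSections R U}
    (h : ∀ y, ∃ O : U.Opens, y ∈ O ∧ hollowRes R O.ι m = hollowRes R O.ι n) : m = n := by
  refine hollow_ext R (fun y => ?_) fun y => ?_
  · obtain ⟨O, hy, hO⟩ := h y
    exact congrArg (fun l : HollowSections R O => l.1 ⟨y, hy⟩) hO
  · obtain ⟨O, hy, hO⟩ := h y
    exact gm_congr O y hy (congrArg (fun l : HollowSections R O => l.2.val) hO)

/-- Where u is constant with value v, it factors through the section of V at v, so the components of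
φ are determined there by global sections. -/
theorem hollowRes_app (φ : hollow R S ⟶ W) {U : S.Etale} {V : W.toScheme.Etale}
    (u : U.left ⟶ V.left) (hu : u ≫ V.hom = U.hom ≫ φ.base) (v : V.left) (O : U.left.Opens)
    (hO : ∀ z ∈ O, u z = v) (m : W.M.obj (op V)) :
    hollowRes R O.ι ((φ.app u hu).hom m : HollowSections R U.left) =
      hollowRes R (O.ι ≫ U.hom) (homSec φ (V := topEt W.toScheme) φ.base (Category.comp_id _)
        (resM (secHom s V v) m)) := by
  have : Etale (V.hom : V.left ⟶ W.toScheme) := V.prop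
  have hu' : (O.ι ≫ u) ≫ V.hom = (etaleOpen U O).hom ≫ φ.base :=
    (Category.assoc _ _ _).trans ((congrArg (O.ι ≫ ·) hu).trans (Category.assoc _ _ _).symm)
  have h1 := φ.naturality (etaleOpenHom U O) (𝟙 V) u hu (O.ι ≫ u) hu'
    (congrArg (O.ι ≫ ·) (Category.comp_id _))
  let a : etaleOpen U O ⟶ topEt S := MorphismProperty.Over.homMk (O.ι ≫ U.hom) (Category.comp_id _)
  have h2 := φ.naturality (U := topEt S) a (secHom s V v) φ.base
    ((Category.comp_id _).trans (Category.id_comp _).symm) (O.ι ≫ u) hu' (by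
    have h3 := eq_comp_secAt s V.hom v (O.ι ≫ u) fun z => hO _ z.2
    refine Eq.trans ?_ h3.symm
    exact (Category.assoc _ _ _).symm.trans (congrArg (· ≫ secAt s V.hom v) hu'.symm))
  have e1 := congr($(h1).hom m)
  have e2 := congr($(h2).hom m)
  have e3 : resM (𝟙 V) m = m := resM_id W m
  refine Eq.trans ?_ e2.symm
  refine Eq.trans ?_ e1
  exact congrArg (fun n => hollowRes R O.ι ((φ.app u hu).hom n : HollowSections R U.left)) e3.symm

theorem hom_ext_to_point (φ ψ : hollow R S ⟶ W) (hb : φ.base = ψ.base)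
    (h : ∀ m, homSec φ (V := topEt W.toScheme) φ.base (Category.comp_id _) m =
      homSec ψ (V := topEt W.toScheme) ψ.base (Category.comp_id _) m) : φ = ψ := by
  refine LogScheme.Hom.ext' hb fun U V u hu hu' => CommMonCat.hom_ext (MonoidHom.ext fun m => ?_)
  have : Etale (V.hom : V.left ⟶ W.toScheme) := V.prop
  have : DiscreteTopology V.left := discreteTopology_of_etale s (V.hom : V.left ⟶ W.toScheme)
  refine hollow_ext_local s (R := R) (U := U.left) fun y => 
    ⟨⟨u ⁻¹' {u y}, (isOpen_discrete {u y}).preimage u.continuous⟩, rfl, ?_⟩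
  refine (hollowRes_app s φ u hu (u y) _ (fun z hz => hz) m).trans (Eq.trans ?_
    (hollowRes_app s ψ u hu' (u y) _ (fun z hz => hz) m).symm)
  rw [h]

end ToPoint

/-! ### Global sections of one-point log schemes -/

/-- The monoid of global sections of a log structure. -/
abbrev gsec (W : LogScheme.{u}) : Type u := W.M.obj (op (topEt W.toScheme))

/-- The map on global sections. -/
noncomputable def gmap {W X : LogScheme.{u}} (f : W ⟶ X) : gsec X →* gsec W :=
  (f.app (U := topEt W.toScheme) (V := topEt X.toScheme) f.base
    ((Category.comp_id _).trans (Category.id_comp _).symm)).hom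

section OnePoint

variable {κ : Type u} [Field κ] [IsAlgClosed κ]
  {W : LogScheme.{u}} [ConnectedSpace W.toScheme] (s : W.toScheme ⟶ Spec (.of κ)) [IsFinite s]

/-- The value of the function of a global section. -/
noncomputable def valM : gsec W →* κ :=
  MonoidHom.comp (N := Γ(W.toScheme, ⊤)) (kval s).toMonoidHom (funM W (topEt W.toScheme))

theorem isUnit_iff_valM (m : gsec W) : IsUnit m ↔ valM s m ≠ 0 :=
  (isUnit_iff_funM W m).trans (isUnit_iff_kval_ne_zero s _)

include s in
-- Every étale neighbourhood of the geometric point admits a section from W through the chosen lift,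
-- so no localisation takes place in the stalk.
theorem bijective_germ {Ω : Type u} [Field Ω] [IsSepClosed Ω] (w : Spec (.of Ω) ⟶ W.toScheme) :
    Function.Bijective (W.germ w (topEt W.toScheme) w (Category.comp_id _)).hom := by
  constructor
  · intro m n h
    obtain ⟨V, c, z, hz, hc, h'⟩ := exists_of_germ_eq W w _ _ _ m n h
    have h1 : secHom s V (z default) ≫ c = 𝟙 _ := by
      rw [secHom_comp]
      refine MorphismProperty.Over.Hom.ext ?_
      exact (Category.comp_id _).symm.trans (secAt_comp s (𝟙 W.toScheme) _)
    have h2 := congrArg (resM (secHom s V (z default))) h'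
    rwa [resM_resM, resM_resM, h1, resM_id, resM_id] at h2
  · intro n
    obtain ⟨V, y, hy, m, rfl⟩ := exists_germ W w n
    refine ⟨resM (secHom s V (y default)) m,
      germ_resM W w (secHom s V (y default)) y hy w (Category.comp_id _) ?_ m⟩
    have : Etale (V.hom : V.left ⟶ W.toScheme) := V.prop
    have h1 := eq_comp_secAt s V.hom (y default) y fun x => by rw [Subsingleton.elim x default]
    rw [hy] at h1
    exact h1.symm

end OnePoint

/-! ### Ghost stalks in terms of global sections -/

section Ghost

variable {Ω : Type u} [Field Ω] [IsSepClosed Ω]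

/-- The class of a global section in the stalk of the ghost sheaf. -/
noncomputable def ghostOf (W : LogScheme.{u}) (w : Spec (.of Ω) ⟶ W.toScheme) :
    gsec W →* Associates (W.stalk w) :=
  Associates.mkMonoidHom.comp (W.germ w (topEt W.toScheme) w (Category.comp_id _)).hom

theorem ghostMap_ghostOf {W X : LogScheme.{u}} (f : W ⟶ X) (w : Spec (.of Ω) ⟶ W.toScheme)
    (x : Spec (.of Ω) ⟶ X.toScheme) (h : w ≫ f.base = x) (m : gsec X) :
    LogScheme.ghostMap f w x h (Additive.ofMul (ghostOf X x m)) =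
      Additive.ofMul (ghostOf W w (gmap f m)) := by
  have h1 := stalkMap_germ W w f x h (U := topEt W.toScheme) (V := topEt X.toScheme) f.base
    ((Category.comp_id _).trans (Category.id_comp _).symm) w (Category.comp_id _) x
    (Category.comp_id _) h m
  exact congrArg (fun n => Additive.ofMul (Associates.mk n)) h1

variable {κ : Type u} [Field κ] [IsAlgClosed κ]
  {W : LogScheme.{u}} [ConnectedSpace W.toScheme] (s : W.toScheme ⟶ Spec (.of κ)) [IsFinite s]
  (w : Spec (.of Ω) ⟶ W.toScheme)
include s

theorem ghostOf_surjective : Function.Surjective (ghostOf W w) :=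
  Associates.mk_surjective.comp (bijective_germ s w).2

theorem ghostOf_eq_iff (m n : gsec W) : ghostOf W w m = ghostOf W w n ↔ ∃ v : (gsec W)ˣ, m * v = n := by
  have hb := bijective_germ s w
  let e : gsec W ≃* W.stalk w := MulEquiv.ofBijective _ hb
  refine Associates.mk_eq_mk_iff_associated.trans ⟨fun ⟨v, hv⟩ => ?_, fun ⟨v, hv⟩ => ?_⟩
  · refine ⟨Units.map (e.symm : W.stalk w →* gsec W) v, e.injective ?_⟩
    rw [map_mul]
    refine (congrArg (e m * ·) (e.apply_symm_apply v.val)).trans hv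
  · exact ⟨Units.map (e : gsec W →* W.stalk w) v, (map_mul e _ _).symm.trans (congrArg e hv)⟩

theorem ghostOf_eq_one_iff (m : gsec W) : ghostOf W w m = 1 ↔ IsUnit m := by
  rw [eq_comm, ← map_one (ghostOf W w), ghostOf_eq_iff s]
  constructor
  · rintro ⟨v, rfl⟩
    rw [one_mul]
    exact v.isUnit
  · rintro ⟨v, rfl⟩
    exact ⟨v, one_mul _⟩

end Ghost

/-! ### Fibre squares of one-point log schemes -/

instance : Subsingleton NatSq.{u}ˣ := by
  have h : ∀ a : NatSq.{u}ˣ, a = 1 := fun a => by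
    have h1 : (Multiplicative.toAdd a.val).down + (Multiplicative.toAdd a.inv).down = 0 :=
      congrArg (fun z : NatSq => (Multiplicative.toAdd z).down) a.val_inv
    have h2 := congrArg Prod.fst h1
    have h3 := congrArg Prod.snd h1
    simp only [Prod.fst_add, Prod.snd_add, Prod.fst_zero, Prod.snd_zero] at h2 h3
    refine Units.ext (Multiplicative.toAdd.injective (ULift.ext _ _ (Prod.ext ?_ ?_)))
    · exact (Nat.add_eq_zero_iff.1 h2).1
    · exact (Nat.add_eq_zero_iff.1 h3).1
  exact ⟨fun a b => (h a).trans (h b).symm⟩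

/-- A commutative square over one-point log schemes finite over `κ`, which is cartesian for
hollow log schemes. -/
structure FsSquare (κ : Type u) [Field κ] [IsAlgClosed κ] where
  (W₁ W₂ X Z : LogScheme.{u})
  (s₁ : W₁.toScheme ⟶ Spec (.of κ)) (s₂ : W₂.toScheme ⟶ Spec (.of κ))
  (s : X.toScheme ⟶ Spec (.of κ))
  (f₁ : W₁ ⟶ X) (f₂ : W₂ ⟶ X) (p₁ : Z ⟶ W₁) (p₂ : Z ⟶ W₂)
  [conn₁ : ConnectedSpace W₁.toScheme] [conn₂ : ConnectedSpace W₂.toScheme]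
  [conn : ConnectedSpace X.toScheme] [fin₁ : IsFinite s₁] [fin₂ : IsFinite s₂] [fin : IsFinite s]
  hf₁ : f₁.base ≫ s = s₁
  hf₂ : f₂.base ≫ s = s₂
  comm : p₁ ≫ f₁ = p₂ ≫ f₂
  exists_lift : ∀ (S : Scheme.{u}) (φ₁ : hollow NatSq.{u} S ⟶ W₁) (φ₂ : hollow NatSq.{u} S ⟶ W₂),
    φ₁ ≫ f₁ = φ₂ ≫ f₂ → ∃ φ : hollow NatSq.{u} S ⟶ Z, φ ≫ p₁ = φ₁ ∧ φ ≫ p₂ = φ₂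
  hom_ext : ∀ (S : Scheme.{u}) (φ ψ : hollow NatSq.{u} S ⟶ Z), φ ≫ p₁ = ψ ≫ p₁ → φ ≫ p₂ = ψ ≫ p₂ →
    φ = ψ
  fs₁ : W₁.isFs
  fs₂ : W₂.isFs
  fsZ : Z.isFs

attribute [instance] FsSquare.conn₁ FsSquare.conn₂ FsSquare.conn FsSquare.fin₁ FsSquare.fin₂
  FsSquare.fin

section Sec

/-- Units of `A` as units of the global functions of `Spec A`. -/
noncomputable def unitSec (A : Type u) [CommRing A] : Aˣ →* (Γ(Spec (.of A), ⊤))ˣ :=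
  Units.map ((Scheme.ΓSpecIso (.of A)).inv.hom : A →* Γ(Spec (.of A), ⊤))

/-- Constant sections of the hollow log structure on an affine scheme. -/
noncomputable def sec (A : Type u) [CommRing A] (r : NatSq.{u}) (c : Aˣ) :
    HollowSections NatSq.{u} (Spec (.of A)) :=
  (LocallyConstant.const _ r, unitSec A c)

theorem hollowFun_sec (A : Type u) [CommRing A] (r : NatSq.{u}) (c : Aˣ) :
    hollowFun NatSq _ (sec A r c) =
      (Scheme.ΓSpecIso (.of A)).inv.hom (indHom NatSq A r * c) := by
  refine gm_ext fun y => ?_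
  rw [gm_hollowFun, map_mul, map_mul]
  refine congrArg₂ (· * ·) ?_ rfl
  exact (map_indHom NatSq ((gm y).comp (Scheme.ΓSpecIso (.of A)).inv.hom) r).symm

theorem kconst_specMap {κ : Type u} [Field κ] {A : Type u} [CommRing A] (j : κ →+* A) (x : κ) :
    kconst (Spec.map (CommRingCat.ofHom j)) x = (Scheme.ΓSpecIso (.of A)).inv.hom (j x) :=
  congr($((Scheme.ΓSpecIso_inv_naturality (CommRingCat.ofHom j)).symm).hom x)

theorem hollowPush_sec {A B : Type u} [CommRing A] [CommRing B] (g : A →+* B)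
    (ρ : NatSq.{u} →* NatSq.{u}) (r : NatSq.{u}) (c : Aˣ) :
    hollowPush (Spec.map (CommRingCat.ofHom g)) ρ (sec A r c) = sec B (ρ r) (Units.map g.toMonoidHom c) := by
  refine Prod.ext (LocallyConstant.ext fun y => rfl) (Units.ext ?_)
  exact congr($((Scheme.ΓSpecIso_inv_naturality (CommRingCat.ofHom g)).symm).hom c.val)

theorem comp_kpt_comp {κ : Type u} [Field κ] [IsAlgClosed κ] {W X S : Scheme.{u}}
    [ConnectedSpace W] [ConnectedSpace X] {s : W ⟶ Spec (.of κ)} [IsFinite s]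
    {s' : X ⟶ Spec (.of κ)} [IsFinite s'] {f : W ⟶ X} (h : f ≫ s' = s) (t : S ⟶ Spec (.of κ)) :
    (t ≫ kpt s) ≫ f = t ≫ kpt s' := by
  have h1 : (kpt s ≫ f) ≫ s' = 𝟙 _ := by rw [Category.assoc, h, kpt_comp]
  have h2 := eq_comp_kpt s' (kpt s ≫ f)
  rw [h1, Category.id_comp] at h2
  rw [Category.assoc, h2]

theorem comp_kpt_comp_self {κ : Type u} [Field κ] [IsAlgClosed κ] {W S : Scheme.{u}}
    [ConnectedSpace W] (s : W ⟶ Spec (.of κ)) [IsFinite s] (t : S ⟶ Spec (.of κ)) :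
    (t ≫ kpt s) ≫ s = t := by
  rw [Category.assoc, kpt_comp, Category.comp_id]

theorem eq_of_comp_eq {κ : Type u} [Field κ] [IsAlgClosed κ] {W S : Scheme.{u}}
    [ConnectedSpace W] (s : W ⟶ Spec (.of κ)) [IsFinite s] [_root_.IsReduced Γ(S, ⊤)]
    {b b' : S ⟶ W} (h : b ≫ s = b' ≫ s) : b = b' := by
  rw [eq_comp_kpt s b, h, ← eq_comp_kpt s b']

end Sec

/-! ### Data for morphisms from hollow log schemes to the fibre product -/

namespace FsSquare

variable {κ : Type u} [Field κ] [IsAlgClosed κ] (Q : FsSquare κ)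

/-- The structure morphism. -/
noncomputable def str : Q.Z.toScheme ⟶ Spec (.of κ) := Q.p₁.base ≫ Q.s₁

theorem p₂_comp : Q.p₂.base ≫ Q.s₂ = Q.str := by
  have h : Q.p₁.base ≫ Q.f₁.base = Q.p₂.base ≫ Q.f₂.base := congrArg LogScheme.Hom.base Q.comm
  rw [str, ← Q.hf₁, ← Q.hf₂, ← Category.assoc, ← Category.assoc, h]

/-- Data describing a morphism from a hollow log scheme over `Spec A` to the fibre product. -/
structure Datum (A : Type u) [CommRing A] (j : κ →+* A) where
  (a₁ : gsec Q.W₁ →* NatSq.{u}) (a₂ : gsec Q.W₂ →* NatSq.{u})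
  (c₁ : gsec Q.W₁ →* Aˣ) (c₂ : gsec Q.W₂ →* Aˣ)
  ha₁ : ∀ m, a₁ m = 1 ↔ IsUnit m
  ha₂ : ∀ m, a₂ m = 1 ↔ IsUnit m
  hc₁ : ∀ m, IsUnit m → (c₁ m : A) = j (valM Q.s₁ m)
  hc₂ : ∀ m, IsUnit m → (c₂ m : A) = j (valM Q.s₂ m)
  comm_a : ∀ m, a₁ (gmap Q.f₁ m) = a₂ (gmap Q.f₂ m)
  comm_c : ∀ m, c₁ (gmap Q.f₁ m) = c₂ (gmap Q.f₂ m)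

variable {Q} {A : Type u} [CommRing A] {j : κ →+* A}

/-- The condition that a morphism is given by a datum. -/
structure Realizes (D : Q.Datum A j) (φ : hollow NatSq.{u} (Spec (.of A)) ⟶ Q.Z) : Prop where
  base : φ.base ≫ Q.str = Spec.map (CommRingCat.ofHom j)
  sec₁ : ∀ m, homSec (φ ≫ Q.p₁) (V := topEt Q.W₁.toScheme) (φ ≫ Q.p₁).base (Category.comp_id _) m =
    sec A (D.a₁ m) (D.c₁ m)
  sec₂ : ∀ m, homSec (φ ≫ Q.p₂) (V := topEt Q.W₂.toScheme) (φ ≫ Q.p₂).base (Category.comp_id _) m =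
    sec A (D.a₂ m) (D.c₂ m)

theorem exists_hom_to_factor {W : LogScheme.{u}} [ConnectedSpace W.toScheme]
    (s : W.toScheme ⟶ Spec (.of κ)) [IsFinite s] (a : gsec W →* NatSq.{u}) (c : gsec W →* Aˣ)
    (ha : ∀ m, a m = 1 ↔ IsUnit m) (hc : ∀ m, IsUnit m → (c m : A) = j (valM s m)) :
    ∃ (φ : hollow NatSq.{u} (Spec (.of A)) ⟶ W)
      (_ : φ.base = Spec.map (CommRingCat.ofHom j) ≫ kpt s),
      ∀ m, homSec φ (V := topEt W.toScheme) φ.base (Category.comp_id _) m = sec A (a m) (c m) := by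
  let h : gsec W →* HollowSections NatSq.{u} (Spec (.of A)) :=
    { toFun := fun m => sec A (a m) (c m)
      map_one' := by rw [map_one, map_one]; exact Prod.ext rfl (map_one (unitSec A))
      map_mul' := fun m n => by
        rw [map_mul, map_mul]; exact Prod.ext rfl (map_mul (unitSec A) _ _) }
  obtain ⟨φ, hb, hφ⟩ := exists_hom_to_point s (Spec.map (CommRingCat.ofHom j) ≫ kpt s) h (by
    intro m
    refine (hollowFun_sec A _ _).trans ?_
    refine Eq.trans ?_ (kpt_appTop s (Spec.map (CommRingCat.ofHom j)) _).symm
    rw [kconst_specMap]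
    refine congrArg _ ?_
    change _ = j (valM s m)
    -- On units this is the condition on c. On non-units both sides vanish: a(m) ≠ 1 makes the
    -- indicator zero, and m has value 0 at the κ-point.
    by_cases hm : IsUnit m
    · rw [(ha m).2 hm, map_one, one_mul, hc m hm]
    · have h1 : a m ≠ 1 := fun h => hm ((ha m).1 h)
      have h2 : valM s m = 0 := by
        by_contra h
        exact hm ((isUnit_iff_valM s m).2 h)
      rw [h2, map_zero]
      simp [indHom, h1])
  refine ⟨φ, hb, fun m => ?_⟩
  rw [← show h m = sec A (a m) (c m) from rfl, ← hφ m]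
  simp only [hb]

theorem exists_realizes (D : Q.Datum A j) : ∃ φ, Realizes D φ := by
  obtain ⟨φ₁, hb₁, hφ₁⟩ := exists_hom_to_factor Q.s₁ D.a₁ D.c₁ D.ha₁ D.hc₁
  obtain ⟨φ₂, hb₂, hφ₂⟩ := exists_hom_to_factor Q.s₂ D.a₂ D.c₂ D.ha₂ D.hc₂
  obtain ⟨φ, h₁, h₂⟩ := Q.exists_lift _ φ₁ φ₂ (by
    refine hom_ext_to_point Q.s _ _ ?_ fun m => ?_
    · exact (congrArg (· ≫ Q.f₁.base) hb₁).trans ((comp_kpt_comp Q.hf₁ _).trans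
        ((comp_kpt_comp Q.hf₂ _).symm.trans (congrArg (· ≫ Q.f₂.base) hb₂).symm))
    · refine (homSec_comp φ₁ Q.f₁ (V := topEt Q.W₁.toScheme) (W := topEt Q.X.toScheme) Q.f₁.base
        ((Category.comp_id _).trans (Category.id_comp _).symm) φ₁.base (Category.comp_id _) _ _
        rfl m).trans ?_
      refine Eq.trans ?_ (homSec_comp φ₂ Q.f₂ (V := topEt Q.W₂.toScheme) (W := topEt Q.X.toScheme)
        Q.f₂.base ((Category.comp_id _).trans (Category.id_comp _).symm) φ₂.base
        (Category.comp_id _) _ _ rfl m).symm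
      refine (hφ₁ (gmap Q.f₁ m)).trans (Eq.trans ?_ (hφ₂ (gmap Q.f₂ m)).symm)
      rw [D.comm_a, D.comm_c])
  refine ⟨φ, ?_, fun m => ?_, fun m => ?_⟩
  · have e : φ.base ≫ Q.p₁.base = φ₁.base := congrArg LogScheme.Hom.base h₁
    exact (Category.assoc _ _ _).symm.trans ((congrArg (· ≫ Q.s₁) (e.trans hb₁)).trans
      (comp_kpt_comp_self Q.s₁ _))
  · rw [← hφ₁]
    simp only [h₁]
  · rw [← hφ₂]
    simp only [h₂]

/-- Reducedness of A is essential: a morphism from a reduced scheme to Wᵢ is determined by its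
composite with the structure morphism to Spec κ, so the data leave no freedom in the base. -/
theorem Realizes.unique [_root_.IsReduced A] {D : Q.Datum A j}
    {φ ψ : hollow NatSq.{u} (Spec (.of A)) ⟶ Q.Z} (hφ : Realizes D φ) (hψ : Realizes D ψ) :
    φ = ψ := by
  have hb := hφ.base.trans hψ.base.symm
  refine Q.hom_ext _ _ _ ?_ ?_
  · refine hom_ext_to_point Q.s₁ _ _ ?_ fun m => (hφ.sec₁ m).trans (hψ.sec₁ m).symm
    exact eq_of_comp_eq (S := Spec (.of A)) Q.s₁ ((Category.assoc _ _ _).trans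
      (hb.trans (Category.assoc _ _ _).symm))
  · refine hom_ext_to_point Q.s₂ _ _ ?_ fun m => (hφ.sec₂ m).trans (hψ.sec₂ m).symm
    have hb' : φ.base ≫ Q.p₂.base ≫ Q.s₂ = ψ.base ≫ Q.p₂.base ≫ Q.s₂ := by
      rw [p₂_comp]
      exact hb
    exact eq_of_comp_eq (S := Spec (.of A)) Q.s₂ ((Category.assoc _ _ _).trans
      (hb'.trans (Category.assoc _ _ _).symm))

/-- The image of a datum under a ring homomorphism and a local homomorphism of monoids. -/
noncomputable def Datum.map (D : Q.Datum A j) {B : Type u} [CommRing B] (g : A →+* B)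
    (ρ : NatSq.{u} →* NatSq.{u}) (hρ : ∀ r, ρ r = 1 → r = 1) : Q.Datum B (g.comp j) where
  a₁ := ρ.comp D.a₁
  a₂ := ρ.comp D.a₂
  c₁ := (Units.map g.toMonoidHom).comp D.c₁
  c₂ := (Units.map g.toMonoidHom).comp D.c₂
  ha₁ m := ⟨fun h => (D.ha₁ m).1 (hρ _ h), fun h => by
    rw [MonoidHom.comp_apply, (D.ha₁ m).2 h, map_one]⟩
  ha₂ m := ⟨fun h => (D.ha₂ m).1 (hρ _ h), fun h => by
    rw [MonoidHom.comp_apply, (D.ha₂ m).2 h, map_one]⟩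
  hc₁ m h := congrArg g (D.hc₁ m h)
  hc₂ m h := congrArg g (D.hc₂ m h)
  comm_a m := congrArg ρ (D.comm_a m)
  comm_c m := congrArg (Units.map g.toMonoidHom) (D.comm_c m)

theorem Realizes.map {D : Q.Datum A j} {φ : hollow NatSq.{u} (Spec (.of A)) ⟶ Q.Z}
    (hφ : Realizes D φ) {B : Type u} [CommRing B] (g : A →+* B)
    (ρ : NatSq.{u} →* NatSq.{u}) (hρ : ∀ r, ρ r = 1 → r = 1) :
    Realizes (D.map g ρ hρ) (hollowMap (Spec.map (CommRingCat.ofHom g)) ρ hρ ≫ φ) where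
  base := by
    refine (Category.assoc _ _ _).trans ((congrArg (Spec.map (CommRingCat.ofHom g) ≫ ·)
      hφ.base).trans ?_)
    exact (Spec.map_comp _ _).symm
  sec₁ m := by
    simp only [Category.assoc]
    refine (homSec_hollowMap_comp _ ρ hρ (φ ≫ Q.p₁) (V := topEt Q.W₁.toScheme) (φ ≫ Q.p₁).base
      (Category.comp_id _) _ _ rfl m).trans ?_
    rw [hφ.sec₁]
    exact hollowPush_sec g ρ _ _
  sec₂ m := by
    simp only [Category.assoc]
    refine (homSec_hollowMap_comp _ ρ hρ (φ ≫ Q.p₂) (V := topEt Q.W₂.toScheme) (φ ≫ Q.p₂).base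
      (Category.comp_id _) _ _ rfl m).trans ?_
    rw [hφ.sec₂]
    exact hollowPush_sec g ρ _ _

/-- A section with ℕ²-component 1 has an invertible function, whereas a non-unit of M(W) pulls back
to a section with function 0. Morphisms from hollow points are thus automatically local on monoids.
-/
theorem isUnit_of_homSec {K : Type u} [Field K] {W : LogScheme.{u}} [ConnectedSpace W.toScheme]
    (s : W.toScheme ⟶ Spec (.of κ)) [IsFinite s] (φ : hollow NatSq.{u} (Spec (.of K)) ⟶ W)
    (m : gsec W)
    (h : (homSec φ (V := topEt W.toScheme) φ.base (Category.comp_id _) m).1 default = 1) :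
    IsUnit m := by
  rw [isUnit_iff_valM s]
  have h1 := hollowFun_homSec φ (V := topEt W.toScheme) φ.base (Category.comp_id _) m
  have h2 : φ.base.appTop.hom (funM W (topEt W.toScheme) m) =
      kconst (φ.base ≫ s) (valM s m) := appTop_eq_kconst_kval (S := Spec (.of K)) s φ.base _
  intro h0
  rw [h0, map_zero] at h2
  have h3 := h1.trans h2
  have h4 : (homSec φ (V := topEt W.toScheme) φ.base (Category.comp_id _) m).1 = 1 := by
    refine LocallyConstant.ext fun y => ?_
    rw [Subsingleton.elim y default, h]
    rfl
  rw [hollowFun_apply, h4, map_one, one_mul] at h3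
  exact Units.ne_zero _ h3

theorem sec_default {K : Type u} [Field K] (d : HollowSections NatSq.{u} (Spec (.of K))) :
    d = sec K (d.1 default) (Units.map (Scheme.ΓSpecIso (.of K)).hom.hom.toMonoidHom d.2) := by
  refine Prod.ext (LocallyConstant.ext fun y => ?_) (Units.ext ?_)
  · rw [Subsingleton.elim y default]
    rfl
  · exact congr($((Scheme.ΓSpecIso (.of K)).hom_inv_id.symm).hom d.2.val)

theorem units_eq_of_hollowFun_eq {K : Type u} [Field K]
    (d : HollowSections NatSq.{u} (Spec (.of K))) (hd : IsUnit d) (j : κ →+* K) (x : κ)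
    (h : hollowFun NatSq _ d = kconst (Spec.map (CommRingCat.ofHom j)) x) :
    (Units.map (Scheme.ΓSpecIso (.of K)).hom.hom.toMonoidHom d.2 : K) = j x := by
  have h1 : d.1 default = 1 := by
    rw [fst_eq_one_of_isUnit NatSq hd]
    rfl
  rw [sec_default d, kconst_specMap, hollowFun_sec, h1, map_one, one_mul] at h
  exact (ConcreteCategory.bijective_of_isIso (Scheme.ΓSpecIso (.of K)).inv).1 h

/-- Since Spec K is a single point, hollow sections over it are pairs in ℕ² × Kˣ. Since it is
reduced, functions on Wᵢ pull back to constants from κ, which yields the condition on units. -/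
theorem exists_datum_of_hom {K : Type u} [Field K] (φ : hollow NatSq.{u} (Spec (.of K)) ⟶ Q.Z) :
    ∃ (j : κ →+* K) (D : Q.Datum K j), Realizes D φ := by
  let t : Spec (.of K) ⟶ Spec (.of κ) := φ.base ≫ Q.str
  let j : κ →+* K := (Spec.preimage t).hom
  have ht : t = Spec.map (CommRingCat.ofHom j) := (Spec.map_preimage t).symm
  let d₁ := homSec (φ ≫ Q.p₁) (V := topEt Q.W₁.toScheme) (φ ≫ Q.p₁).base (Category.comp_id _)
  let d₂ := homSec (φ ≫ Q.p₂) (V := topEt Q.W₂.toScheme) (φ ≫ Q.p₂).base (Category.comp_id _)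
  let pa : HollowSections NatSq.{u} (Spec (.of K)) →* NatSq.{u} :=
    { toFun := fun d => d.1 default, map_one' := rfl, map_mul' := fun _ _ => rfl }
  let pc : HollowSections NatSq.{u} (Spec (.of K)) →* Kˣ :=
    (Units.map (Scheme.ΓSpecIso (.of K)).hom.hom.toMonoidHom).comp (MonoidHom.snd _ _)
  have hd : ∀ m, d₁ (gmap Q.f₁ m) = d₂ (gmap Q.f₂ m) := fun m => by
    have h1 := homSec_comp (φ ≫ Q.p₁) Q.f₁ (V := topEt Q.W₁.toScheme) (W := topEt Q.X.toScheme)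
      Q.f₁.base ((Category.comp_id _).trans (Category.id_comp _).symm) (φ ≫ Q.p₁).base
      (Category.comp_id _) ((φ ≫ Q.p₁) ≫ Q.f₁).base (Category.comp_id _) rfl m
    have h2 := homSec_comp (φ ≫ Q.p₂) Q.f₂ (V := topEt Q.W₂.toScheme) (W := topEt Q.X.toScheme)
      Q.f₂.base ((Category.comp_id _).trans (Category.id_comp _).symm) (φ ≫ Q.p₂).base
      (Category.comp_id _) ((φ ≫ Q.p₂) ≫ Q.f₂).base (Category.comp_id _) rfl m
    refine h1.symm.trans (Eq.trans ?_ h2)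
    have e : (φ ≫ Q.p₁) ≫ Q.f₁ = (φ ≫ Q.p₂) ≫ Q.f₂ := by
      rw [Category.assoc, Category.assoc, Q.comm]
    simp only [e]
  have hfst : ∀ d : HollowSections NatSq.{u} (Spec (.of K)), IsUnit d → d.1 default = 1 := fun d h => by
    rw [fst_eq_one_of_isUnit NatSq h]
    rfl
  have hc : ∀ {W : LogScheme.{u}} [ConnectedSpace W.toScheme] (s : W.toScheme ⟶ Spec (.of κ))
      [IsFinite s] (ψ : hollow NatSq.{u} (Spec (.of K)) ⟶ W) (_ : ψ.base ≫ s = t) (m : gsec W)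
      (_ : IsUnit m), (pc (homSec ψ (V := topEt W.toScheme) ψ.base (Category.comp_id _) m) : K) =
        j (valM s m) := by
    intro W _ s _ ψ hψ m hm
    have h1 := hollowFun_homSec ψ (V := topEt W.toScheme) ψ.base (Category.comp_id _) m
    have h2 : ψ.base.appTop.hom (funM W (topEt W.toScheme) m) = kconst (ψ.base ≫ s) (valM s m) :=
      appTop_eq_kconst_kval (S := Spec (.of K)) s ψ.base _
    exact units_eq_of_hollowFun_eq _ (hm.map _) j _ (h1.trans (h2.trans
      (congrArg (fun b : Spec (.of K) ⟶ Spec (.of κ) => kconst b (valM s m)) (hψ.trans ht))))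
  have ht₁ : (φ ≫ Q.p₁).base ≫ Q.s₁ = t := Category.assoc _ _ _
  have ht₂ : (φ ≫ Q.p₂).base ≫ Q.s₂ = t :=
    (Category.assoc _ _ _).trans (congrArg (φ.base ≫ ·) Q.p₂_comp)
  let D : Q.Datum K j :=
    { a₁ := pa.comp d₁
      a₂ := pa.comp d₂
      c₁ := pc.comp d₁
      c₂ := pc.comp d₂
      ha₁ := fun m => ⟨isUnit_of_homSec Q.s₁ _ m, fun h => hfst _ (h.map d₁)⟩
      ha₂ := fun m => ⟨isUnit_of_homSec Q.s₂ _ m, fun h => hfst _ (h.map d₂)⟩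
      hc₁ := fun m h => hc Q.s₁ (φ ≫ Q.p₁) ht₁ m h
      hc₂ := fun m h => hc Q.s₂ (φ ≫ Q.p₂) ht₂ m h
      comm_a := fun m => congrArg pa (hd m)
      comm_c := fun m => congrArg pc (hd m) }
  exact ⟨j, D, ht, fun m => sec_default _, fun m => sec_default _⟩

end FsSquare

/-! ### Hollow points through every point of an fs log scheme -/

section FsPoints

open Algebra

/-- The homomorphism with given coordinates. -/
def natPair {M : Type*} [CommMonoid M] (l l' : Additive M →+ ℕ) : M →* NatSq.{u} where
  toFun m := Multiplicative.ofAdd ⟨(l (Additive.ofMul m), l' (Additive.ofMul m))⟩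
  map_one' := by
    have h : l (Additive.ofMul (1 : M)) = 0 := map_zero l
    have h' : l' (Additive.ofMul (1 : M)) = 0 := map_zero l'
    rw [h, h']
    rfl
  map_mul' m n := by
    have h : l (Additive.ofMul (m * n)) = l (Additive.ofMul m) + l (Additive.ofMul n) := map_add l _ _
    have h' : l' (Additive.ofMul (m * n)) = l' (Additive.ofMul m) + l' (Additive.ofMul n) :=
      map_add l' _ _
    rw [h, h']
    rfl

theorem natPair_eq_one_iff {M : Type*} [CommMonoid M] (l l' : Additive M →+ ℕ) (m : M) :
    natPair.{u} l l' m = 1 ↔ l (Additive.ofMul m) = 0 ∧ l' (Additive.ofMul m) = 0 := by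
  constructor
  · intro h
    exact ⟨congrArg (fun z : NatSq.{u} => (Multiplicative.toAdd z).down.1) h,
      congrArg (fun z : NatSq.{u} => (Multiplicative.toAdd z).down.2) h⟩
  · rintro ⟨h, h'⟩
    change Multiplicative.ofAdd _ = 1
    rw [h, h']
    rfl

/-- The two components are chosen independently: a local homomorphism from the ghost monoid to ℕ,
and an extension of the evaluation Nˣ → Kˣ to N^gp. The extension exists because Nˣ embeds in N^gp
and Kˣ is divisible. -/
theorem exists_sec_of_isFsStalk {K : Type u} [Field K] [IsAlgClosed K] {N : Type u} [CommMonoid N]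
    (hN : IsFsStalk N) (ev : N →* Γ(Spec (.of K), ⊤)) (hev : ∀ n, IsUnit n ↔ IsUnit (ev n)) :
    ∃ h : N →* HollowSections NatSq.{u} (Spec (.of K)), ∀ n, hollowFun NatSq _ (h n) = ev n := by
  obtain ⟨l, hl⟩ := exists_local_hom_nat hN.fg hN.ghost_of_injective
    fun a b hab => ghost_sharp a b hab
  let e : Γ(Spec (.of K), ⊤) →+* K := (Scheme.ΓSpecIso (.of K)).hom.hom
  let f : Additive Nˣ →+ Additive (GrothendieckGroup N) :=
    (GrothendieckGroup.of.comp (Units.coeHom N)).toAdditive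
  have hf : Function.Injective f := fun a b hab => by
    have := hN.of_injective hab
    exact Additive.toMul.injective (Units.ext this)
  obtain ⟨h, hh⟩ := exists_extension_units f hf
    (Units.map ((e : Γ(Spec (.of K), ⊤) →* K).comp ev)).toAdditive
  let c : N →* Kˣ := (MonoidHom.toAdditive.symm h).comp GrothendieckGroup.of
  have hc : ∀ v : Nˣ, (c v : K) = e (ev v) := fun v =>
    congrArg (fun z : Additive Kˣ => ((Additive.toMul z : Kˣ) : K))
      (DFunLike.congr_fun hh (Additive.ofMul v))
  -- Only locality of this map matters, so the diagonal of ℕ² is good enough.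
  let a : N →* NatSq.{u} := (natPair l l).comp Associates.mkMonoidHom
  have ha : ∀ n, a n = 1 ↔ IsUnit n := fun n => by
    refine ((natPair_eq_one_iff l l _).trans and_self_iff).trans ⟨fun h0 => ?_, fun h0 => ?_⟩
    · exact Associates.mk_eq_one.1 (hl _ h0)
    · have : Associates.mkMonoidHom n = 1 := Associates.mk_eq_one.2 h0
      rw [this]
      exact map_zero l
  refine ⟨
    { toFun := fun n => sec K (a n) (c n)
      map_one' := by rw [map_one, map_one]; exact Prod.ext rfl (map_one (unitSec K))
      map_mul' := fun m n => by
        rw [map_mul, map_mul]; exact Prod.ext rfl (map_mul (unitSec K) _ _) }, fun n => ?_⟩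
  refine (hollowFun_sec K (a n) (c n)).trans ?_
  have hinj : Function.Injective e :=
    (ConcreteCategory.bijective_of_isIso (Scheme.ΓSpecIso (.of K)).hom).1
  refine hinj ((congr($((Scheme.ΓSpecIso (.of K)).inv_hom_id).hom _)).trans ?_)
  change indHom NatSq K (a n) * c n = e (ev n)
  by_cases hn : IsUnit n
  · obtain ⟨v, rfl⟩ := hn
    rw [(ha _).2 v.isUnit, map_one, one_mul, hc]
  · have h1 : a n ≠ 1 := fun h => hn ((ha n).1 h)
    have h2 : e (ev n) = 0 := by
      by_contra h0
      refine hn ((hev n).2 ?_)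
      have h3 := (IsUnit.mk0 _ h0).map (Scheme.ΓSpecIso (.of K)).inv.hom
      rwa [show (Scheme.ΓSpecIso (.of K)).inv.hom (e (ev n)) = ev n from
        congr($((Scheme.ΓSpecIso (.of K)).hom_inv_id).hom _)] at h3
    rw [h2]
    simp [indHom, h1]

/-- Every point of an fs log scheme is the image of a hollow point. -/
theorem exists_hollow_point {Z : LogScheme.{u}} (hZ : Z.isFs) (z : Z.toScheme) :
    ∃ (K : Type u) (_ : Field K) (_ : IsAlgClosed K) (φ : hollow NatSq.{u} (Spec (.of K)) ⟶ Z)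
      (b : Spec (.of K) ⟶ Z.toScheme), φ.base = b ∧ b default = z := by
  let K : Type u := AlgebraicClosure (Z.toScheme.residueField z)
  let b : Spec (.of K) ⟶ Z.toScheme :=
    Spec.map (CommRingCat.ofHom (algebraMap (Z.toScheme.residueField z) K)) ≫
      Z.toScheme.fromSpecResidueField z
  have hb : b default = z := by
    rw [Scheme.Hom.comp_apply]
    exact Z.toScheme.fromSpecResidueField_apply z _
  obtain ⟨h, hh⟩ := exists_sec_of_isFsStalk (isFsStalk_stalk hZ b) (evStalk Z b)
    (isUnit_stalk_iff Z b)
  obtain ⟨φ, hφ⟩ := exists_hom_of_stalk b h hh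
  exact ⟨K, inferInstance, inferInstance, φ, b, hφ, hb⟩

end FsPoints

/-! ### Comparison of local homomorphisms to ℕ -/

section Bound

/-- It suffices to treat generators: there f is either zero, and then f' is too, or at least 1, so
the sum of the values of f' on the generators serves as the constant. -/
theorem exists_le_mul {Q : Type*} [AddCommMonoid Q] (hQ : AddMonoid.FG Q) (f f' : Q →+ ℕ)
    (hf : ∀ q, f q = 0 → f' q = 0) : ∃ N, ∀ q, f' q ≤ N * f q := by
  obtain ⟨S, hS⟩ := hQ.fg_top
  refine ⟨∑ q ∈ S, f' q, fun q => ?_⟩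
  have hq : q ∈ AddSubmonoid.closure (S : Set Q) := hS ▸ AddSubmonoid.mem_top q
  induction hq using AddSubmonoid.closure_induction with
  | mem q hq =>
    by_cases h : f q = 0
    · rw [hf q h]
      exact Nat.zero_le _
    · calc f' q ≤ ∑ q ∈ S, f' q := Finset.single_le_sum (fun _ _ => Nat.zero_le _) hq
        _ ≤ _ := Nat.le_mul_of_pos_right _ (Nat.pos_of_ne_zero h)
  | zero => simp
  | add x y _ _ hx hy =>
    rw [map_add, map_add, mul_add]
    exact add_le_add hx hy

variable {κ Ω : Type u} [Field κ] [IsAlgClosed κ] [Field Ω] [IsSepClosed Ω]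
  {W : LogScheme.{u}} [ConnectedSpace W.toScheme] (s : W.toScheme ⟶ Spec (.of κ)) [IsFinite s]
  (w : Spec (.of Ω) ⟶ W.toScheme)
include s

theorem exists_factor_ghostOf {T : Type*} [CommMonoid T] (f : gsec W →* T)
    (hf : ∀ m, IsUnit m → f m = 1) :
    ∃ g : Associates (W.stalk w) →* T, ∀ m, g (ghostOf W w m) = f m := by
  have hs := ghostOf_surjective s w
  have key : ∀ m n, ghostOf W w m = ghostOf W w n → f m = f n := fun m n h => by
    obtain ⟨v, rfl⟩ := (ghostOf_eq_iff s w m n).1 h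
    rw [map_mul, hf _ v.isUnit, mul_one]
  have h1 : ∀ m, f (Function.surjInv hs (ghostOf W w m)) = f m := fun m =>
    key _ _ (Function.surjInv_eq hs _)
  refine ⟨
    { toFun := fun q => f (Function.surjInv hs q)
      map_one' := by
        rw [← map_one (ghostOf W w), h1, map_one]
      map_mul' := fun p q => by
        obtain ⟨m, rfl⟩ := hs p
        obtain ⟨n, rfl⟩ := hs q
        rw [← map_mul, h1, h1, h1, map_mul] }, h1⟩

end Bound

/-! ### The group of characters of the fibre product -/

open Algebra

section GroupCompletion

variable {M N A : Type*} [AddCommMonoid M] [AddCommMonoid N] [AddCommGroup A]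

/-- The inclusion of the first summand in the sum of two group completions. -/
noncomputable def gpInl (M N : Type*) [AddCommMonoid M] [AddCommMonoid N] :
    M →+ GrothendieckAddGroup M × GrothendieckAddGroup N :=
  (AddMonoidHom.inl _ _).comp GrothendieckAddGroup.of

/-- The inclusion of the second summand in the sum of two group completions. -/
noncomputable def gpInr (M N : Type*) [AddCommMonoid M] [AddCommMonoid N] :
    N →+ GrothendieckAddGroup M × GrothendieckAddGroup N :=
  (AddMonoidHom.inr _ _).comp GrothendieckAddGroup.of

/-- The universal property of the sum of two group completions. -/
noncomputable def gpDesc (f : M →+ A) (g : N →+ A) :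
    GrothendieckAddGroup M × GrothendieckAddGroup N →+ A :=
  (GrothendieckAddGroup.lift f).coprod (GrothendieckAddGroup.lift g)

theorem gpDesc_inl (f : M →+ A) (g : N →+ A) (m : M) : gpDesc f g (gpInl M N m) = f m := by
  change GrothendieckAddGroup.lift f (GrothendieckAddGroup.of m) +
    GrothendieckAddGroup.lift g 0 = f m
  rw [lift_of, map_zero, add_zero]

theorem gpDesc_inr (f : M →+ A) (g : N →+ A) (n : N) : gpDesc f g (gpInr M N n) = g n := by
  change GrothendieckAddGroup.lift f 0 +
    GrothendieckAddGroup.lift g (GrothendieckAddGroup.of n) = g n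
  rw [lift_of, map_zero, zero_add]

theorem exists_add_inl_inr (e : GrothendieckAddGroup M × GrothendieckAddGroup N) :
    ∃ m m' n n', e + (gpInl M N m' + gpInr M N n') = gpInl M N m + gpInr M N n := by
  obtain ⟨x, y⟩ := e
  obtain ⟨m, m', hm⟩ := exists_add_of_eq_of x
  obtain ⟨n, n', hn⟩ := exists_add_of_eq_of y
  refine ⟨m, m', n, n', Prod.ext ?_ ?_⟩
  · change x + (GrothendieckAddGroup.of m' + 0) = GrothendieckAddGroup.of m + 0
    rw [add_zero, add_zero, hm]
  · change y + (0 + GrothendieckAddGroup.of n') = 0 + GrothendieckAddGroup.of n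
    rw [zero_add, zero_add, hn]

theorem gp_hom_ext {f g : GrothendieckAddGroup M × GrothendieckAddGroup N →+ A}
    (h₁ : ∀ m, f (gpInl M N m) = g (gpInl M N m)) (h₂ : ∀ n, f (gpInr M N n) = g (gpInr M N n)) :
    f = g := by
  ext e
  obtain ⟨m, m', n, n', h⟩ := exists_add_inl_inr e
  have hf := congrArg f h
  have hg := congrArg g h
  simp only [map_add] at hf hg
  rw [h₁, h₁, h₂, h₂] at hf
  exact add_right_cancel (hf.trans hg.symm)

end GroupCompletion

namespace FsSquare

variable {κ : Type u} [Field κ] [IsAlgClosed κ] (Q : FsSquare κ)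

/-- The sum of the group completions of the monoids of global sections. -/
abbrev gp : Type u :=
  GrothendieckAddGroup (Additive (gsec Q.W₁)) × GrothendieckAddGroup (Additive (gsec Q.W₂))

/-- The class of a section on the first factor. -/
noncomputable abbrev inl (m : gsec Q.W₁) : Q.gp := gpInl _ _ (Additive.ofMul m)

/-- The class of a section on the second factor. -/
noncomputable abbrev inr (m : gsec Q.W₂) : Q.gp := gpInr _ _ (Additive.ofMul m)

/-- The subgroup generated by the units and the relations from the base. -/
noncomputable def rel : AddSubgroup Q.gp :=
  AddSubgroup.closure ({e | ∃ m, IsUnit m ∧ e = Q.inl m} ∪ {e | ∃ m, IsUnit m ∧ e = Q.inr m} ∪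
    {e | ∃ m, e = Q.inl (gmap Q.f₁ m) - Q.inr (gmap Q.f₂ m)})

/-- The quotient of the sum of the group completions by the units and the relations from the
base. -/
abbrev coker : Type u := Q.gp ⧸ Q.rel

variable {Q}

theorem inl_mem_rel {m : gsec Q.W₁} (hm : IsUnit m) : Q.inl m ∈ Q.rel :=
  AddSubgroup.subset_closure (Or.inl (Or.inl ⟨m, hm, rfl⟩))

theorem inr_mem_rel {m : gsec Q.W₂} (hm : IsUnit m) : Q.inr m ∈ Q.rel :=
  AddSubgroup.subset_closure (Or.inl (Or.inr ⟨m, hm, rfl⟩))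

theorem sub_mem_rel (m : gsec Q.X) : Q.inl (gmap Q.f₁ m) - Q.inr (gmap Q.f₂ m) ∈ Q.rel :=
  AddSubgroup.subset_closure (Or.inr ⟨m, rfl⟩)

theorem rel_le {H : AddSubgroup Q.gp} (h₁ : ∀ m, IsUnit m → Q.inl m ∈ H)
    (h₂ : ∀ m, IsUnit m → Q.inr m ∈ H)
    (h₃ : ∀ m, Q.inl (gmap Q.f₁ m) - Q.inr (gmap Q.f₂ m) ∈ H) : Q.rel ≤ H := by
  refine (AddSubgroup.closure_le _).2 ?_
  rintro _ ((⟨m, hm, rfl⟩ | ⟨m, hm, rfl⟩) | ⟨m, rfl⟩)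
  exacts [h₁ m hm, h₂ m hm, h₃ m]

theorem eq_zero_of_mem_rel {B : Type*} [AddCommGroup B] (F : Q.gp →+ B)
    (h₁ : ∀ m, IsUnit m → F (Q.inl m) = 0) (h₂ : ∀ m, IsUnit m → F (Q.inr m) = 0)
    (h₃ : ∀ m, F (Q.inl (gmap Q.f₁ m)) = F (Q.inr (gmap Q.f₂ m))) {e : Q.gp} (he : e ∈ Q.rel) :
    F e = 0 := by
  refine rel_le (H := F.ker) h₁ h₂ (fun m => ?_) he
  change F _ = 0
  rw [map_sub, h₃, sub_self]

section Coker

variable {Ω : Type u} [Field Ω] [IsSepClosed Ω] (w₁ : Spec (.of Ω) ⟶ Q.W₁.toScheme)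
  (w₂ : Spec (.of Ω) ⟶ Q.W₂.toScheme) (x : Spec (.of Ω) ⟶ Q.X.toScheme)
  (h₁ : w₁ ≫ Q.f₁.base = x) (h₂ : w₂ ≫ Q.f₂.base = x)

/-- Dividing out the units replaces M(Wᵢ) by the ghost monoid Qᵢ. As M(X) maps onto P, the remaining
relations generate the image of θ; the minus sign in θ matches the difference in `rel`. The two
inverse maps come from the universal properties. -/
theorem nonempty_cokerEquiv : Nonempty (Q.coker ≃+
    ((GrothendieckAddGroup (Q.W₁.ghost w₁) × GrothendieckAddGroup (Q.W₂.ghost w₂)) ⧸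
      (theta (LogScheme.ghostMap Q.f₁ w₁ x h₁) (LogScheme.ghostMap Q.f₂ w₂ x h₂)).range)) := by
  set θ := theta (LogScheme.ghostMap Q.f₁ w₁ x h₁) (LogScheme.ghostMap Q.f₂ w₂ x h₂) with hθ
  let q := QuotientAddGroup.mk' θ.range
  let q' := QuotientAddGroup.mk' Q.rel
  have hq : ∀ p, q (gpInl _ _ (LogScheme.ghostMap Q.f₁ w₁ x h₁ p)) =
      q (gpInr _ _ (LogScheme.ghostMap Q.f₂ w₂ x h₂ p)) := fun p => by
    rw [← sub_eq_zero, ← map_sub]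
    refine (QuotientAddGroup.eq_zero_iff _).2 ⟨GrothendieckAddGroup.of p, Prod.ext ?_ ?_⟩
    · refine (gpMap_of _ _).trans ?_
      exact (sub_zero _).symm
    · refine (congrArg Neg.neg (gpMap_of _ _)).trans ?_
      exact (zero_sub _).symm
  let F : Q.gp →+ _ := gpDesc
    (q.comp ((gpInl _ _).comp (ghostOf Q.W₁ w₁).toAdditive))
    (q.comp ((gpInr _ _).comp (ghostOf Q.W₂ w₂).toAdditive))
  have hF₁ : ∀ m, F (Q.inl m) = q (gpInl _ _ (Additive.ofMul (ghostOf Q.W₁ w₁ m))) :=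
    fun m => gpDesc_inl _ _ _
  have hF₂ : ∀ m, F (Q.inr m) = q (gpInr _ _ (Additive.ofMul (ghostOf Q.W₂ w₂ m))) :=
    fun m => gpDesc_inr _ _ _
  have hF : ∀ e ∈ Q.rel, F e = 0 := fun e he => by
    refine eq_zero_of_mem_rel F (fun m hm => ?_) (fun m hm => ?_) (fun m => ?_) he
    · rw [hF₁, (ghostOf_eq_one_iff Q.s₁ w₁ m).2 hm, ofMul_one, map_zero, map_zero]
    · rw [hF₂, (ghostOf_eq_one_iff Q.s₂ w₂ m).2 hm, ofMul_one, map_zero, map_zero]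
    · rw [hF₁, hF₂, ← ghostMap_ghostOf Q.f₁ w₁ x h₁, ← ghostMap_ghostOf Q.f₂ w₂ x h₂, hq]
  obtain ⟨g₁, hg₁⟩ := exists_factor_ghostOf Q.s₁ w₁ (T := Multiplicative Q.coker)
    (AddMonoidHom.toMultiplicativeRight (q'.comp (gpInl _ _)))
    fun m hm => (QuotientAddGroup.eq_zero_iff _).2 (inl_mem_rel hm)
  obtain ⟨g₂, hg₂⟩ := exists_factor_ghostOf Q.s₂ w₂ (T := Multiplicative Q.coker)
    (AddMonoidHom.toMultiplicativeRight (q'.comp (gpInr _ _)))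
    fun m hm => (QuotientAddGroup.eq_zero_iff _).2 (inr_mem_rel hm)
  have hg₁' : ∀ m, MonoidHom.toAdditiveLeft g₁ (Additive.ofMul (ghostOf Q.W₁ w₁ m)) = q' (Q.inl m) :=
    fun m => hg₁ m
  have hg₂' : ∀ m, MonoidHom.toAdditiveLeft g₂ (Additive.ofMul (ghostOf Q.W₂ w₂ m)) = q' (Q.inr m) :=
    fun m => hg₂ m
  let G := gpDesc (MonoidHom.toAdditiveLeft g₁) (MonoidHom.toAdditiveLeft g₂)
  have hG : ∀ e ∈ θ.range, G e = 0 := by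
    rintro _ ⟨e, rfl⟩
    have h0 : G.comp θ = 0 := by
      refine GrothendieckAddGroup.lift.symm.injective (AddMonoidHom.ext fun p => ?_)
      obtain ⟨m, rfl⟩ := ghostOf_surjective Q.s x p
      change G (θ (GrothendieckAddGroup.of (Additive.ofMul (ghostOf Q.X x m)))) = 0
      have h : θ (GrothendieckAddGroup.of (Additive.ofMul (ghostOf Q.X x m))) =
          gpInl _ _ (Additive.ofMul (ghostOf Q.W₁ w₁ (gmap Q.f₁ m))) -
            gpInr _ _ (Additive.ofMul (ghostOf Q.W₂ w₂ (gmap Q.f₂ m))) := by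
        rw [← ghostMap_ghostOf Q.f₁ w₁ x h₁, ← ghostMap_ghostOf Q.f₂ w₂ x h₂]
        refine Prod.ext ?_ ?_
        · refine (gpMap_of _ _).trans ?_
          exact (sub_zero _).symm
        · refine (congrArg Neg.neg (gpMap_of _ _)).trans ?_
          exact (zero_sub _).symm
      rw [h, map_sub, gpDesc_inl, gpDesc_inr, hg₁', hg₂', ← map_sub]
      exact (QuotientAddGroup.eq_zero_iff _).2 (sub_mem_rel m)
    exact DFunLike.congr_fun h0 e
  refine ⟨AddMonoidHom.toAddEquiv (QuotientAddGroup.lift _ F hF) (QuotientAddGroup.lift _ G hG)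
    (QuotientAddGroup.addMonoidHom_ext _ (gp_hom_ext (fun m => ?_) fun m => ?_))
    (QuotientAddGroup.addMonoidHom_ext _ (gp_hom_ext (fun p => ?_) fun p => ?_))⟩
  · change QuotientAddGroup.lift _ G hG (F (Q.inl m.toMul)) = q' (Q.inl m.toMul)
    rw [hF₁]
    exact (gpDesc_inl _ _ _).trans (hg₁' _)
  · change QuotientAddGroup.lift _ G hG (F (Q.inr m.toMul)) = q' (Q.inr m.toMul)
    rw [hF₂]
    exact (gpDesc_inr _ _ _).trans (hg₂' _)
  · obtain ⟨m, rfl⟩ := ghostOf_surjective Q.s₁ w₁ p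
    change QuotientAddGroup.lift _ F hF (G (gpInl _ _ (Additive.ofMul (ghostOf Q.W₁ w₁ m)))) = _
    rw [gpDesc_inl, hg₁']
    exact hF₁ m
  · obtain ⟨m, rfl⟩ := ghostOf_surjective Q.s₂ w₂ p
    change QuotientAddGroup.lift _ F hF (G (gpInr _ _ (Additive.ofMul (ghostOf Q.W₂ w₂ m)))) = _
    rw [gpDesc_inr, hg₂']
    exact hF₂ m

end Coker

/-! ### Characters of data -/

variable {A B : Type u} [CommRing A] [CommRing B] {j : κ →+* A} {i : κ →+* B}

/-- The homomorphism on the sum of the group completions defined by a datum. -/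
noncomputable def Datum.pc (D : Q.Datum A j) : Q.gp →+ Additive Aˣ :=
  gpDesc D.c₁.toAdditive D.c₂.toAdditive

theorem Datum.pc_inl (D : Q.Datum A j) (m : gsec Q.W₁) :
    D.pc (Q.inl m) = Additive.ofMul (D.c₁ m) := gpDesc_inl _ _ _

theorem Datum.pc_inr (D : Q.Datum A j) (m : gsec Q.W₂) :
    D.pc (Q.inr m) = Additive.ofMul (D.c₂ m) := gpDesc_inr _ _ _

/-- The datum with the same monoid homomorphisms and prescribed units. -/
noncomputable def Datum.withC (D : Q.Datum A j) (F : Q.gp →+ Additive Bˣ)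
    (h₁ : ∀ m, IsUnit m → ((F (Q.inl m)).toMul : B) = i (valM Q.s₁ m))
    (h₂ : ∀ m, IsUnit m → ((F (Q.inr m)).toMul : B) = i (valM Q.s₂ m))
    (h₃ : ∀ m, F (Q.inl (gmap Q.f₁ m)) = F (Q.inr (gmap Q.f₂ m))) : Q.Datum B i where
  a₁ := D.a₁
  a₂ := D.a₂
  c₁ := MonoidHom.toAdditive.symm (F.comp (gpInl _ _))
  c₂ := MonoidHom.toAdditive.symm (F.comp (gpInr _ _))
  ha₁ := D.ha₁
  ha₂ := D.ha₂
  hc₁ := h₁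
  hc₂ := h₂
  comm_a := D.comm_a
  comm_c m := congrArg Additive.toMul (h₃ m)

theorem Datum.pc_withC (D : Q.Datum A j) (F : Q.gp →+ Additive Bˣ)
    (h₁ : ∀ m, IsUnit m → ((F (Q.inl m)).toMul : B) = i (valM Q.s₁ m))
    (h₂ : ∀ m, IsUnit m → ((F (Q.inr m)).toMul : B) = i (valM Q.s₂ m))
    (h₃ : ∀ m, F (Q.inl (gmap Q.f₁ m)) = F (Q.inr (gmap Q.f₂ m))) :
    (D.withC F h₁ h₂ h₃).pc = F :=
  gp_hom_ext (fun m => pc_inl _ m.toMul) fun m => pc_inr _ m.toMul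

theorem Datum.pc_map (D : Q.Datum A j) (g : A →+* B) (ρ : NatSq.{u} →* NatSq.{u})
    (hρ : ∀ r, ρ r = 1 → r = 1) (e : Q.gp) :
    (D.map g ρ hρ).pc e = (Units.map g.toMonoidHom).toAdditive (D.pc e) :=
  DFunLike.congr_fun (g := (Units.map g.toMonoidHom).toAdditive.comp D.pc) (gp_hom_ext
    (fun m => (pc_inl (D.map g ρ hρ) m.toMul).trans
      (congrArg (Units.map g.toMonoidHom).toAdditive (pc_inl D m.toMul)).symm)
    fun m => (pc_inr (D.map g ρ hρ) m.toMul).trans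
      (congrArg (Units.map g.toMonoidHom).toAdditive (pc_inr D m.toMul)).symm) e

/-- There is a datum over the base field as soon as there is one over some extension. -/
theorem exists_datum {K : Type u} [Field K] {j : κ →+* K} (D : Q.Datum K j) :
    Nonempty (Q.Datum κ (RingHom.id κ)) := by
  let J : Additive κˣ →+ Additive Kˣ := (Units.map j.toMonoidHom).toAdditive
  have hJ : Function.Injective J := fun x y h =>
    Additive.toMul.injective (Units.ext (j.injective
      (congrArg (fun z : Additive Kˣ => (z.toMul : K)) h)))
  have h1 : ∀ {W : LogScheme.{u}} [ConnectedSpace W.toScheme] (s : W.toScheme ⟶ Spec (.of κ))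
      [IsFinite s] (m : gsec W) (_ : IsUnit m) (c : Kˣ) (_ : (c : K) = j (valM s m)),
      J (Additive.ofMul (Units.mk0 (valM s m) ((isUnit_iff_valM s m).1 ‹_›))) = Additive.ofMul c :=
    fun s _ m hm c hc => Additive.toMul.injective (Units.ext hc.symm)
  -- On units the homomorphism of D is evaluation, with values in κˣ, and on relations from X it is
  -- trivial. Its restriction to `rel` therefore descends to κˣ, and it extends to the whole group
  -- by divisibility; the maps to ℕ² are kept.
  have hrel : Q.rel ≤ J.range.comap D.pc := by
    refine rel_le (fun m hm => ⟨_, (h1 Q.s₁ m hm _ (D.hc₁ m hm)).trans (D.pc_inl m).symm⟩)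
      (fun m hm => ⟨_, (h1 Q.s₂ m hm _ (D.hc₂ m hm)).trans (D.pc_inr m).symm⟩) fun m => ⟨0, ?_⟩
    rw [map_zero, map_sub, Datum.pc_inl, Datum.pc_inr, D.comm_c, sub_self]
  choose μ hμ using fun e : Q.rel => hrel e.2
  obtain ⟨F, hF⟩ := exists_extension_units Q.rel.subtype Subtype.val_injective
    { toFun := μ
      map_zero' := hJ (by rw [hμ, map_zero]; exact map_zero _)
      map_add' := fun x y => hJ (by rw [map_add, hμ, hμ, hμ]; exact map_add _ _ _) }
  have hF' : ∀ e ∈ Q.rel, J (F e) = D.pc e := fun e he =>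
    (congrArg J (DFunLike.congr_fun hF ⟨e, he⟩)).trans (hμ ⟨e, he⟩)
  refine ⟨D.withC F (fun m hm => ?_) (fun m hm => ?_) fun m => hJ ?_⟩
  · have h := hF' _ (inl_mem_rel hm)
    rw [Datum.pc_inl, ← h1 Q.s₁ m hm _ (D.hc₁ m hm)] at h
    exact congrArg (fun z : Additive κˣ => (z.toMul : κ)) (hJ h)
  · have h := hF' _ (inr_mem_rel hm)
    rw [Datum.pc_inr, ← h1 Q.s₂ m hm _ (D.hc₂ m hm)] at h
    exact congrArg (fun z : Additive κˣ => (z.toMul : κ)) (hJ h)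
  · have h := hF' _ (sub_mem_rel m)
    rw [map_sub, map_sub, map_sub, Datum.pc_inl, Datum.pc_inr, D.comm_c, sub_self] at h
    exact sub_eq_zero.1 h

/-- The character of a datum relative to a base datum. -/
noncomputable def Datum.chi (D₀ : Q.Datum κ (RingHom.id κ)) (D : Q.Datum A j) :
    Q.gp →+ Additive Aˣ :=
  D.pc - (Units.map j.toMonoidHom).toAdditive.comp D₀.pc

/-- On units both homomorphisms are evaluation, and each one separately respects the relations from
X. The difference of two data is thus a character of `coker`. -/
theorem Datum.sub_eq_zero_of_mem_rel (D D' : Q.Datum A j) {e : Q.gp} (he : e ∈ Q.rel) :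
    (D.pc - D'.pc) e = 0 := by
  refine eq_zero_of_mem_rel _ (fun m hm => ?_) (fun m hm => ?_) (fun m => ?_) he
  · rw [AddMonoidHom.sub_apply, pc_inl, pc_inl, sub_eq_zero]
    exact congrArg Additive.ofMul (Units.ext ((D.hc₁ m hm).trans (D'.hc₁ m hm).symm))
  · rw [AddMonoidHom.sub_apply, pc_inr, pc_inr, sub_eq_zero]
    exact congrArg Additive.ofMul (Units.ext ((D.hc₂ m hm).trans (D'.hc₂ m hm).symm))
  · rw [AddMonoidHom.sub_apply, AddMonoidHom.sub_apply, pc_inr, pc_inr, pc_inl, pc_inl, D.comm_c,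
      D'.comm_c]

theorem Datum.chi_of_mem_rel (D₀ : Q.Datum κ (RingHom.id κ)) (D : Q.Datum A j) {e : Q.gp}
    (he : e ∈ Q.rel) : chi D₀ D e = 0 := by
  have h := sub_eq_zero_of_mem_rel D (D₀.map j (MonoidHom.id _) fun _ h => h) he
  rw [AddMonoidHom.sub_apply, pc_map] at h
  exact h

/-- Multiplication of the units of a datum by a character. -/
noncomputable def Datum.twist (D : Q.Datum A j) (ψ : Q.gp →+ Additive Aˣ)
    (hψ : ∀ e ∈ Q.rel, ψ e = 0) : Q.Datum A j :=
  D.withC (D.pc + ψ)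
    (fun m hm => by
      rw [AddMonoidHom.add_apply, hψ _ (inl_mem_rel hm), add_zero, pc_inl]
      exact D.hc₁ m hm)
    (fun m hm => by
      rw [AddMonoidHom.add_apply, hψ _ (inr_mem_rel hm), add_zero, pc_inr]
      exact D.hc₂ m hm)
    (fun m => by
      have h := hψ _ (sub_mem_rel m)
      rw [map_sub, sub_eq_zero] at h
      rw [AddMonoidHom.add_apply, AddMonoidHom.add_apply, pc_inl, pc_inr, D.comm_c, h])

theorem Datum.pc_twist (D : Q.Datum A j) (ψ : Q.gp →+ Additive Aˣ)
    (hψ : ∀ e ∈ Q.rel, ψ e = 0) : (D.twist ψ hψ).pc = D.pc + ψ := pc_withC _ _ _ _ _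

end FsSquare

/-! ### Local constancy of the torsion part of the character -/

open Algebra

/-- Xⁿ - 1 already splits over κ, so it acquires no new roots in K. -/
theorem exists_root_of_pow_eq_one {κ K : Type*} [Field κ] [IsAlgClosed κ] [Field K] (j : κ →+* K)
    {n : ℕ} (hn : 0 < n) {x : Kˣ} (hx : x ^ n = 1) :
    ∃ ζ : κˣ, ζ ^ n = 1 ∧ Units.map j.toMonoidHom ζ = x := by
  have h1 : Polynomial.Splits (Polynomial.X ^ n - Polynomial.C (1 : κ)) := IsAlgClosed.splits _
  have h2 : (x : K) ∈ ((Polynomial.X ^ n - Polynomial.C (1 : κ)).map j).roots := by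
    rw [Polynomial.map_sub, Polynomial.map_pow, Polynomial.map_X,
      Polynomial.map_C, map_one, Polynomial.mem_roots (Polynomial.X_pow_sub_C_ne_zero hn 1)]
    have : (x : K) ^ n = 1 := congrArg Units.val hx
    simp [this]
  rw [h1.roots_map, Multiset.mem_map] at h2
  obtain ⟨ζ, hζ, h3⟩ := h2
  rw [Polynomial.mem_roots (Polynomial.X_pow_sub_C_ne_zero hn 1)] at hζ
  have h4 : ζ ^ n = 1 := by
    simpa [sub_eq_zero] using hζ
  exact ⟨Units.ofPowEqOne ζ n h4 hn.ne', Units.ext h4, Units.ext h3⟩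

namespace FsSquare

variable {κ : Type u} [Field κ] [IsAlgClosed κ] {Q : FsSquare κ}

theorem gmap_gmap (m : gsec Q.X) :
    gmap Q.p₁ (gmap Q.f₁ m) = gmap Q.p₂ (gmap Q.f₂ m) := by
  have h : ∀ {X Y Z : LogScheme.{u}} (f : X ⟶ Y) (g : Y ⟶ Z) (m : gsec Z),
      gmap (f ≫ g) m = gmap f (gmap g m) := fun {X Y Z} f g m =>
    congr($(comp_app f g (U := topEt X.toScheme) (V := topEt Y.toScheme) (W := topEt Z.toScheme)
      f.base ((Category.comp_id _).trans (Category.id_comp _).symm) g.base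
      ((Category.comp_id _).trans (Category.id_comp _).symm) (f ≫ g).base
      ((Category.comp_id _).trans (Category.id_comp _).symm) rfl).hom m)
  rw [← h, ← h, Q.comm]

theorem Realizes.homSec_gmap₁ {A : Type u} [CommRing A] {j : κ →+* A} {D : Q.Datum A j}
    {φ : hollow NatSq.{u} (Spec (.of A)) ⟶ Q.Z} (hφ : Realizes D φ) (m : gsec Q.W₁) :
    homSec φ (V := topEt Q.Z.toScheme) φ.base (Category.comp_id _) (gmap Q.p₁ m) =
      sec A (D.a₁ m) (D.c₁ m) :=
  (homSec_comp φ Q.p₁ (V := topEt Q.Z.toScheme) (W := topEt Q.W₁.toScheme) Q.p₁.base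
    ((Category.comp_id _).trans (Category.id_comp _).symm) φ.base (Category.comp_id _) _ _
    rfl m).symm.trans (hφ.sec₁ m)

theorem Realizes.homSec_gmap₂ {A : Type u} [CommRing A] {j : κ →+* A} {D : Q.Datum A j}
    {φ : hollow NatSq.{u} (Spec (.of A)) ⟶ Q.Z} (hφ : Realizes D φ) (m : gsec Q.W₂) :
    homSec φ (V := topEt Q.Z.toScheme) φ.base (Category.comp_id _) (gmap Q.p₂ m) =
      sec A (D.a₂ m) (D.c₂ m) :=
  (homSec_comp φ Q.p₂ (V := topEt Q.Z.toScheme) (W := topEt Q.W₂.toScheme) Q.p₂.base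
    ((Category.comp_id _).trans (Category.id_comp _).symm) φ.base (Category.comp_id _) _ _
    rfl m).symm.trans (hφ.sec₂ m)

/-- A torsion class becomes a unit locally at each geometric point of the fibre product. -/
theorem exists_unit_stalk {Ω : Type u} [Field Ω] [IsSepClosed Ω] (b : Spec (.of Ω) ⟶ Q.Z.toScheme)
    {n : ℕ} (hn : 0 < n) {e : Q.gp} (he : n • e ∈ Q.rel) (m₁ m₁' : gsec Q.W₁) (m₂ m₂' : gsec Q.W₂)
    (h : e + (Q.inl m₁' + Q.inr m₂') = Q.inl m₁ + Q.inr m₂) :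
    ∃ d : (Q.Z.stalk b)ˣ,
      (Q.Z.germ b (topEt Q.Z.toScheme) b (Category.comp_id _)).hom
        (gmap Q.p₁ m₁ * gmap Q.p₂ m₂) =
      (Q.Z.germ b (topEt Q.Z.toScheme) b (Category.comp_id _)).hom
        (gmap Q.p₁ m₁' * gmap Q.p₂ m₂') * d := by
  have hN := isFsStalk_stalk Q.fsZ b
  let N := Q.Z.stalk b
  let γ : gsec Q.Z →* N := (Q.Z.germ b (topEt Q.Z.toScheme) b (Category.comp_id _)).hom
  let of : N →* GrothendieckGroup N := GrothendieckGroup.of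
  let F : Q.gp →+ Additive (GrothendieckGroup N) := gpDesc (of.comp (γ.comp (gmap Q.p₁))).toAdditive
    (of.comp (γ.comp (gmap Q.p₂))).toAdditive
  have hF₁ : ∀ m, F (Q.inl m) = Additive.ofMul (of (γ (gmap Q.p₁ m))) := fun m => gpDesc_inl _ _ _
  have hF₂ : ∀ m, F (Q.inr m) = Additive.ofMul (of (γ (gmap Q.p₂ m))) := fun m => gpDesc_inr _ _ _
  have hrel : Q.rel ≤ ((of.comp (Units.coeHom N)).toAdditive.range).comap F := by
    refine rel_le (fun m hm => ?_) (fun m hm => ?_) fun m => ⟨0, ?_⟩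
    · obtain ⟨v, hv⟩ := (hm.map (gmap Q.p₁)).map γ
      refine ⟨Additive.ofMul v, ?_⟩
      rw [hF₁, ← hv]
      rfl
    · obtain ⟨v, hv⟩ := (hm.map (gmap Q.p₂)).map γ
      refine ⟨Additive.ofMul v, ?_⟩
      rw [hF₂, ← hv]
      rfl
    · rw [map_zero, map_sub, hF₁, hF₂, gmap_gmap, sub_self]
  obtain ⟨v, hv⟩ := hrel he
  set a : N := γ (gmap Q.p₁ m₁ * gmap Q.p₂ m₂) with ha
  set a' : N := γ (gmap Q.p₁ m₁' * gmap Q.p₂ m₂') with ha'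
  have h1 : F e + Additive.ofMul (of a') = Additive.ofMul (of a) := by
    have := congrArg F h
    rw [map_add, map_add, map_add, hF₁, hF₁, hF₂, hF₂, ← ofMul_mul, ← ofMul_mul, ← map_mul,
      ← map_mul, ← map_mul, ← map_mul] at this
    exact this
  have h2 : of (a ^ n) = of (a' ^ n * v.toMul) := by
    have h2' : n • Additive.ofMul (of a) = n • Additive.ofMul (of a') + F (n • e) := by
      rw [← h1, nsmul_add, ← map_nsmul, add_comm]
    rw [← hv, ← ofMul_pow, ← ofMul_pow] at h2'
    rw [map_mul, map_pow, map_pow]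
    exact congrArg Additive.toMul h2'
  have h3 : a ^ n = a' ^ n * (v.toMul : Nˣ) := hN.of_injective h2
  -- Saturation of the stalk of `Z` enters here: aⁿ is a'ⁿ times a unit, so a' divides a, and the
  -- n-th power of the quotient is a unit.
  obtain ⟨d, hd⟩ := hN.exists_mul n a a' _ hn h3
  have h4 : d ^ n = (v.toMul : Nˣ) := by
    refine hN.cancel _ _ (a' ^ n) ?_
    rw [mul_comm, ← mul_pow, ← hd, h3, mul_comm]
  have h5 : IsUnit d := (isUnit_pow_iff hn.ne').1 (h4 ▸ Units.isUnit _)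
  exact ⟨h5.unit, hd⟩

theorem exists_add_inl_inr' (e : Q.gp) : ∃ (m m' : gsec Q.W₁) (n n' : gsec Q.W₂),
    e + (Q.inl m' + Q.inr n') = Q.inl m + Q.inr n := by
  obtain ⟨m, m', n, n', h⟩ := exists_add_inl_inr e
  exact ⟨m.toMul, m'.toMul, n.toMul, n'.toMul, h⟩

/-- Étale locally, the value of the units of data on a torsion class is given by a function. -/
theorem exists_unit_section {Ω : Type u} [Field Ω] [IsSepClosed Ω]
    (b : Spec (.of Ω) ⟶ Q.Z.toScheme) {n : ℕ} (hn : 0 < n) {e : Q.gp} (he : n • e ∈ Q.rel) :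
    ∃ (U : Scheme.{u}) (f : U ⟶ Q.Z.toScheme) (_ : Etale f) (y : Spec (.of Ω) ⟶ U)
      (_ : y ≫ f = b) (g : Γ(U, ⊤)), ∀ (A : Type u) [CommRing A] (j : κ →+* A) (D : Q.Datum A j)
        (φ : hollow NatSq.{u} (Spec (.of A)) ⟶ Q.Z) (_ : Realizes D φ)
        (z : Spec (.of A) ⟶ U) (_ : z ≫ f = φ.base),
        z.appTop.hom g = (Scheme.ΓSpecIso (.of A)).inv.hom (D.pc e).toMul := by
  obtain ⟨m₁, m₁', m₂, m₂', h⟩ := exists_add_inl_inr' e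
  obtain ⟨d, hd⟩ := exists_unit_stalk b hn he m₁ m₁' m₂ m₂' h
  obtain ⟨V, c, z, hz, hc, v, hv⟩ :=
    exists_unit_germ_over b (topEt Q.Z.toScheme) b (Category.comp_id _) d
  obtain ⟨U, c', y, hy, hc', h'⟩ := exists_of_germ_eq Q.Z b V z hz
    (resM c (gmap Q.p₁ m₁ * gmap Q.p₂ m₂)) (resM c (gmap Q.p₁ m₁' * gmap Q.p₂ m₂') * v) (by
      refine (germ_resM Q.Z b c b (Category.comp_id _) z hz hc _).trans (hd.trans ?_)
      rw [map_mul (Q.Z.germ b V z hz).hom]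
      exact congrArg₂ (· * ·) (germ_resM Q.Z b c b (Category.comp_id _) z hz hc _).symm
        (congrArg Units.val hv).symm)
  -- The function is that of the unit v with m₁m₂ = m₁'m₂'v over U. Pulled back along a morphism
  -- realising D, this identity makes the unit component of v equal to the value of `D.pc` on e,
  -- since e = m₁ + m₂ - m₁' - m₂'.
  refine ⟨U.left, U.hom, U.prop, y, hy, funM Q.Z U (resM c' v), fun A _ j D φ hφ t ht => ?_⟩
  have hcc : t ≫ (c' ≫ c).left = φ.base := by
    refine Eq.trans ?_ ht
    let c'' : U ⟶ topEt Q.Z.toScheme := c' ≫ c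
    have hw : c''.left ≫ (topEt Q.Z.toScheme).hom = U.hom := MorphismProperty.Over.w c''
    exact congrArg (t ≫ ·) ((Category.comp_id _).symm.trans hw)
  have e1 : ∀ k, homSec φ t ht (resM c' (resM c k)) =
      homSec φ (V := topEt Q.Z.toScheme) φ.base (Category.comp_id _) k := fun k => by
    rw [resM_resM]
    exact homSec_resM φ (c' ≫ c) (V := topEt Q.Z.toScheme) φ.base (Category.comp_id _) t ht hcc k
  have e2 := congrArg (homSec φ t ht) h'
  rw [map_mul (resM c'), map_mul (homSec φ t ht), e1, e1, map_mul, map_mul, hφ.homSec_gmap₁, hφ.homSec_gmap₁,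
    hφ.homSec_gmap₂, hφ.homSec_gmap₂] at e2
  have e3 : unitSec A (D.c₁ m₁) * unitSec A (D.c₂ m₂) =
      unitSec A (D.c₁ m₁') * unitSec A (D.c₂ m₂') * (homSec φ t ht (resM c' v)).2 :=
    congrArg Prod.snd e2
  have e4 : (D.pc e).toMul * (D.c₁ m₁' * D.c₂ m₂') = D.c₁ m₁ * D.c₂ m₂ := by
    have h' := congrArg D.pc h
    rw [map_add, map_add, map_add, D.pc_inl, D.pc_inl, D.pc_inr, D.pc_inr] at h'
    exact congrArg Additive.toMul h'
  have e5 : (homSec φ t ht (resM c' v)).2 = unitSec A (D.pc e).toMul := by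
    refine mul_left_cancel (e3.symm.trans ?_)
    rw [← map_mul, ← map_mul, ← map_mul, ← e4, mul_comm]
  have e6 := hollowFun_homSec φ t ht (resM c' v)
  have e7 : IsUnit (homSec φ t ht (resM c' v)) := (v.isUnit.map (resM c')).map _
  rw [hollowFun_apply, fst_eq_one_of_isUnit NatSq e7, map_one, one_mul, e5] at e6
  exact e6.symm

theorem Datum.pc_eq_chi {A : Type u} [CommRing A] {j : κ →+* A} (D₀ : Q.Datum κ (RingHom.id κ))
    (D : Q.Datum A j) (e : Q.gp) :
    ((D.pc e).toMul : A) = (chi D₀ D e).toMul * j (D₀.pc e).toMul := by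
  have : D.pc e = chi D₀ D e + (Units.map j.toMonoidHom).toAdditive (D₀.pc e) :=
    (sub_add_cancel _ _).symm
  rw [this]
  rfl

/-- On torsion classes the characters take values in the base field. -/
theorem exists_chi_eq {K : Type u} [Field K] {j : κ →+* K} (D₀ : Q.Datum κ (RingHom.id κ))
    (D : Q.Datum K j) {n : ℕ} (hn : 0 < n) {e : Q.gp} (he : n • e ∈ Q.rel) :
    ∃ ζ : κˣ, ζ ^ n = 1 ∧ Units.map j.toMonoidHom ζ = (Datum.chi D₀ D e).toMul := by
  refine exists_root_of_pow_eq_one j hn ?_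
  have h := Datum.chi_of_mem_rel D₀ D he
  rw [map_nsmul] at h
  exact congrArg Additive.toMul h

/-- For any datum the value on e is ξ times that of D₀ for some n-th root of unity ξ of κ, and étale
locally it is given by one function g. Let ζ be the root occurring at z. The product of g - ξ·D₀(e)
over all ξ ≠ ζ is nonzero exactly where the root is ζ. This is an open condition, and étale maps are
open. -/
theorem exists_isOpen_chi (D₀ : Q.Datum κ (RingHom.id κ)) {n : ℕ} (hn : 0 < n) {e : Q.gp}
    (he : n • e ∈ Q.rel) (z : Q.Z.toScheme) :
    ∃ (O : Set Q.Z.toScheme) (ζ : κˣ), IsOpen O ∧ z ∈ O ∧ ∀ (K : Type u) [Field K] [IsAlgClosed K]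
      (j : κ →+* K) (D : Q.Datum K j) (φ : hollow NatSq.{u} (Spec (.of K)) ⟶ Q.Z)
      (_ : Realizes D φ) (b : Spec (.of K) ⟶ Q.Z.toScheme) (_ : φ.base = b), b default ∈ O →
        (Datum.chi D₀ D e).toMul = Units.map j.toMonoidHom ζ := by
  obtain ⟨Ω, _, _, φ₀, b₀, hb₀, rfl⟩ := exists_hollow_point Q.fsZ z
  obtain ⟨j₀, D₁, hφ₀⟩ := exists_datum_of_hom φ₀
  obtain ⟨ζ, hζ, hζ'⟩ := exists_chi_eq D₀ D₁ hn he
  obtain ⟨U, f, _, y, hy, g, hg⟩ := exists_unit_section b₀ hn he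
  classical
  let P : Γ(U, ⊤) := ∏ ξ ∈ (Polynomial.nthRootsFinset n (1 : κ)).erase ζ,
    (g - kconst (f ≫ Q.str) (ξ * (D₀.pc e).toMul))
  have hP : ∀ (K : Type u) [Field K] (j : κ →+* K) (D : Q.Datum K j)
      (φ : hollow NatSq.{u} (Spec (.of K)) ⟶ Q.Z) (_ : Realizes D φ) (t : Spec (.of K) ⟶ U)
      (_ : t ≫ f = φ.base) (ξ : κˣ) (_ : ξ ^ n = 1)
      (_ : Units.map j.toMonoidHom ξ = (Datum.chi D₀ D e).toMul),
      t default ∈ U.basicOpen P ↔ ξ = ζ := by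
    intro K _ j D φ hφ t ht ξ hξ hξ'
    have h1 : t.appTop.hom P = (Scheme.ΓSpecIso (.of K)).inv.hom
        (j (∏ ξ' ∈ (Polynomial.nthRootsFinset n (1 : κ)).erase ζ,
          (ξ - ξ') * (D₀.pc e).toMul)) := by
      rw [map_prod, map_prod, map_prod]
      refine Finset.prod_congr rfl fun ξ' _ => ?_
      rw [map_sub, hg K j D φ hφ t ht, kconst_comp]
      have h2 : t ≫ f ≫ Q.str = Spec.map (CommRingCat.ofHom j) :=
        (Category.assoc _ _ _).symm.trans ((congrArg (· ≫ Q.str) ht).trans hφ.base)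
      rw [h2, kconst_specMap, ← map_sub]
      refine congrArg _ ?_
      rw [Datum.pc_eq_chi D₀, ← hξ', sub_mul, map_sub, map_mul, map_mul]
      rfl
    have h3 : IsUnit (t.appTop.hom P) ↔ t default ∈ U.basicOpen P := by
      rw [isUnit_appTop_iff]
      exact ⟨fun h => h _, fun h s => Subsingleton.elim default s ▸ h⟩
    rw [← h3, h1]
    have h4 : ∀ x : K, IsUnit ((Scheme.ΓSpecIso (.of K)).inv.hom x) ↔ x ≠ 0 := fun x => by
      rw [← isUnit_iff_ne_zero]
      exact MulEquiv.isUnit_map (Scheme.ΓSpecIso (.of K)).symm.commRingCatIsoToRingEquiv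
    rw [h4, map_ne_zero, Finset.prod_ne_zero_iff]
    constructor
    · intro h
      by_contra hne
      refine h ξ (Finset.mem_erase.2 ⟨fun h' => hne (Units.ext h'), ?_⟩) (by simp)
      rw [Polynomial.mem_nthRootsFinset hn]
      exact congrArg Units.val hξ
    · rintro rfl ξ' hξ'
      exact mul_ne_zero (sub_ne_zero.2 (Finset.mem_erase.1 hξ').1.symm) (Units.ne_zero _)
  refine ⟨f '' (U.basicOpen P), ζ, ?_, ?_, ?_⟩
  · exact f.isOpenMap _ (U.basicOpen P).2
  · exact ⟨y default, (hP Ω j₀ D₁ φ₀ hφ₀ y (hy.trans hb₀.symm) ζ hζ hζ').2 rfl, by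
      rw [← hy]; rfl⟩
  · rintro K _ _ j D φ hφ b rfl ⟨x, hx, hxb⟩
    obtain ⟨t, ht, rfl⟩ := Scheme.exists_fac_of_etale_of_isSepClosed f _ x hxb
    obtain ⟨ξ, hξ, hξ'⟩ := exists_chi_eq D₀ D hn he
    rw [← hξ', (hP K j D φ hφ t ht ξ hξ hξ').1 hx]

end FsSquare

/-! ### Points of the fibre product and their data -/

open Algebra

/-- A residue field of K ⊗ K' over κ receives both fields; its algebraic closure is taken. -/
theorem exists_common_extension {κ K K' : Type u} [Field κ] [Field K] [Field K'] (j : κ →+* K)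
    (j' : κ →+* K') : ∃ (L : Type u) (_ : Field L) (_ : IsAlgClosed L) (g : K →+* L)
      (g' : K' →+* L), g.comp j = g'.comp j' := by
  algebraize [j, j']
  obtain ⟨M, hM⟩ := Ideal.exists_maximal (TensorProduct κ K K')
  let F := TensorProduct κ K K' ⧸ M
  let _ : Field F := Ideal.Quotient.field M
  let π : TensorProduct κ K K' →+* AlgebraicClosure F :=
    (algebraMap F (AlgebraicClosure F)).comp (Ideal.Quotient.mk M)
  refine ⟨AlgebraicClosure F, inferInstance, inferInstance,
    π.comp (Algebra.TensorProduct.includeLeft (S := κ)).toRingHom,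
    π.comp (Algebra.TensorProduct.includeRight).toRingHom, ?_⟩
  ext x
  refine congrArg π ?_
  exact ((Algebra.TensorProduct.includeLeft (R := κ) (S := κ) (A := K) (B := K')).commutes x).trans
    ((Algebra.TensorProduct.includeRight (R := κ) (A := K) (B := K')).commutes x).symm

section NatSq

/-- The linear form with given coefficients. -/
def natLin (α β : ℕ) : Additive NatSq.{u} →+ ℕ where
  toFun r := α * (Multiplicative.toAdd r.toMul).down.1 + β * (Multiplicative.toAdd r.toMul).down.2
  map_zero' := by
    change α * 0 + β * 0 = 0
    simp
  map_add' r r' := by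
    change α * (_ + _) + β * (_ + _) = _
    ring

theorem eq_one_of_natLin_eq_zero {α β : ℕ} (hα : 0 < α) (hβ : 0 < β) (r : NatSq.{u})
    (h : natLin α β (Additive.ofMul r) = 0) : r = 1 := by
  have h1 : α * (Multiplicative.toAdd r).down.1 + β * (Multiplicative.toAdd r).down.2 = 0 := h
  rw [Nat.add_eq_zero_iff, Nat.mul_eq_zero, Nat.mul_eq_zero] at h1
  refine Multiplicative.toAdd.injective (ULift.ext _ _ (Prod.ext ?_ ?_))
  · exact h1.1.resolve_left hα.ne'
  · exact h1.2.resolve_left hβ.ne'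

/-- The difference of a multiple of a homomorphism and a smaller homomorphism. -/
def natSub {M : Type*} [AddCommMonoid M] (N : ℕ) (b b' : M →+ ℕ) (h : ∀ m, b' m ≤ N * b m) :
    M →+ ℕ where
  toFun m := N * b m - b' m
  map_zero' := by simp
  map_add' m m' := by
    have h1 := h m
    have h2 := h m'
    rw [map_add, map_add, mul_add]
    omega

end NatSq

namespace FsSquare

variable {κ : Type u} [Field κ] [IsAlgClosed κ] {Q : FsSquare κ}

/-- The point of the fibre product given by a datum over a field. -/
def IsPt {K : Type u} [Field K] {j : κ →+* K} (D : Q.Datum K j) (z : Q.Z.toScheme) : Prop :=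
  ∃ (φ : hollow NatSq.{u} (Spec (.of K)) ⟶ Q.Z) (b : Spec (.of K) ⟶ Q.Z.toScheme),
    Realizes D φ ∧ φ.base = b ∧ b default = z

theorem exists_isPt {K : Type u} [Field K] {j : κ →+* K} (D : Q.Datum K j) : ∃ z, IsPt D z := by
  obtain ⟨φ, hφ⟩ := exists_realizes D
  exact ⟨_, φ, _, hφ, rfl, rfl⟩

theorem IsPt.unique {K : Type u} [Field K] {j : κ →+* K} {D : Q.Datum K j} {z z' : Q.Z.toScheme}
    (h : IsPt D z) (h' : IsPt D z') : z = z' := by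
  obtain ⟨φ, b, hφ, rfl, rfl⟩ := h
  obtain ⟨φ', b', hφ', rfl, rfl⟩ := h'
  rw [hφ.unique hφ']

theorem Realizes.exists_map {A : Type u} [CommRing A] {j : κ →+* A} {D : Q.Datum A j}
    {φ : hollow NatSq.{u} (Spec (.of A)) ⟶ Q.Z} (hφ : Realizes D φ) {B : Type u} [CommRing B]
    (g : A →+* B) (i : κ →+* B) (hi : g.comp j = i) (ρ : NatSq.{u} →* NatSq.{u})
    (hρ : ∀ r, ρ r = 1 → r = 1) :
    ∃ (D' : Q.Datum B i) (φ' : hollow NatSq.{u} (Spec (.of B)) ⟶ Q.Z), Realizes D' φ' ∧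
      φ'.base = Spec.map (CommRingCat.ofHom g) ≫ φ.base ∧
      (∀ e, D'.pc e = (Units.map g.toMonoidHom).toAdditive (D.pc e)) ∧
      (∀ m, D'.a₁ m = ρ (D.a₁ m)) ∧ ∀ m, D'.a₂ m = ρ (D.a₂ m) := by
  subst hi
  exact ⟨_, _, hφ.map g ρ hρ, rfl, fun e => D.pc_map g ρ hρ e, fun _ => rfl, fun _ => rfl⟩

/-- Neither extending the field nor changing the monoid part moves the image point, because the
underlying morphism only gets precomposed with a map of one-point spectra. -/
theorem IsPt.exists_map {K : Type u} [Field K] {j : κ →+* K} {D : Q.Datum K j}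
    {z : Q.Z.toScheme} (hD : IsPt D z) {L : Type u} [Field L]
    (g : K →+* L) (i : κ →+* L) (hi : g.comp j = i) (ρ : NatSq.{u} →* NatSq.{u})
    (hρ : ∀ r, ρ r = 1 → r = 1) :
    ∃ (D' : Q.Datum L i), IsPt D' z ∧
      (∀ e, D'.pc e = (Units.map g.toMonoidHom).toAdditive (D.pc e)) ∧
      (∀ m, D'.a₁ m = ρ (D.a₁ m)) ∧ ∀ m, D'.a₂ m = ρ (D.a₂ m) := by
  obtain ⟨φ, b, hφ, hb, hz⟩ := hD
  obtain ⟨D', φ', hφ', hb', h⟩ := hφ.exists_map g i hi ρ hρ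
  refine ⟨D', ⟨φ', _, hφ', hb'.trans (congrArg (_ ≫ ·) hb), ?_⟩, h⟩
  rw [← hz]
  refine (Scheme.Hom.comp_apply (Spec.map (CommRingCat.ofHom g)) b default).trans ?_
  exact congrArg b (Subsingleton.elim _ _)

theorem Datum.ext_pc {A : Type u} [CommRing A] {j : κ →+* A} {D D' : Q.Datum A j}
    (hc : D.pc = D'.pc) (h₁ : ∀ m, D.a₁ m = D'.a₁ m) (h₂ : ∀ m, D.a₂ m = D'.a₂ m) : D = D' := by
  have e₁ : D.a₁ = D'.a₁ := MonoidHom.ext h₁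
  have e₂ : D.a₂ = D'.a₂ := MonoidHom.ext h₂
  have e₃ : D.c₁ = D'.c₁ := MonoidHom.ext fun m => by
    have := DFunLike.congr_fun hc (Q.inl m)
    rw [pc_inl, pc_inl] at this
    exact Additive.ofMul.injective this
  have e₄ : D.c₂ = D'.c₂ := MonoidHom.ext fun m => by
    have := DFunLike.congr_fun hc (Q.inr m)
    rw [pc_inr, pc_inr] at this
    exact Additive.ofMul.injective this
  cases D
  cases D'
  cases e₁
  cases e₂
  cases e₃
  cases e₄
  rfl

/-- The point only depends on the monoid homomorphisms up to linear maps. -/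
theorem IsPt.eq_of_natLin {K : Type u} [Field K] {j : κ →+* K} {D D' : Q.Datum K j}
    (hc : D.pc = D'.pc) {α β γ : ℕ} (hα : 0 < α) (hβ : 0 < β) (hγ : 0 < γ)
    (h₁ : ∀ m, γ * natLin 1 1 (Additive.ofMul (D.a₁ m)) = natLin α β (Additive.ofMul (D'.a₁ m)))
    (h₂ : ∀ m, γ * natLin 1 1 (Additive.ofMul (D.a₂ m)) = natLin α β (Additive.ofMul (D'.a₂ m)))
    {z z' : Q.Z.toScheme} (hD : IsPt D z) (hD' : IsPt D' z') : z = z' := by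
  have hρ : ∀ {α β : ℕ}, 0 < α → 0 < β → ∀ r, natPair.{u} (natLin α β) (natLin α β) r = 1 → r = 1 :=
    fun hα hβ r h => eq_one_of_natLin_eq_zero hα hβ r ((natPair_eq_one_iff _ _ _).1 h).1
  -- Both data are pushed to the diagonal of ℕ² by local homomorphisms. This leaves their points
  -- unchanged, and by hypothesis the two results coincide.
  obtain ⟨E, hE, hEc, hE₁, hE₂⟩ := hD.exists_map (RingHom.id K) j (RingHom.id_comp j)
    (natPair (natLin γ γ) (natLin γ γ)) (hρ hγ hγ)
  obtain ⟨E', hE', hEc', hE₁', hE₂'⟩ := hD'.exists_map (RingHom.id K) j (RingHom.id_comp j)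
    (natPair (natLin α β) (natLin α β)) (hρ hα hβ)
  have key : ∀ r r', γ * natLin 1 1 (Additive.ofMul r) = natLin α β (Additive.ofMul r') →
      natPair.{u} (natLin.{u} γ γ) (natLin γ γ) r = natPair (natLin α β) (natLin α β) r' := fun r r' h => by
    have h1 : natLin γ γ (Additive.ofMul r) = natLin α β (Additive.ofMul r') := by
      rw [← h]
      change γ * _ + γ * _ = γ * (1 * _ + 1 * _)
      ring
    change Multiplicative.ofAdd _ = Multiplicative.ofAdd _
    rw [h1]
  have : E = E' := by
    refine Datum.ext_pc (AddMonoidHom.ext fun e => ?_) (fun m => ?_) fun m => ?_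
    · rw [hEc, hEc', hc]
    · rw [hE₁, hE₁', key _ _ (h₁ m)]
    · rw [hE₂, hE₂', key _ _ (h₂ m)]
  subst this
  exact hE.unique hE'

theorem exists_le_mul_gsec {W : LogScheme.{u}} [ConnectedSpace W.toScheme]
    (s : W.toScheme ⟶ Spec (.of κ)) [IsFinite s] (hW : W.isFs) (b b' : Additive (gsec W) →+ ℕ)
    (hb : ∀ m, b (Additive.ofMul m) = 0 ↔ IsUnit m)
    (hb' : ∀ m, b' (Additive.ofMul m) = 0 ↔ IsUnit m) : ∃ N, ∀ m, b' m ≤ N * b m := by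
  obtain ⟨g, hg⟩ := exists_factor_ghostOf s (kpt s) (T := Multiplicative ℕ)
    (AddMonoidHom.toMultiplicativeRight b) fun m hm => (hb m).2 hm
  obtain ⟨g', hg'⟩ := exists_factor_ghostOf s (kpt s) (T := Multiplicative ℕ)
    (AddMonoidHom.toMultiplicativeRight b') fun m hm => (hb' m).2 hm
  obtain ⟨N, hN⟩ := exists_le_mul (isFsStalk_stalk hW (kpt s)).fg (MonoidHom.toAdditiveLeft g)
    (MonoidHom.toAdditiveLeft g') fun q hq => by
      obtain ⟨m, rfl⟩ := ghostOf_surjective s (kpt s) q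
      refine (hg' m).trans ((hb' m).2 ((hb m).1 ?_))
      exact (hg m).symm.trans hq
  refine ⟨N, fun m => ?_⟩
  have h := hN (Additive.ofMul (ghostOf W (kpt s) m.toMul))
  have e : MonoidHom.toAdditiveLeft g (Additive.ofMul (ghostOf W (kpt s) m.toMul)) = b m := hg m.toMul
  have e' : MonoidHom.toAdditiveLeft g' (Additive.ofMul (ghostOf W (kpt s) m.toMul)) = b' m :=
    hg' m.toMul
  rwa [e, e'] at h

/-- The point does not depend on the monoid homomorphisms. -/
theorem IsPt.eq_of_pc_eq {K : Type u} [Field K] {j : κ →+* K} {D D' : Q.Datum K j}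
    (hc : D.pc = D'.pc) {z z' : Q.Z.toScheme} (hD : IsPt D z) (hD' : IsPt D' z') : z = z' := by
  have hb : ∀ {M : Type u} [CommMonoid M] (a : M →* NatSq.{u}) (_ : ∀ m, a m = 1 ↔ IsUnit m)
      (m : M), (natLin 1 1).comp a.toAdditive (Additive.ofMul m) = 0 ↔ IsUnit m := by
    intro M _ a ha m
    rw [← ha]
    refine ⟨fun h => eq_one_of_natLin_eq_zero one_pos one_pos _ h, fun h => ?_⟩
    change natLin 1 1 (Additive.ofMul (a m)) = 0
    rw [h]
    exact map_zero _
  obtain ⟨N₁, h₁⟩ := exists_le_mul_gsec Q.s₁ Q.fs₁ _ _ (hb _ D.ha₁) (hb _ D'.ha₁)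
  obtain ⟨N₁', h₁'⟩ := exists_le_mul_gsec Q.s₁ Q.fs₁ _ _ (hb _ D'.ha₁) (hb _ D.ha₁)
  obtain ⟨N₂, h₂⟩ := exists_le_mul_gsec Q.s₂ Q.fs₂ _ _ (hb _ D.ha₂) (hb _ D'.ha₂)
  obtain ⟨N₂', h₂'⟩ := exists_le_mul_gsec Q.s₂ Q.fs₂ _ _ (hb _ D'.ha₂) (hb _ D.ha₂)
  -- One N bounds all four comparisons; N ≥ 2 makes γ = N² - 1 positive.
  obtain ⟨N, hN, l₁, l₁', l₂, l₂'⟩ : ∃ N, 2 ≤ N ∧ N₁ ≤ N ∧ N₁' ≤ N ∧ N₂ ≤ N ∧ N₂' ≤ N :=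
    ⟨N₁ + N₁' + N₂ + N₂' + 2, by omega, by omega, by omega, by omega, by omega⟩
  replace h₁ := fun m => (h₁ m).trans (Nat.mul_le_mul_right _ l₁)
  replace h₁' := fun m => (h₁' m).trans (Nat.mul_le_mul_right _ l₁')
  replace h₂ := fun m => (h₂ m).trans (Nat.mul_le_mul_right _ l₂)
  replace h₂' := fun m => (h₂' m).trans (Nat.mul_le_mul_right _ l₂')
  obtain ⟨γ, hγ0, hγ⟩ : ∃ γ, 0 < γ ∧ γ + 1 = N * N :=
    ⟨N * N - 1, by have := Nat.mul_le_mul hN hN; omega, by have := Nat.mul_le_mul hN hN; omega⟩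
  -- The map (x, y) ↦ (Nx - y, Ny - x) has determinant N² - 1 = γ, and the linear forms with
  -- coefficients (N, 1) and (1, N) recover γx and γy. The bounds make the natural subtractions
  -- exact.
  have arith : ∀ x y : ℕ, y ≤ N * x → x ≤ N * y →
      γ * x = N * (N * x - y) + 1 * (N * y - x) ∧ γ * y = 1 * (N * x - y) + N * (N * y - x) := by
    intro x y h h'
    zify [h, h']
    have hγ' : (γ : ℤ) = N * N - 1 := by
      have : (γ : ℤ) + 1 = N * N := by exact_mod_cast hγ
      linarith
    rw [hγ']
    constructor <;> ring
  have unit : ∀ x y : ℕ, y ≤ N * x → x ≤ N * y → N * x - y = 0 → N * y - x = 0 → x = 0 := by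
    intro x y h h' e e'
    have := (arith x y h h').1
    rw [e, e'] at this
    simpa [hγ0.ne'] using this
  -- With b and b' the sums of the two coordinates of the maps of D and D', this datum uses (Nb -
  -- b', Nb' - b). It specialises to multiples of both b and b', so it defines the point of D and
  -- that of D' at once; a single copy of ℕ would not have room for both.
  let E : Q.Datum K j :=
    { D with
      a₁ := natPair (natSub N _ _ h₁) (natSub N _ _ h₁')
      a₂ := natPair (natSub N _ _ h₂) (natSub N _ _ h₂')
      ha₁ := fun m => (natPair_eq_one_iff _ _ m).trans
        ⟨fun h => (hb _ D.ha₁ m).1 (unit _ _ (h₁ _) (h₁' _) h.1 h.2), fun h => by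
          have e := (hb _ D.ha₁ m).2 h
          have e' := (hb _ D'.ha₁ m).2 h
          exact ⟨by change _ * _ - _ = 0; rw [e, e']; simp, by change _ * _ - _ = 0; rw [e, e']; simp⟩⟩
      ha₂ := fun m => (natPair_eq_one_iff _ _ m).trans
        ⟨fun h => (hb _ D.ha₂ m).1 (unit _ _ (h₂ _) (h₂' _) h.1 h.2), fun h => by
          have e := (hb _ D.ha₂ m).2 h
          have e' := (hb _ D'.ha₂ m).2 h
          exact ⟨by change _ * _ - _ = 0; rw [e, e']; simp, by change _ * _ - _ = 0; rw [e, e']; simp⟩⟩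
      comm_a := fun m => by
        have e := congrArg (fun r => natLin 1 1 (Additive.ofMul r)) (D.comm_a m)
        have e' := congrArg (fun r => natLin 1 1 (Additive.ofMul r)) (D'.comm_a m)
        change natLin 1 1 (Additive.ofMul (D.a₁ _)) = natLin 1 1 (Additive.ofMul (D.a₂ _)) at e
        change natLin 1 1 (Additive.ofMul (D'.a₁ _)) = natLin 1 1 (Additive.ofMul (D'.a₂ _)) at e'
        exact congrArg₂ (fun x y => (Multiplicative.ofAdd (ULift.up (N * x - y, N * y - x)) : NatSq.{u}))
          e e' }
  obtain ⟨w, hw⟩ := exists_isPt E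
  have e₁ : z = w := hD.eq_of_natLin (D' := E) (show D.pc = E.pc from rfl) (α := N) (β := 1) (γ := γ) (by omega) one_pos hγ0
    (fun m => (arith _ _ (h₁ (Additive.ofMul m)) (h₁' (Additive.ofMul m))).1)
    (fun m => (arith _ _ (h₂ (Additive.ofMul m)) (h₂' (Additive.ofMul m))).1) hw
  have e₂ : z' = w := hD'.eq_of_natLin (D' := E) hc.symm (α := 1) (β := N) (γ := γ) one_pos (by omega) hγ0
    (fun m => (arith _ _ (h₁ (Additive.ofMul m)) (h₁' (Additive.ofMul m))).2)
    (fun m => (arith _ _ (h₂ (Additive.ofMul m)) (h₂' (Additive.ofMul m))).2) hw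
  exact e₁.trans e₂.symm

/-- Data whose units agree on torsion classes define points in the same connected component. -/
theorem IsPt.connectedComponent_eq [Module.Finite ℤ Q.coker] {K : Type u} [Field K] {j : κ →+* K}
    {D D' : Q.Datum K j}
    (hc : ∀ (n : ℕ) (e : Q.gp), 0 < n → n • e ∈ Q.rel → D.pc e = D'.pc e)
    {z z' : Q.Z.toScheme} (hD : IsPt D z) (hD' : IsPt D' z') :
    connectedComponent z = connectedComponent z' := by
  obtain ⟨A, _, _, jA, e₀, e₁, he₀, he₁, hA⟩ := exists_path_ring K
  -- By hypothesis this difference is trivial on torsion, so `exists_path_hom` joins it to the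
  -- trivial character over A. Twisting D by the resulting family gives a datum E over A.
  let ψ : Q.coker →+ Additive Kˣ := QuotientAddGroup.lift Q.rel (D'.pc - D.pc)
    fun e he => Datum.sub_eq_zero_of_mem_rel _ _ he
  let T : Submodule ℤ Q.coker := AddSubgroup.toIntSubmodule (AddCommGroup.torsion Q.coker)
  obtain ⟨Ψ, -, hΨ₀, hΨ₁⟩ := exists_path_hom e₀ e₁ hA T
    (fun n b hn hb => (isOfFinAddOrder_nsmul.1 hb).resolve_right hn.ne') ψ (by
      intro x hx
      obtain ⟨e, rfl⟩ := QuotientAddGroup.mk_surjective x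
      obtain ⟨n, hn, h⟩ := isOfFinAddOrder_iff_nsmul_eq_zero.1 hx
      have h' : n • e ∈ Q.rel := (QuotientAddGroup.eq_zero_iff _).1 h
      change D'.pc e - D.pc e = 0
      rw [hc n e hn h', sub_self])
  let E : Q.Datum A (jA.comp j) := (D.map jA (MonoidHom.id _) fun _ h => h).twist
    (Ψ.comp (QuotientAddGroup.mk' Q.rel)) fun e he => by
      rw [AddMonoidHom.comp_apply, QuotientAddGroup.mk'_apply, (QuotientAddGroup.eq_zero_iff e).2 he,
        map_zero]
  have hE : ∀ e, E.pc e = (Units.map jA.toMonoidHom).toAdditive (D.pc e) + Ψ e := fun e => by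
    rw [Datum.pc_twist, AddMonoidHom.add_apply, Datum.pc_map]
    rfl
  obtain ⟨φ, hφ⟩ := exists_realizes E
  -- The specialisation of E along ε has the units of D₁ but the monoid part of D. By
  -- `IsPt.eq_of_pc_eq` the points nevertheless agree, so z and z' both lie in the image of Spec A,
  -- which is connected as A is a domain.
  have key : ∀ (ε : A →+* K) (_ : ε.comp jA = RingHom.id K) (D₁ : Q.Datum K j)
      (_ : ∀ e : Q.gp, (Units.map ε.toMonoidHom).toAdditive (Ψ e) = D₁.pc e - D.pc e)
      (w : Q.Z.toScheme) (_ : IsPt D₁ w), w ∈ Set.range φ.base := by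
    intro ε hε D₁ h w hw
    obtain ⟨E₁, φ₁, hφ₁, hb, hc, -⟩ := hφ.exists_map ε j
      (by rw [← RingHom.comp_assoc, hε, RingHom.id_comp]) (MonoidHom.id _) fun _ h => h
    have h1 : D₁.pc = E₁.pc := AddMonoidHom.ext fun e => by
      have h2 : (Units.map ε.toMonoidHom).toAdditive
          ((Units.map jA.toMonoidHom).toAdditive (D.pc e)) = D.pc e :=
        Additive.toMul.injective (Units.ext (congr($hε (D.pc e).toMul)))
      rw [hc, hE, map_add, h, h2, add_sub_cancel]
    refine ⟨Spec.map (CommRingCat.ofHom ε) default, ?_⟩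
    refine Eq.symm (hw.eq_of_pc_eq h1 ⟨φ₁, _, hφ₁, hb, ?_⟩)
    exact Scheme.Hom.comp_apply (Spec.map (CommRingCat.ofHom ε)) φ.base default
  have h₀ := key e₀ he₀ D (fun e => by rw [hΨ₀, sub_self]) z hD
  have h₁ := key e₁ he₁ D' (fun e => hΨ₁ e) z' hD'
  have hA' : PreconnectedSpace (Spec (.of A)) := inferInstance
  have : _root_.IsPreconnected (Set.range φ.base) :=
    isPreconnected_range (α := Spec (.of A)) φ.base.continuous
  exact _root_.connectedComponent_eq (this.subset_connectedComponent h₀ h₁)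

end FsSquare

/-! ### Counting the connected components -/

open Algebra

namespace FsSquare

variable {κ : Type u} [Field κ] [IsAlgClosed κ] {Q : FsSquare κ} (D₀ : Q.Datum κ (RingHom.id κ))

theorem map_units_injective {K : Type u} [Field K] (j : κ →+* K) :
    Function.Injective (Units.map j.toMonoidHom).toAdditive := fun _ _ h =>
  Additive.toMul.injective (Units.ext (j.injective
    (congrArg (fun z : Additive Kˣ => (z.toMul : K)) h)))

/-- The point `z` is given by a datum whose character restricts to `η` on torsion classes. -/
def HasChar (z : Q.Z.toScheme) (η : AddCommGroup.torsion Q.coker →+ Additive κˣ) : Prop :=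
  ∃ (K : Type u) (_ : Field K) (_ : IsAlgClosed K) (j : κ →+* K) (D : Q.Datum K j), IsPt D z ∧
    ∀ (e : Q.gp) (he : (e : Q.coker) ∈ AddCommGroup.torsion Q.coker),
      Datum.chi D₀ D e = (Units.map j.toMonoidHom).toAdditive (η ⟨e, he⟩)

theorem exists_nsmul_mem_rel {e : Q.gp} (he : (e : Q.coker) ∈ AddCommGroup.torsion Q.coker) :
    ∃ n : ℕ, 0 < n ∧ n • e ∈ Q.rel := by
  obtain ⟨n, hn, h⟩ := isOfFinAddOrder_iff_nsmul_eq_zero.1 he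
  exact ⟨n, hn, (QuotientAddGroup.eq_zero_iff _).1 h⟩

theorem mk_mem_torsion {e : Q.gp} {n : ℕ} (hn : 0 < n) (he : n • e ∈ Q.rel) :
    (e : Q.coker) ∈ AddCommGroup.torsion Q.coker :=
  isOfFinAddOrder_iff_nsmul_eq_zero.2 ⟨n, hn, (QuotientAddGroup.eq_zero_iff _).2 he⟩

theorem exists_hasChar (z : Q.Z.toScheme) : ∃ η, HasChar D₀ z η := by
  obtain ⟨K, _, _, φ, b, hb, hz⟩ := exists_hollow_point Q.fsZ z
  obtain ⟨j, D, hφ⟩ := exists_datum_of_hom φ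
  let J := (Units.map j.toMonoidHom).toAdditive
  let X : Q.coker →+ Additive Kˣ := QuotientAddGroup.lift Q.rel (Datum.chi D₀ D)
    fun e he => Datum.chi_of_mem_rel D₀ D he
  have h : ∀ t : AddCommGroup.torsion Q.coker, ∃ ζ : Additive κˣ, J ζ = X t := by
    rintro ⟨t, ht⟩
    obtain ⟨e, rfl⟩ := QuotientAddGroup.mk_surjective t
    obtain ⟨n, hn, he⟩ := exists_nsmul_mem_rel ht
    obtain ⟨ζ, -, hζ⟩ := exists_chi_eq D₀ D hn he
    exact ⟨Additive.ofMul ζ, congrArg Additive.ofMul hζ⟩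
  choose η hη using h
  refine ⟨
    { toFun := η
      map_zero' := map_units_injective j ((hη 0).trans ((map_zero X).trans (map_zero J).symm))
      map_add' := fun x y => map_units_injective j ((hη _).trans ((map_add X _ _).trans
        ((congrArg₂ (· + ·) (hη x) (hη y)).symm.trans (map_add J _ _).symm))) },
    K, inferInstance, inferInstance, j, D, ⟨φ, b, hφ, hb, hz⟩, fun e he => (hη ⟨e, he⟩).symm⟩

/-- By divisibility of κˣ, η extends from the torsion to all of `coker`, and D₀ is twisted by the
extension. -/
theorem exists_hasChar_of_hom (η : AddCommGroup.torsion Q.coker →+ Additive κˣ) :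
    ∃ z, HasChar D₀ z η := by
  obtain ⟨ψ, hψ⟩ := exists_extension_units (AddCommGroup.torsion Q.coker).subtype
    Subtype.val_injective η
  let D := D₀.twist (ψ.comp (QuotientAddGroup.mk' Q.rel)) fun e he => by
    rw [AddMonoidHom.comp_apply, QuotientAddGroup.mk'_apply, (QuotientAddGroup.eq_zero_iff e).2 he,
      map_zero]
  obtain ⟨z, hz⟩ := exists_isPt D
  refine ⟨z, κ, inferInstance, inferInstance, RingHom.id κ, D, hz, fun e he => ?_⟩
  have h1 : D.pc e = D₀.pc e + ψ e := by
    rw [Datum.pc_twist]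
    rfl
  refine (congrArg (· - D₀.pc e) h1).trans ((add_sub_cancel_left _ _).trans ?_)
  exact DFunLike.congr_fun hψ ⟨e, he⟩

variable {D₀}

/-- The two data may live over different fields. Over a common extension their homomorphisms agree
on torsion classes, as both are given there by η and D₀. -/
theorem HasChar.connectedComponent_eq [Module.Finite ℤ Q.coker] {z z' : Q.Z.toScheme}
    {η : AddCommGroup.torsion Q.coker →+ Additive κˣ} (h : HasChar D₀ z η)
    (h' : HasChar D₀ z' η) : connectedComponent z = connectedComponent z' := by
  obtain ⟨K, _, _, j, D, hD, hη⟩ := h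
  obtain ⟨K', _, _, j', D', hD', hη'⟩ := h'
  obtain ⟨L, _, _, g, g', hg⟩ := exists_common_extension j j'
  obtain ⟨E, hE, hEc, -⟩ := hD.exists_map g (g.comp j) rfl (MonoidHom.id _) fun _ h => h
  obtain ⟨E', hE', hEc', -⟩ := hD'.exists_map g' (g.comp j) hg.symm (MonoidHom.id _) fun _ h => h
  refine hE.connectedComponent_eq (fun n e hn he => ?_) hE'
  have h1 : ∀ {F : Type u} [Field F] {i : κ →+* F} (D : Q.Datum F i), D.pc e =
      Datum.chi D₀ D e + (Units.map i.toMonoidHom).toAdditive (D₀.pc e) := fun D =>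
    (sub_add_cancel _ _).symm
  rw [hEc, hEc', h1 D, h1 D', hη e (mk_mem_torsion hn he), hη' e (mk_mem_torsion hn he), ← map_add,
    ← map_add]
  exact Additive.toMul.injective (Units.ext (congr($hg _)))

theorem HasChar.exists_isOpen {z : Q.Z.toScheme}
    {η : AddCommGroup.torsion Q.coker →+ Additive κˣ} (h : HasChar D₀ z η)
    (t : AddCommGroup.torsion Q.coker) : ∃ O : Set Q.Z.toScheme, IsOpen O ∧ z ∈ O ∧
      ∀ z' ∈ O, ∀ η', HasChar D₀ z' η' → η' t = η t := by
  obtain ⟨t, ht⟩ := t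
  obtain ⟨e, rfl⟩ := QuotientAddGroup.mk_surjective t
  obtain ⟨n, hn, he⟩ := exists_nsmul_mem_rel ht
  obtain ⟨O, ζ, hO, hz, hζ⟩ := exists_isOpen_chi D₀ hn he z
  have key : ∀ z' ∈ O, ∀ η', HasChar D₀ z' η' → η' ⟨_, ht⟩ = Additive.ofMul ζ := by
    rintro z' hz' η' ⟨K, _, _, j, D, ⟨φ, b, hφ, hb, rfl⟩, h⟩
    refine map_units_injective j ?_
    exact (h e ht).symm.trans (congrArg Additive.ofMul (hζ K j D φ hφ b hb hz'))
  exact ⟨O, hO, hz, fun z' hz' η' h' => (key z' hz' η' h').trans (key z hz η h).symm⟩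

theorem card_connectedComponents [CharZero κ] [Module.Finite ℤ Q.coker]
    [Finite (AddCommGroup.torsion Q.coker)] [Nonempty Q.Z.toScheme] :
    Finite (_root_.ConnectedComponents Q.Z.toScheme) ∧
      Nat.card (_root_.ConnectedComponents Q.Z.toScheme) =
        Nat.card (AddCommGroup.torsion Q.coker) := by
  obtain ⟨z₀⟩ := ‹Nonempty Q.Z.toScheme›
  obtain ⟨K, _, _, φ, -⟩ := exists_hollow_point Q.fsZ z₀
  obtain ⟨j, D, -⟩ := exists_datum_of_hom φ
  obtain ⟨D₀⟩ := exists_datum D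
  choose f hf using exists_hasChar D₀
  have hloc : IsLocallyConstant f := (IsLocallyConstant.iff_exists_open f).2 fun z => by
    choose O hO hz h using (hf z).exists_isOpen
    exact ⟨⋂ t, O t, isOpen_iInter_of_finite hO, Set.mem_iInter.2 hz, fun z' hz' =>
      AddMonoidHom.ext fun t => h t z' (Set.mem_iInter.1 hz' t) _ (hf z')⟩
  -- Independence of the character from the field and the datum comes from the open set of
  -- `HasChar.exists_isOpen`, which contains z itself.
  have huniq : ∀ z η, HasChar D₀ z η → η = f z := fun z η h => AddMonoidHom.ext fun t => by
    obtain ⟨O, -, hz, h'⟩ := (hf z).exists_isOpen t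
    exact h' z hz η h
  have hlift : ∀ z z' : Q.Z.toScheme, connectedComponent z = connectedComponent z' → f z = f z' :=
    fun z z' h => hloc.apply_eq_of_isPreconnected isPreconnected_connectedComponent
      (s := connectedComponent z') (h ▸ mem_connectedComponent) mem_connectedComponent
  let F : _root_.ConnectedComponents Q.Z.toScheme → (AddCommGroup.torsion Q.coker →+ Additive κˣ) :=
    Quotient.lift f hlift
  have hF : Function.Bijective F := by
    constructor
    · rintro ⟨z⟩ ⟨z'⟩ h
      have h' : f z = f z' := h
      exact ConnectedComponents.coe_eq_coe.2 ((hf z).connectedComponent_eq (h' ▸ hf z'))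
    · intro η
      obtain ⟨z, hz⟩ := exists_hasChar_of_hom D₀ η
      exact ⟨ConnectedComponents.mk z, (huniq z η hz).symm⟩
  have hc := card_hom_units (K := κ) (AddCommGroup.torsion Q.coker)
  have : Finite (AddCommGroup.torsion Q.coker →+ Additive κˣ) :=
    Nat.finite_of_card_ne_zero (hc ▸ Nat.card_pos.ne')
  exact ⟨Finite.of_injective F hF.1, (Nat.card_congr (Equiv.ofBijective F hF)).trans hc⟩

end FsSquare

end LogGeometry

/-! ### Application to the fibre product of fs log schemes -/

theorem mainTheorem3 {κ : Type u} [Field κ] [IsAlgClosed κ] [CharZero κ]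
    (W₁ W₂ X : FsLogScheme.{u})
    [ConnectedSpace W₁.obj.toScheme] [ConnectedSpace W₂.obj.toScheme]
    [ConnectedSpace X.obj.toScheme]
    -- the structure morphisms to `Spec κ`; over a field, "finite length" means "finite"
    (s₁ : W₁.obj.toScheme ⟶ Spec (.of κ)) (s₂ : W₂.obj.toScheme ⟶ Spec (.of κ))
    (s : X.obj.toScheme ⟶ Spec (.of κ)) [IsFinite s₁] [IsFinite s₂] [IsFinite s]
    -- morphisms `fᵢ : Wᵢ ⟶ X` of log schemes over `Spec κ`
    (f₁ : W₁ ⟶ X) (f₂ : W₂ ⟶ X)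
    (hf₁ : f₁.hom.base ≫ s = s₁) (hf₂ : f₂.hom.base ≫ s = s₂)
    -- geometric points of the one-point schemes `Wᵢ`, `X`, at which the stalks `Q₁`, `Q₂`, `P` are taken
    (w₁ : Spec (.of κ) ⟶ W₁.obj.toScheme) (w₂ : Spec (.of κ) ⟶ W₂.obj.toScheme)
    (x : Spec (.of κ) ⟶ X.obj.toScheme)
    (h₁ : w₁ ≫ f₁.hom.base = x) (h₂ : w₂ ≫ f₂.hom.base = x)
    (θ₁ : X.obj.ghost x →+ W₁.obj.ghost w₁) (hθ₁ : θ₁ = LogScheme.ghostMap f₁.hom w₁ x h₁)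
    (θ₂ : X.obj.ghost x →+ W₂.obj.ghost w₂) (hθ₂ : θ₂ = LogScheme.ghostMap f₂.hom w₂ x h₂) :
    -- (1) `Z` is the fibre product `W₁ ×_X W₂` in the category of fs log schemes
    (∀ (Z : FsLogScheme.{u}) (p₁ : Z ⟶ W₁) (p₂ : Z ⟶ W₂), IsPullback p₁ p₂ f₁ f₂ →
      Nonempty Z.obj.toScheme →
        Finite (_root_.ConnectedComponents Z.obj.toScheme) ∧
          Nat.card (_root_.ConnectedComponents Z.obj.toScheme) = Nat.card (cokerTors (theta θ₁ θ₂))) ∧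
    -- (2)
    Finite (cokerTors (theta θ₁ θ₂)) ∧
      Finite (cokerTors (thetaTranspose θ₁ θ₂)) ∧
        Nat.card (cokerTors (theta θ₁ θ₂)) = Nat.card (cokerTors (thetaTranspose θ₁ θ₂)) := by
  have hQ₁ := isFsStalk_stalk W₁.property w₁
  have hQ₂ := isFsStalk_stalk W₂.property w₂
  have hP := isFsStalk_stalk X.property x
  have := hQ₁.finite_gp
  have := hQ₂.finite_gp
  have := hP.finite_gp
  have := hQ₁.free_gp
  have := hQ₂.free_gp
  have := hP.free_gp
  refine ⟨fun Z p₁ p₂ hZ _ => ?_, card_cokerTors_thetaTranspose θ₁ θ₂⟩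
  subst hθ₁ hθ₂
  -- Hollow log schemes with monoid ℕ² are fs, so the universal property of the fs fibre product may
  -- be tested on them; nothing else about it is used beyond `Z` being fs and the square commuting.
  let H (S : Scheme.{u}) : FsLogScheme.{u} := ⟨hollow NatSq S, isFs_hollow S natSq_isFsMonoid⟩
  let Q : FsSquare κ :=
    { W₁ := W₁.obj
      W₂ := W₂.obj
      X := X.obj
      Z := Z.obj
      s₁ := s₁
      s₂ := s₂
      s := s
      f₁ := f₁.hom
      f₂ := f₂.hom
      p₁ := p₁.hom
      p₂ := p₂.hom
      hf₁ := hf₁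
      hf₂ := hf₂
      comm := congrArg (fun f => f.hom) hZ.w
      exists_lift := fun S φ₁ φ₂ h => by
        let g₁ : H S ⟶ W₁ := ⟨φ₁⟩
        let g₂ : H S ⟶ W₂ := ⟨φ₂⟩
        obtain ⟨l, h₁, h₂⟩ := hZ.exists_lift g₁ g₂ (ObjectProperty.hom_ext _ h)
        exact ⟨l.hom, congrArg (fun f => f.hom) h₁, congrArg (fun f => f.hom) h₂⟩
      hom_ext := fun S φ ψ h₁ h₂ => by
        let g : H S ⟶ Z := ⟨φ⟩
        let g' : H S ⟶ Z := ⟨ψ⟩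
        have hg : g = g' := hZ.hom_ext (ObjectProperty.hom_ext _ h₁) (ObjectProperty.hom_ext _ h₂)
        exact congrArg (fun f => f.hom) hg
      fs₁ := W₁.property
      fs₂ := W₂.property
      fsZ := Z.property }
  obtain ⟨e⟩ := Q.nonempty_cokerEquiv w₁ w₂ x h₁ h₂
  have hc : Module.Finite ℤ Q.coker :=
    have := Module.Finite.of_surjective (QuotientAddGroup.mk' (theta (LogScheme.ghostMap f₁.hom w₁ x h₁)
      (LogScheme.ghostMap f₂.hom w₂ x h₂)).range).toIntLinearMap
      (QuotientAddGroup.mk'_surjective _)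
    Module.Finite.equiv e.symm.toIntLinearEquiv
  let e' : AddCommGroup.torsion Q.coker ≃ cokerTors (theta (LogScheme.ghostMap f₁.hom w₁ x h₁)
      (LogScheme.ghostMap f₂.hom w₂ x h₂)) :=
    e.toEquiv.subtypeEquiv fun t =>
      (e.injective.isOfFinAddOrder_iff (f := e.toAddMonoidHom)).symm
  have ht : Finite (AddCommGroup.torsion Q.coker) :=
    have := finite_cokerTors (theta (LogScheme.ghostMap f₁.hom w₁ x h₁)
      (LogScheme.ghostMap f₂.hom w₂ x h₂))
    Finite.of_equiv _ e'.symm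
  have hZ' : Nonempty Q.Z.toScheme := ‹_›
  have hcard := Q.card_connectedComponents
  exact ⟨hcard.1, hcard.2.trans (Nat.card_congr e')⟩
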